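/- **Setting.** Let $A(\lambda)=\sum_{j=0}^m\lambda^jA_j\in\mathbb C[\lambda]^{n\times n}$ be regular of degree $m$, let $D(\lambda)=\sum_{j=0}^k\lambda^jD_j\in\mathbb C[\lambda]^{r\times r}$ have degree $k$, and let $B\in\mathbb C^{n\times r}$, $C\in\mathbb C^{r\times n}$ be arbitrary. Put $\mathcal S(\lambda)=\begin{bmatrix}A(\lambda)&B\\ C&D(\lambda)\end{bmatrix}$ (the convention with upper right block $-B$ is obtained by replacing $B$ by $-B$ throughout). **Index tuples.** Write $(a:b)=(a,a+1,\dots,b)$, empty if $a>b$. An index tuple (finite tuple of integers) satisfies the *SIP* if between any two equal entries $j$ there is an entry $j+1$. Two tuples are *equivalent* if one is obtained from the other by interchanging neighbouring entries $i,j$ with $|i-j|>1$. For an index tuple $\gamma$, $c_0(\gamma)$ (resp. $i_0(\gamma)$) is the largest $s$ such that $(0,1,\dots,s)$ (resp. $(s,\dots,1,0)$) is a subtuple of $\gamma$, and is $-1$ if $0\notin\gamma$. For an integer $\rho\ge 0$, a *simple admissible tuple* of $\{0,\dots,\rho\}$ is a permutation of $\{0,\dots,\rho\}$ equivalent to $(\rho-1:\rho,\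 \rho-3:\rho-2,\dots,q+1:q+2,\ 0:q)$ with $q\in\{0,1\}$ and $\rho-q$ even; its *symmetric complement* is $(\rho-1,\rho-3,\dots,q+1)$, followed by the entry $0$ if $q=1$. A tuple is in *canonical form for $\rho$* if it is $(s_1:\rho-2,\ s_2:\rho-4,\dots,s_{\lfloor \rho/2\rfloor}:\rho-2\lfloor \rho/2\rfloor)$ with all $s_j\ge0$. **Elementary matrices.** For $P\in\mathbb C^{n\times n}$ let $M_0(P)=\mathrm{diag}(I_{(m-1)n},P)$, $M_{-m}(P)=\mathrm{diag}(P,I_{(m-1)n})$ and, for $1\le i\le m-1$, $M_i(P)=\mathrm{diag}\bigl(I_{(m-i-1)n},\begin{bmatrix}P&I_n\\I_n&0\end{bmatrix},I_{(i-1)n}\bigr)$, $M_{-i}(P)=\mathrm{diag}\bigl(I_{(m-i-1)n},\begin{bmatrix}0&I_n\\I_n&P\end{bmatrix},I_{(i-1)n}\bigr)$. A matrix assignment for $p=(p_1,\dots,p_t)$ is a tuple $P=(P_1,\dots,P_t)$ of $n\times n$ matrices; $M_p(P)=M_{p_1}(P_1)\cdots M_{p_t}(P_t)$. It is nonsingular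 if the matrices assigned to the entries $0$ and $-m$ are nonsingular. $M^A_p$ is the product for the assignment $-A_i$ at $i\ge0$ and $A_{-i}$ at $i<0$. The matrices $N_p(P)$, $N^D_p$ are defined in the same way for $D(\lambda)$, with $(k,r)$ in place of $(m,n)$. **GFPR.** Let $0\le h\le m-1$; let $\sigma$ be a permutation of $\{0,\dots,h\}$ and $\tau$ one of $\{-m,\dots,-h-1\}$; let $\sigma_1,\sigma_2$ have entries in $\{0,\dots,h-1\}$ and $\tau_1,\tau_2$ in $\{-m,\dots,-h-2\}$, with $(\sigma_1,\sigma,\sigma_2)$ and $(\tau_1,\tau,\tau_2)$ satisfying the SIP; let $X_1,X_2,Y_1,Y_2$ be matrix assignments for $\sigma_1,\sigma_2,\tau_1,\tau_2$. Put $L_A(\lambda)=M_{(\tau_1,\sigma_1)}(Y_1,X_1)(\lambda M^A_\tau-M^A_\sigma)M_{(\sigma_2,\tau_2)}(X_2,Y_2)$. Let $L_D(\lambda)$ be built in the same way for $D(\lambda)$ from $0\le\ell\le k-1$ and tuples $\gamma,\delta,\gamma_1,\gamma_2,\delta_1,\delta_2$ (in the roles of $\sigma,\tau,\sigma_1,\sigma_2,\tau_1,\tau_2$).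 Every pencil $$\begin{bmatrix}L_A(\lambda)& e_{m-i_0(\sigma_1,\sigma)}e_{k-c_0(\gamma,\gamma_2)}^T\otimes B\\ e_{k-i_0(\gamma_1,\gamma)}e_{m-c_0(\sigma,\sigma_2)}^T\otimes C& L_D(\lambda)\end{bmatrix}$$ is called a GFPR of $\mathcal S(\lambda)$. **Block symmetry.** A block matrix written as $\begin{bmatrix}\mathcal A&uv^T\otimes B\\ sz^T\otimes C&\mathcal D\end{bmatrix}$ is block symmetric if it equals its Rosenbrock block transpose $\begin{bmatrix}\mathcal A^{\mathcal B}&zs^T\otimes B\\ vu^T\otimes C&\mathcal D^{\mathcal B}\end{bmatrix}$ with $\mathcal A^{\mathcal B}=[\mathcal A_{ji}]$, $\mathcal D^{\mathcal B}=[\mathcal D_{ji}]$, in the sense that $\mathcal A^{\mathcal B}=\mathcal A$, $\mathcal D^{\mathcal B}=\mathcal D$, $u=z$, $v=s$. **Rosenbrock linearization.** A pencil $\mathbb L(\lambda)$ of size $mn+kr$ is a Rosenbrock linearization of $\mathcal S(\lambda)$ if there are unimodular matrix polynomials $U_A,V_A$ of size $mn$ and $U_D,V_D$ of size $kr$ with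 $\mathrm{diag}(U_A,U_D)\,\mathbb L\,\mathrm{diag}(V_A,V_D)=\mathrm{diag}(I_{(m-1)n},\mathcal S,I_{(k-1)r})$. **Theorem.** Let $h\in\{0,\dots,m-1\}$ and $\ell\in\{0,\dots,k-1\}$ be even. Let $w_h$ and $v_h+m$ be simple admissible tuples of $\{0,\dots,h\}$ and $\{0,\dots,m-h-1\}$ with symmetric complements $c_{w_h}$ and $c_{v_h}+m$; let $t_{w_h}$ and $t_{v_h}+m$ be in canonical form for $h$ and $m-h-1$; let $X_A,Y_A$ be nonsingular matrix assignments for $t_{w_h},t_{v_h}$. Let $w_\ell,v_\ell,c_{w_\ell},c_{v_\ell},t_{w_\ell},t_{v_\ell},X_D,Y_D$ be given in the same way with $(k,\ell)$ in place of $(m,h)$. Put $$\mathbb L(\lambda)=\begin{bmatrix}L_A(\lambda)& e_{m-i_0(t_{w_h},w_h)}e^T_{k-c_0(w_\ell,c_{w_\ell},\mathrm{rev}\,t_{w_\ell})}\otimes B\\ e_{k-i_0(t_{w_\ell},w_\ell)}e^T_{m-c_0(w_h,c_{w_h},\mathrm{rev}\,t_{w_h})}\otimes C& L_D(\lambda)\end{bmatrix},$$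 $$L_A(\lambda)=M_{(t_{v_h},t_{w_h})}(Y_A,X_A)\,(\lambda M^A_{v_h}-M^A_{w_h})\,M^A_{(c_{w_h},c_{v_h})}\,M_{(\mathrm{rev}\,t_{w_h},\mathrm{rev}\,t_{v_h})}(\mathrm{rev}\,X_A,\mathrm{rev}\,Y_A),$$ $$L_D(\lambda)=N_{(t_{v_\ell},t_{w_\ell})}(Y_D,X_D)\,(\lambda N^D_{v_\ell}-N^D_{w_\ell})\,N^D_{(c_{w_\ell},c_{v_\ell})}\,N_{(\mathrm{rev}\,t_{w_\ell},\mathrm{rev}\,t_{v_\ell})}(\mathrm{rev}\,X_D,\mathrm{rev}\,Y_D).$$ Then: 1. $\mathbb L(\lambda)$ is a GFPR of $\mathcal S(\lambda)$, and it is block symmetric. 2. If $A(\lambda)$ and $D(\lambda)$ are symmetric, $C=B^T$, and all matrices in $X_A,Y_A,X_D,Y_D$ are symmetric, then $\mathbb L(\lambda)$ is symmetric. 3. If $m$ and $k$ are both odd, then $\mathbb L(\lambda)$ is a Rosenbrock linearization of $\mathcal S(\lambda)$. 4. In general, $\mathbb L(\lambda)$ is a Rosenbrock linearization of $\mathcal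 S(\lambda)$ provided that $A_m$ is nonsingular if $m$ is even, and $D_k$ is nonsingular if $k$ is even. -/

import Mathlib

open Polynomial Matrix

/-! ### Index tuples -/

/-- The string `(a : b) = (a, a+1, …, b)`, empty if `b < a`. -/
def seg (a b : ℤ) : List ℤ := (List.range (b + 1 - a).toNat).map fun i => a + (i : ℤ)

/-- `γ + c`. -/
def shiftTuple (γ : List ℤ) (c : ℤ) : List ℤ := γ.map fun i => i + c

/-- The successor infix property: between any two equal entries `j` there is an entry `j + 1`.
The property is invariant under shifts, so it also applies to tuples with negative entries. -/
def SIP (γ : List ℤ) : Prop :=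
  ∀ s t : Fin γ.length, s < t → γ.get s = γ.get t →
    ∃ p : Fin γ.length, s < p ∧ p < t ∧ γ.get p = γ.get s + 1

/-- One interchange of two neighbouring entries `i`, `j` with `|i - j| > 1`. -/
def TupleSwap (γ δ : List ℤ) : Prop :=
  ∃ (α β : List ℤ) (i j : ℤ), 1 < |i - j| ∧ γ = α ++ i :: j :: β ∧ δ = α ++ j :: i :: β

/-- Equivalence of index tuples: `γ` becomes `δ` by finitely many such interchanges.  A tuple with
the successor infix property has exactly one equivalent tuple in column standard form. -/
def TupleEquiv (γ δ : List ℤ) : Prop := Relation.ReflTransGen TupleSwap γ δ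

/-- The number `c_p(γ)` of consecutive consecutions of `γ` at `p` (`-1` if `p ∉ γ`):
the largest `s` such that `(p, p+1, …, p+s)` is a subtuple of `γ`. -/
def consecutions (p : ℤ) (γ : List ℤ) : ℤ :=
  if p ∈ γ then
    (Nat.findGreatest (fun s : ℕ => (seg p (p + s)).Sublist γ) γ.length : ℤ)
  else -1

/-- The number `i_p(γ)` of consecutive inversions of `γ` at `p` (`-1` if `p ∉ γ`):
the largest `s` such that `(p+s, …, p+1, p)` is a subtuple of `γ`. -/
def inversions (p : ℤ) (γ : List ℤ) : ℤ :=
  if p ∈ γ then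
    (Nat.findGreatest (fun s : ℕ => (seg p (p + s)).reverse.Sublist γ) γ.length : ℤ)
  else -1

/-- The column standard form `(ρ-1 : ρ, ρ-3 : ρ-2, …, q+1 : q+2, 0 : q)`. -/
def admissibleForm (ρ q : ℕ) : List ℤ :=
  (List.range ((ρ - q) / 2)).flatMap
    (fun j => seg ((ρ : ℤ) - 1 - 2 * (j : ℤ)) ((ρ : ℤ) - 2 * (j : ℤ))) ++ seg 0 (q : ℤ)

/-- `γ` is an admissible tuple of `{0, …, ρ}` with index `q`: a permutation of `{0, …, ρ}` whose
column standard form is `admissibleForm ρ q`. -/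
def IsAdmissible (ρ q : ℕ) (γ : List ℤ) : Prop :=
  q ≤ ρ ∧ Even (ρ - q) ∧ γ.Perm (seg 0 (ρ : ℤ)) ∧ TupleEquiv γ (admissibleForm ρ q)

/-- A simple admissible tuple: the index is `0` or `1`. -/
def IsSimpleAdmissible (ρ q : ℕ) (γ : List ℤ) : Prop := IsAdmissible ρ q γ ∧ (q = 0 ∨ q = 1)

/-- The symmetric complement `(ρ-1, ρ-3, …, q+1, 0 : q-1, 0 : q-2, …, 0 : 1, 0)` of an admissible
tuple of `{0, …, ρ}` with index `q`; for `q = 0` it is `(ρ-1, ρ-3, …, 1)`, empty if `ρ = 0`. -/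
def symmComplement (ρ q : ℕ) : List ℤ :=
  (List.range ((ρ - q) / 2)).map (fun j => (ρ : ℤ) - 1 - 2 * (j : ℤ)) ++
    (List.range q).flatMap (fun j => seg 0 ((q : ℤ) - 1 - (j : ℤ)))

/-- `γ = (s₁ : ρ-2, s₂ : ρ-4, …, s_⌊ρ/2⌋ : ρ - 2⌊ρ/2⌋)` with all `s_j ≥ 0`. -/
def IsCanonicalForm (ρ : ℕ) (γ : List ℤ) : Prop :=
  ∃ s : ℕ → ℕ, γ = (List.range (ρ / 2)).flatMap
    (fun j => seg (s (j + 1) : ℤ) ((ρ : ℤ) - 2 * ((j : ℤ) + 1)))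

/-! ### Elementary block matrices and matrix assignments -/

/-- The elementary matrix `M_i(P)`, `-m ≤ i ≤ m - 1`, as an `m × m` block matrix.  For `i = 0` and
`i = -m` it is block diagonal with `P` in the last, respectively first, place.  For
`1 ≤ |i| ≤ m - 1` it is the identity except in the (zero-based) block rows and columns
`m - |i| - 1`, `m - |i|`, where it is `[P I; I 0]` if `i > 0` and `[0 I; I P]` if `i < 0`. -/
def elemMatrix {R : Type*} [Ring R] (m : ℕ) {n : ℕ} (i : ℤ) (P : Matrix (Fin n) (Fin n) R) :
    Matrix (Fin m × Fin n) (Fin m × Fin n) R :=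
  Matrix.of fun x y =>
    let a : ℤ := (x.1 : ℕ)
    let b : ℤ := (y.1 : ℕ)
    let s : ℤ := (m : ℤ) - |i|
    let one : Matrix (Fin n) (Fin n) R := 1
    let blk : Matrix (Fin n) (Fin n) R :=
      if i = 0 then
        if a = b then (if a = (m : ℤ) - 1 then P else one) else 0
      else if i = -(m : ℤ) then
        if a = b then (if a = 0 then P else one) else 0
      else if a = s - 1 ∧ b = s - 1 then (if 0 < i then P else 0)
      else if a = s ∧ b = s then (if 0 < i then 0 else P)
      else if (a = s - 1 ∧ b = s) ∨ (a = s ∧ b = s - 1) then one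
      else if a = b then one else 0
    blk x.2 y.2

/-- `M_p(P) = M_{p₁}(P₁) M_{p₂}(P₂) ⋯` for a matrix assignment `P` for `p`. -/
def assignProd {R : Type*} [Ring R] (m : ℕ) {n : ℕ} (p : List ℤ)
    (P : List (Matrix (Fin n) (Fin n) R)) : Matrix (Fin m × Fin n) (Fin m × Fin n) R :=
  (List.zipWith (fun i Q => elemMatrix m i Q) p P).prod

/-- `P` is a matrix assignment for the index tuple `p`. -/
def IsAssignment {n : ℕ} (p : List ℤ) (P : List (Matrix (Fin n) (Fin n) ℂ)) : Prop :=
  P.length = p.length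

/-- `P` is a nonsingular matrix assignment for `p`: the matrices assigned to the positions `0` and
`-m` are nonsingular. -/
def IsNonsingularAssignment (m : ℕ) {n : ℕ} (p : List ℤ)
    (P : List (Matrix (Fin n) (Fin n) ℂ)) : Prop :=
  IsAssignment p P ∧ ∀ x ∈ List.zip p P, (x.1 = 0 ∨ x.1 = -(m : ℤ)) → IsUnit x.2.det

noncomputable section

/-! ### Matrix polynomials -/

/-- The coefficient `A_j` of `λ^j` in `A(λ)`. -/
def matCoeff {n : ℕ} (A : Matrix (Fin n) (Fin n) ℂ[X]) (j : ℕ) : Matrix (Fin n) (Fin n) ℂ :=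
  A.map fun p => p.coeff j

/-- `A(λ)` has degree `m`. -/
def HasMatDegree {n : ℕ} (A : Matrix (Fin n) (Fin n) ℂ[X]) (m : ℕ) : Prop :=
  matCoeff A m ≠ 0 ∧ ∀ j, m < j → matCoeff A j = 0

/-- The trivial matrix assignment for `p`: `-A_i` at `i ≥ 0` and `A_{-i}` at `i < 0`. -/
def trivialAssignment {n : ℕ} (A : Matrix (Fin n) (Fin n) ℂ[X]) (p : List ℤ) :
    List (Matrix (Fin n) (Fin n) ℂ) :=
  p.map fun i => if 0 ≤ i then -matCoeff A i.toNat else matCoeff A (-i).toNat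

/-- `M^A_p`, a product of Fiedler matrices of `A(λ)`. -/
def fiedlerProd (m : ℕ) {n : ℕ} (A : Matrix (Fin n) (Fin n) ℂ[X]) (p : List ℤ) :
    Matrix (Fin m × Fin n) (Fin m × Fin n) ℂ :=
  assignProd m p (trivialAssignment A p)

/-- A constant matrix regarded as a matrix polynomial. -/
def constMat {ι κ : Type*} (M : Matrix ι κ ℂ) : Matrix ι κ ℂ[X] := M.map Polynomial.C

/-- The pencil `P (λ E - F) Q`. -/
def pencilProd {ι : Type*} [Fintype ι] (P E F Q : Matrix ι ι ℂ) : Matrix ι ι ℂ[X] :=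
  constMat P * ((Polynomial.X : ℂ[X]) • constMat E - constMat F) * constMat Q

/-- The system matrix `[A(λ) B; C D(λ)]`. -/
def systemMatrix {n r : ℕ} (A : Matrix (Fin n) (Fin n) ℂ[X]) (B : Matrix (Fin n) (Fin r) ℂ)
    (C : Matrix (Fin r) (Fin n) ℂ) (D : Matrix (Fin r) (Fin r) ℂ[X]) :
    Matrix (Fin n ⊕ Fin r) (Fin n ⊕ Fin r) ℂ[X] :=
  Matrix.fromBlocks A (constMat B) (constMat C) D

/-! ### Block system matrices, Rosenbrock block transpose, Rosenbrock linearizations -/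

/-- A block system matrix `[𝒜, u vᵀ ⊗ B; s zᵀ ⊗ C, 𝒟]`, where `𝒜` is an `m × m` block matrix with
`n × n` blocks and `𝒟` is a `k × k` block matrix with `r × r` blocks. -/
structure BlockSystem (m n k r : ℕ) where
  blkA : Matrix (Fin m × Fin n) (Fin m × Fin n) ℂ[X]
  u : Fin m → ℂ
  v : Fin k → ℂ
  B : Matrix (Fin n) (Fin r) ℂ
  s : Fin k → ℂ
  z : Fin m → ℂ
  C : Matrix (Fin r) (Fin n) ℂ
  blkD : Matrix (Fin k × Fin r) (Fin k × Fin r) ℂ[X]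

/-- The matrix polynomial given by a block system matrix. -/
def BlockSystem.toMatrix {m n k r : ℕ} (S : BlockSystem m n k r) :
    Matrix ((Fin m × Fin n) ⊕ (Fin k × Fin r)) ((Fin m × Fin n) ⊕ (Fin k × Fin r)) ℂ[X] :=
  Matrix.fromBlocks S.blkA
    (constMat (Matrix.kroneckerMap (fun x y => x * y) (Matrix.vecMulVec S.u S.v) S.B))
    (constMat (Matrix.kroneckerMap (fun x y => x * y) (Matrix.vecMulVec S.s S.z) S.C))
    S.blkD

/-- The block transpose `[M_{ij}] ↦ [M_{ji}]`; the blocks themselves are not transposed. -/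
def blockTranspose {R : Type*} {m n : ℕ} (M : Matrix (Fin m × Fin n) (Fin m × Fin n) R) :
    Matrix (Fin m × Fin n) (Fin m × Fin n) R :=
  Matrix.of fun x y => M (y.1, x.2) (x.1, y.2)

/-- The Rosenbrock block transpose `[𝒜^ℬ, z sᵀ ⊗ B; v uᵀ ⊗ C, 𝒟^ℬ]`. -/
def BlockSystem.rosenbrockTranspose {m n k r : ℕ} (S : BlockSystem m n k r) :
    BlockSystem m n k r where
  blkA := blockTranspose S.blkA
  u := S.z
  v := S.s
  B := S.B
  s := S.v
  z := S.u
  C := S.C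
  blkD := blockTranspose S.blkD

/-- `S` is block symmetric: it agrees with its Rosenbrock block transpose, that is, `𝒜` and `𝒟` are
block symmetric, `u = z` and `v = s`. -/
def BlockSystem.IsBlockSymmetric {m n k r : ℕ} (S : BlockSystem m n k r) : Prop :=
  S.rosenbrockTranspose = S

/-- The place of a row (or column) of an `(mn + kr)`-dimensional matrix in the middle summand of
`diag(I_{(m-1)n}, S, I_{(k-1)r})`, if it lies there. -/
def middleIndex {m n k r : ℕ} : (Fin m × Fin n) ⊕ (Fin k × Fin r) → Option (Fin n ⊕ Fin r)
  | Sum.inl x => if (x.1 : ℕ) + 1 = m then some (Sum.inl x.2) else none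
  | Sum.inr y => if (y.1 : ℕ) = 0 then some (Sum.inr y.2) else none

/-- `diag(I_{(m-1)n}, S, I_{(k-1)r})`. -/
def paddedSystem (m k : ℕ) {n r : ℕ} (S : Matrix (Fin n ⊕ Fin r) (Fin n ⊕ Fin r) ℂ[X]) :
    Matrix ((Fin m × Fin n) ⊕ (Fin k × Fin r)) ((Fin m × Fin n) ⊕ (Fin k × Fin r)) ℂ[X] :=
  Matrix.of fun x y =>
    match middleIndex x, middleIndex y with
    | some p, some q => S p q
    | _, _ => if x = y then 1 else 0

/-- `L(λ)` is a Rosenbrock linearization of `S(λ)`: it is a pencil, and there are unimodular matrix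
polynomials with `diag(U_A, U_D) L diag(V_A, V_D) = diag(I_{(m-1)n}, S, I_{(k-1)r})`. -/
def IsRosenbrockLinearization {m n k r : ℕ}
    (L : Matrix ((Fin m × Fin n) ⊕ (Fin k × Fin r)) ((Fin m × Fin n) ⊕ (Fin k × Fin r)) ℂ[X])
    (S : Matrix (Fin n ⊕ Fin r) (Fin n ⊕ Fin r) ℂ[X]) : Prop :=
  (∀ x y, (L x y).natDegree ≤ 1) ∧
  ∃ (UA VA : Matrix (Fin m × Fin n) (Fin m × Fin n) ℂ[X])
    (UD VD : Matrix (Fin k × Fin r) (Fin k × Fin r) ℂ[X]),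
    IsUnit UA ∧ IsUnit VA ∧ IsUnit UD ∧ IsUnit VD ∧
      Matrix.fromBlocks UA 0 0 UD * L * Matrix.fromBlocks VA 0 0 VD = paddedSystem m k S

/-- The vector `e_j` of length `m` (numbered from one). -/
def stdVec (m : ℕ) (j : ℤ) : Fin m → ℂ := fun i => if ((i : ℕ) : ℤ) + 1 = j then 1 else 0

/-! ### Generalized Fiedler pencils with repetition -/

/-- The index tuples and matrix assignments which define a generalized Fiedler pencil with
repetition of an `n × n` matrix polynomial of degree `m`. -/
structure GFPRData (m n : ℕ) where
  h : ℕ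
  h_lt : h < m
  σ : List ℤ
  τ : List ℤ
  σ₁ : List ℤ
  σ₂ : List ℤ
  τ₁ : List ℤ
  τ₂ : List ℤ
  perm_σ : σ.Perm (seg 0 (h : ℤ))
  perm_τ : τ.Perm (seg (-(m : ℤ)) (-(h : ℤ) - 1))
  mem_σ₁ : ∀ i ∈ σ₁, 0 ≤ i ∧ i ≤ (h : ℤ) - 1
  mem_σ₂ : ∀ i ∈ σ₂, 0 ≤ i ∧ i ≤ (h : ℤ) - 1
  mem_τ₁ : ∀ i ∈ τ₁, -(m : ℤ) ≤ i ∧ i ≤ -(h : ℤ) - 2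
  mem_τ₂ : ∀ i ∈ τ₂, -(m : ℤ) ≤ i ∧ i ≤ -(h : ℤ) - 2
  sip_σ : SIP (σ₁ ++ σ ++ σ₂)
  sip_τ : SIP (τ₁ ++ τ ++ τ₂)
  X₁ : List (Matrix (Fin n) (Fin n) ℂ)
  X₂ : List (Matrix (Fin n) (Fin n) ℂ)
  Y₁ : List (Matrix (Fin n) (Fin n) ℂ)
  Y₂ : List (Matrix (Fin n) (Fin n) ℂ)
  asg_X₁ : IsAssignment σ₁ X₁
  asg_X₂ : IsAssignment σ₂ X₂
  asg_Y₁ : IsAssignment τ₁ Y₁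
  asg_Y₂ : IsAssignment τ₂ Y₂

/-- `M_{(τ₁,σ₁)}(Y₁,X₁) (λ M^A_τ - M^A_σ) M_{(σ₂,τ₂)}(X₂,Y₂)`. -/
def GFPRData.pencil {m n : ℕ} (d : GFPRData m n) (A : Matrix (Fin n) (Fin n) ℂ[X]) :
    Matrix (Fin m × Fin n) (Fin m × Fin n) ℂ[X] :=
  pencilProd (assignProd m (d.τ₁ ++ d.σ₁) (d.Y₁ ++ d.X₁))
    (fiedlerProd m A d.τ) (fiedlerProd m A d.σ)
    (assignProd m (d.σ₂ ++ d.τ₂) (d.X₂ ++ d.Y₂))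

/-- The generalized Fiedler pencil with repetition of `[A(λ) B; C D(λ)]` given by the data `a`
for `A(λ)` and `d` for `D(λ)`. -/
def gfpr {m n k r : ℕ} (A : Matrix (Fin n) (Fin n) ℂ[X]) (B : Matrix (Fin n) (Fin r) ℂ)
    (C : Matrix (Fin r) (Fin n) ℂ) (D : Matrix (Fin r) (Fin r) ℂ[X])
    (a : GFPRData m n) (d : GFPRData k r) : BlockSystem m n k r where
  blkA := a.pencil A
  u := stdVec m ((m : ℤ) - inversions 0 (a.σ₁ ++ a.σ))
  v := stdVec k ((k : ℤ) - consecutions 0 (d.σ ++ d.σ₂))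
  B := B
  s := stdVec k ((k : ℤ) - inversions 0 (d.σ₁ ++ d.σ))
  z := stdVec m ((m : ℤ) - consecutions 0 (a.σ ++ a.σ₂))
  C := C
  blkD := d.pencil D

/-- `L` is a generalized Fiedler pencil with repetition of `[A(λ) B; C D(λ)]`. -/
def IsGFPR {m n k r : ℕ} (L : BlockSystem m n k r) (A : Matrix (Fin n) (Fin n) ℂ[X])
    (B : Matrix (Fin n) (Fin r) ℂ) (C : Matrix (Fin r) (Fin n) ℂ)
    (D : Matrix (Fin r) (Fin r) ℂ[X]) : Prop :=
  ∃ (a : GFPRData m n) (d : GFPRData k r), L = gfpr A B C D a d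

/-! ### The pencil built from simple admissible tuples -/

/-- A number `h < m`, simple admissible tuples `w` and `v + m` of `{0, …, h}` and
`{0, …, m-h-1}` with indices `qw` and `qv`, tuples `tw` and `tv + m` in canonical form for `h` and
`m-h-1`, and nonsingular matrix assignments `X` and `Y` for `tw` and `tv`. -/
structure SimpleData (m n : ℕ) where
  h : ℕ
  h_lt : h < m
  w : List ℤ
  v : List ℤ
  qw : ℕ
  qv : ℕ
  simple_w : IsSimpleAdmissible h qw w
  simple_v : IsSimpleAdmissible (m - h - 1) qv (shiftTuple v (m : ℤ))
  tw : List ℤ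
  tv : List ℤ
  canonical_tw : IsCanonicalForm h tw
  canonical_tv : IsCanonicalForm (m - h - 1) (shiftTuple tv (m : ℤ))
  X : List (Matrix (Fin n) (Fin n) ℂ)
  Y : List (Matrix (Fin n) (Fin n) ℂ)
  nonsing_X : IsNonsingularAssignment m tw X
  nonsing_Y : IsNonsingularAssignment m tv Y

/-- The symmetric complement `c_w` of `w`. -/
def SimpleData.cw {m n : ℕ} (d : SimpleData m n) : List ℤ := symmComplement d.h d.qw

/-- The tuple `c_v` such that `c_v + m` is the symmetric complement of `v + m`. -/
def SimpleData.cv {m n : ℕ} (d : SimpleData m n) : List ℤ :=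
  shiftTuple (symmComplement (m - d.h - 1) d.qv) (-(m : ℤ))

/-- `M_{(tv,tw)}(Y,X) (λ M^A_v - M^A_w) M^A_{(cw,cv)} M_{(rev tw, rev tv)}(rev X, rev Y)`. -/
def SimpleData.pencil {m n : ℕ} (d : SimpleData m n) (A : Matrix (Fin n) (Fin n) ℂ[X]) :
    Matrix (Fin m × Fin n) (Fin m × Fin n) ℂ[X] :=
  pencilProd (assignProd m (d.tv ++ d.tw) (d.Y ++ d.X))
    (fiedlerProd m A d.v) (fiedlerProd m A d.w)
    (fiedlerProd m A (d.cw ++ d.cv) *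
      assignProd m (d.tw.reverse ++ d.tv.reverse) (d.X.reverse ++ d.Y.reverse))

/-- The pencil of the system matrix `[A(λ) B; C D(λ)]` built from the data `a` for `A(λ)` and `d`
for `D(λ)`. -/
def simplePencil {m n k r : ℕ} (A : Matrix (Fin n) (Fin n) ℂ[X]) (B : Matrix (Fin n) (Fin r) ℂ)
    (C : Matrix (Fin r) (Fin n) ℂ) (D : Matrix (Fin r) (Fin r) ℂ[X])
    (a : SimpleData m n) (d : SimpleData k r) : BlockSystem m n k r where
  blkA := a.pencil A
  u := stdVec m ((m : ℤ) - inversions 0 (a.tw ++ a.w))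
  v := stdVec k ((k : ℤ) - consecutions 0 (d.w ++ d.cw ++ d.tw.reverse))
  B := B
  s := stdVec k ((k : ℤ) - inversions 0 (d.tw ++ d.w))
  z := stdVec m ((m : ℤ) - consecutions 0 (a.w ++ a.cw ++ a.tw.reverse))
  C := C
  blkD := d.pencil D

/-- All matrices of the assignments are symmetric. -/
def SimpleData.HasSymmetricAssignments {m n : ℕ} (d : SimpleData m n) : Prop :=
  (∀ P ∈ d.X, P.IsSymm) ∧ (∀ P ∈ d.Y, P.IsSymm)

end

/-! ### Combinatorics of index tuples -/

/-! Regard M_i(P) as a matrix over the ring of blocks, with block rows numbered 0, 1, … from the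
bottom. For i ≥ 0 it sends row i to P times row i plus row i - 1, sends row i - 1 to row i and fixes
the other rows; negative indices obey the same rules after a renumbering (`IsLadder`). If a tuple
has the SIP, the row that meets the block P of one factor is carried by the later factors through
standard rows only (`IsLadder.climb_row`). So no two nontrivial blocks are multiplied in this step,
and the block transpose of the product is the product in reverse order
(`IsLadder.transpose_elemProd`).

Symmetry is then a question about palindromes. Up to equivalence a simple admissible tuple lists
first the numbers whose parity differs from that of ρ, then those with the parity of ρ
(`admissibleForm_equiv`), and its symmetric complement is the first of these groups again. Hence (w,
c_w) and c_w are equivalent to their reversals, and so are the tuples enclosed by t and rev t; the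
canonical form of t is what preserves the SIP (`isSIP_extended`, `isSIP_complement`). Each
coefficient of the pencil is a product of one palindrome in nonnegative and one in negative indices,
acting on disjoint sets of block rows. This gives block symmetry, and for symmetric blocks the same
reversals give symmetry. The unit vectors beside B and C agree because c_0 and i_0 are found by one
greedy climb, with equal results here (`SimpleData.inversions_eq_consecutions`).

For the linearization, T = λM_v - M_w is written out row by row (`pencil_apply`). Without column 0
and row i₀ (i₀ = 0 if h = 0, otherwise 1) it is, after a matching of rows with columns, triangular
with diagonal -1. A column H of powers of λ and of upper parts of A(λ) divided by powers of λ
satisfies T H = A(λ) e_{i₀} and has entry 1 at place 0 (`pencilRow_dot`). Elimination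
(`exists_elimination`) yields unimodular U, V with U T V = diag(I, A(λ)), the block A(λ) standing at
a prescribed place t, and moreover U e_{i₀} = e_t and e_0ᵀ V = e_tᵀ. The outer factors of the pencil
are invertible: only blocks at the indices 0 and -m matter, c_w omits 0 because h is even, and c_v
contains -m only for even m. They carry e_{i₀} and e_0ᵀ exactly to the vectors that stand beside B
and C (`SimpleData.left_factor_mulVec`, `SimpleData.vecMul_right_factor`). So separate
transformations of the A part and the D part also bring the coupling blocks into the required
corners. -/

/-- The subtuple of the entries `x` and `x + 1`. -/
def window (x : ℤ) (p : List ℤ) : List ℤ := p.filter fun i => i = x ∨ i = x + 1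

/-- The first entry among `x`, `x + 1`, if there is one, is `x + 1`. -/
def Lead (x : ℤ) (p : List ℤ) : Prop := (window x p).head? ≠ some x

/-- A recursive form of the successor infix property. -/
def IsSIP : List ℤ → Prop
  | [] => True
  | j :: p => Lead j p ∧ IsSIP p

/-- Starting from `x`, raise the current value by one whenever its successor is met. -/
def climb (x : ℤ) : List ℤ → ℤ
  | [] => x
  | j :: p => if j = x + 1 then climb (x + 1) p else climb x p

theorem window_append (x : ℤ) (p q : List ℤ) : window x (p ++ q) = window x p ++ window x q :=
  List.filter_append ..

theorem window_reverse (x : ℤ) (p : List ℤ) : window x p.reverse = (window x p).reverse :=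
  List.filter_reverse ..

theorem window_cons (x j : ℤ) (p : List ℤ) :
    window x (j :: p) = if j = x ∨ j = x + 1 then j :: window x p else window x p := by
  simp [window, List.filter_cons]

theorem lead_nil (x : ℤ) : Lead x [] := by simp [Lead, window]

theorem lead_cons {x j : ℤ} {p : List ℤ} :
    Lead x (j :: p) ↔ j = x + 1 ∨ (j ≠ x ∧ Lead x p) := by
  unfold Lead
  rw [window_cons]
  by_cases h1 : j = x
  · subst h1; simp
  · by_cases h2 : j = x + 1 <;> simp [h1, h2]

theorem Lead.exists_lt {x : ℤ} {p : List ℤ} (h : Lead x p) (t : Fin p.length) (ht : p.get t = x) :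
    ∃ q : Fin p.length, q < t ∧ p.get q = x + 1 := by
  induction p with
  | nil => exact t.elim0
  | cons j p ih =>
    rw [lead_cons] at h
    rcases h with h | ⟨h1, h2⟩
    · refine ⟨⟨0, by simp⟩, ?_, by simpa using h⟩
      refine Fin.lt_def.2 (Nat.pos_of_ne_zero fun h0 => ?_)
      obtain rfl : t = ⟨0, by simp⟩ := Fin.ext h0
      simp at ht
      omega
    · obtain ⟨t, htl⟩ := t
      cases t with
      | zero => exact absurd (by simpa using ht) h1
      | succ t =>
        obtain ⟨q, hq, hq'⟩ := ih h2 ⟨t, by simpa using htl⟩ (by simpa using ht)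
        exact ⟨⟨q + 1, by simp⟩, by simpa [Fin.lt_def] using hq, by simpa using hq'⟩

/-- The condition `Lead` at the earlier of two equal entries already places the successor before the
later one. -/
theorem IsSIP.sip {p : List ℤ} (h : IsSIP p) : SIP p := by
  induction p with
  | nil => exact fun s => s.elim0
  | cons j p ih =>
    obtain ⟨h1, h2⟩ := h
    rintro ⟨s, hs⟩ ⟨t, ht⟩ hst heq
    cases t with
    | zero => simp at hst
    | succ t =>
      cases s with
      | zero =>
        obtain ⟨q, hq, hq'⟩ := h1.exists_lt ⟨t, by simpa using ht⟩ (by simpa using heq.symm)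
        exact ⟨⟨q + 1, by simp⟩, by simp [Fin.lt_def], by simpa [Fin.lt_def] using hq,
          by simpa using hq'⟩
      | succ s =>
        obtain ⟨q, hq, hq1, hq'⟩ := ih h2 ⟨s, by simpa using hs⟩ ⟨t, by simpa using ht⟩
          (by simpa [Fin.lt_def] using hst) (by simpa using heq)
        exact ⟨⟨q + 1, by simp⟩, by simpa [Fin.lt_def] using hq, by simpa [Fin.lt_def] using hq1,
          by simpa using hq'⟩

/-- The SIP at the value x concerns only the relative order of the entries x and x + 1, so it can be
read off from windows. Equivalence of tuples preserves windows, so the test may be made on a normal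
form. -/
theorem isSIP_of_window {p : List ℤ}
    (h : ∀ x, List.IsChain (fun a b => ¬(a = x ∧ b = x)) (window x p)) : IsSIP p := by
  induction p with
  | nil => trivial
  | cons j p ih =>
    refine ⟨?_, ih fun x => ?_⟩
    · have := h j
      rw [window_cons, if_pos (Or.inl rfl)] at this
      unfold Lead
      cases hw : window j p with
      | nil => simp
      | cons a l =>
        rw [hw] at this
        simp at this ⊢
        tauto
    · have := h x
      rw [window_cons] at this
      split_ifs at this
      · exact this.tail
      · exact this

theorem IsSIP.of_append {p q : List ℤ} (h : IsSIP (p ++ q)) : IsSIP q := by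
  induction p with
  | nil => exact h
  | cons j p ih => exact ih h.2

/-! ### Shifts of tuples -/

theorem shiftTuple_append (p q : List ℤ) (c : ℤ) :
    shiftTuple (p ++ q) c = shiftTuple p c ++ shiftTuple q c := by simp [shiftTuple]

theorem shiftTuple_reverse (p : List ℤ) (c : ℤ) :
    shiftTuple p.reverse c = (shiftTuple p c).reverse := by simp [shiftTuple]

theorem shiftTuple_shiftTuple_neg (p : List ℤ) (c : ℤ) :
    shiftTuple (shiftTuple p c) (-c) = p := by
  simp [shiftTuple, Function.comp_def]

theorem mem_shiftTuple {p : List ℤ} {c x : ℤ} : x ∈ shiftTuple p c ↔ x - c ∈ p := by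
  simp only [shiftTuple, List.mem_map]
  constructor
  · rintro ⟨a, ha, rfl⟩; simpa using ha
  · intro h; exact ⟨x - c, h, by ring⟩

theorem Lead.shift {x : ℤ} {p : List ℤ} (h : Lead x p) (c : ℤ) :
    Lead (x + c) (shiftTuple p c) := by
  induction p with
  | nil => exact lead_nil _
  | cons j p ih =>
    rw [lead_cons] at h
    show Lead (x + c) ((j + c) :: shiftTuple p c)
    rw [lead_cons]
    rcases h with h | ⟨h1, h2⟩
    · left; omega
    · right; exact ⟨by omega, ih h2⟩

theorem IsSIP.shift {p : List ℤ} (h : IsSIP p) (c : ℤ) : IsSIP (shiftTuple p c) := by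
  induction p with
  | nil => trivial
  | cons j p ih => exact ⟨h.1.shift c, ih h.2⟩

/-! ### Segments and canonical forms -/

theorem seg_eq_map (a b : ℤ) :
    seg a b = (List.range (b + 1 - a).toNat).map fun i : ℕ => a + (i : ℤ) := by
  simp [seg, ← List.map_eq_flatMap]

theorem mem_seg {a b x : ℤ} : x ∈ seg a b ↔ a ≤ x ∧ x ≤ b := by
  simp only [seg_eq_map, List.mem_map, List.mem_range]
  constructor
  · rintro ⟨i, hi, rfl⟩; omega
  · intro h; exact ⟨(x - a).toNat, by omega, by omega⟩

theorem seg_eq_nil {a b : ℤ} (h : b < a) : seg a b = [] := by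
  have : (b + 1 - a).toNat = 0 := by omega
  simp [seg_eq_map, this]

theorem seg_eq_cons {a b : ℤ} (h : a ≤ b) : seg a b = a :: seg (a + 1) b := by
  have h1 : (b + 1 - a).toNat = (b + 1 - (a + 1)).toNat + 1 := by omega
  simp only [seg_eq_map, h1, List.range_succ_eq_map, List.map_cons, List.map_map]
  simp [Function.comp_def, add_comm]
  intros
  ring

theorem length_seg (a b : ℤ) : (seg a b).length = (b + 1 - a).toNat := by simp [seg_eq_map]

theorem shiftTuple_seg (a b c : ℤ) : shiftTuple (seg a b) c = seg (a + c) (b + c) := by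
  have h1 : (b + c + 1 - (a + c)) = (b + 1 - a) := by ring
  simp [shiftTuple, seg_eq_map, h1, Function.comp_def, add_right_comm]

/-- A string passes x at most once and then goes on to x + 1, unless it stops at x. -/
theorem window_seg (x a b : ℤ) :
    List.IsChain (fun u v => ¬(u = x ∧ v = x)) (window x (seg a b)) ∧
    (x ≠ b → (window x (seg a b)).getLast? ≠ some x) := by
  induction hn : (b + 1 - a).toNat generalizing a with
  | zero => rw [seg_eq_nil (by omega)]; simp [window]
  | succ n ih =>
    obtain ⟨h1, h2⟩ := ih (a + 1) (by omega)
    rw [seg_eq_cons (by omega), window_cons]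
    split_ifs with h
    · have hh : x ∉ window x (seg (a + 1) b) := by
        simp only [window, List.mem_filter, mem_seg]
        omega
      constructor
      · rw [List.isChain_cons]
        refine ⟨fun y hy => ?_, h1⟩
        rintro ⟨-, rfl⟩
        exact hh (List.mem_of_mem_head? hy)
      · intro hb
        rw [List.getLast?_cons]
        by_cases hax : a = x
        · have : x + 1 ∈ window x (seg (a + 1) b) := by
            simp only [window, List.mem_filter, mem_seg]
            simp
            omega
          obtain ⟨y, hy⟩ : ∃ y, (window x (seg (a + 1) b)).getLast? = some y := by
            cases hw : (window x (seg (a + 1) b)).getLast? with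
            | none => rw [List.getLast?_eq_none_iff] at hw; simp [hw] at this
            | some y => exact ⟨y, rfl⟩
          rw [hy]
          have := h2 hb
          rw [hy] at this
          simpa using this
        · cases hw : (window x (seg (a + 1) b)).getLast? with
          | none => simpa using hax
          | some y =>
            have := h2 hb
            rw [hw] at this
            simpa using this
    · exact ⟨h1, h2⟩

theorem isCanonicalForm_window {n : ℕ} (s : ℕ → ℕ) (ρ x : ℤ) :
    let γ := (List.range n).flatMap fun j => seg (s (j + 1) : ℤ) (ρ - 2 * ((j : ℤ) + 1))
    List.IsChain (fun u v => ¬(u = x ∧ v = x)) (window x γ) ∧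
    ((ρ - x) % 2 = 1 → (window x γ).getLast? ≠ some x) ∧
    (∀ i ∈ γ, 0 ≤ i ∧ i ≤ ρ - 2) := by
  induction n generalizing s ρ with
  | zero => simp [window]
  | succ n ih =>
    obtain ⟨h1, h2, h3⟩ := ih (fun j => s (j + 1)) (ρ - 2)
    obtain ⟨g1, g2⟩ := window_seg x (s 1) (ρ - 2)
    have e : ∀ j : ℕ, (ρ - 2 * (((j + 1 : ℕ) : ℤ) + 1)) = ρ - 2 - 2 * ((j : ℤ) + 1) := by
      intro j; push_cast; ring
    intro γ
    have hγ : γ = seg (s 1) (ρ - 2) ++ (List.range n).flatMap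
        fun j => seg (s (j + 1 + 1) : ℤ) (ρ - 2 - 2 * ((j : ℤ) + 1)) := by
      simp only [γ, List.range_succ_eq_map, List.flatMap_cons, List.flatMap_map, e]
      simp
    rw [hγ, window_append]
    refine ⟨?_, ?_, ?_⟩
    -- The later strings have entries at most ρ - 4, so an x among them is not the end ρ - 2 of the
    -- first string, whose window then cannot end in x.
    · rw [List.isChain_append]
      refine ⟨g1, h1, fun u hu v hv => ?_⟩
      rintro ⟨rfl, hvu⟩
      have hv' := List.mem_of_mem_head? hv
      have := h3 v (List.mem_of_mem_filter hv')
      exact g2 (by omega) (Option.mem_def.1 hu)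
    · intro hx
      have a1 := g2 (by omega)
      have a2 := h2 (by omega)
      rw [List.getLast?_append]
      cases hw : (window x ((List.range n).flatMap
        fun j => seg (s (j + 1 + 1) : ℤ) (ρ - 2 - 2 * ((j : ℤ) + 1)))).getLast? with
      | none => simpa using a1
      | some y => rw [hw] at a2; simpa using a2
    · intro i hi
      rw [List.mem_append] at hi
      rcases hi with hi | hi
      · rw [mem_seg] at hi; omega
      · have := h3 i hi; omega

theorem IsCanonicalForm.mem {ρ : ℕ} {γ : List ℤ} (h : IsCanonicalForm ρ γ) {i : ℤ} (hi : i ∈ γ) :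
    0 ≤ i ∧ i ≤ (ρ : ℤ) - 2 := by
  obtain ⟨s, rfl⟩ := h
  exact (isCanonicalForm_window s (ρ : ℤ) 0).2.2 i hi

theorem IsCanonicalForm.isChain_window {ρ : ℕ} {γ : List ℤ} (h : IsCanonicalForm ρ γ) (x : ℤ) :
    List.IsChain (fun u v => ¬(u = x ∧ v = x)) (window x γ) := by
  obtain ⟨s, rfl⟩ := h
  exact (isCanonicalForm_window s (ρ : ℤ) x).1

theorem IsCanonicalForm.getLast_window {ρ : ℕ} {γ : List ℤ} (h : IsCanonicalForm ρ γ) {x : ℤ}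
    (hx : ((ρ : ℤ) - x) % 2 = 1) : (window x γ).getLast? ≠ some x := by
  obtain ⟨s, rfl⟩ := h
  exact (isCanonicalForm_window s (ρ : ℤ) x).2.1 hx

/-! ### Equivalence of tuples -/

theorem TupleSwap.perm {γ δ : List ℤ} (h : TupleSwap γ δ) : γ.Perm δ := by
  obtain ⟨α, β, i, j, -, rfl, rfl⟩ := h
  exact (List.Perm.swap j i β).append_left α

theorem TupleEquiv.perm {γ δ : List ℤ} (h : TupleEquiv γ δ) : γ.Perm δ := by
  induction h with
  | refl => exact List.Perm.refl _
  | tail _ h ih => exact ih.trans h.perm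

theorem TupleEquiv.shift {γ δ : List ℤ} (h : TupleEquiv γ δ) (c : ℤ) :
    TupleEquiv (shiftTuple γ c) (shiftTuple δ c) := by
  refine Relation.ReflTransGen.lift (fun l => shiftTuple l c) (fun γ δ hs => ?_) _ _ h
  obtain ⟨α, β, i, j, hij, rfl, rfl⟩ := hs
  exact ⟨shiftTuple α c, shiftTuple β c, i + c, j + c, by simpa using hij,
    by simp [shiftTuple], by simp [shiftTuple]⟩

theorem TupleEquiv.append {γ δ : List ℤ} (h : TupleEquiv γ δ) (l r : List ℤ) :
    TupleEquiv (l ++ γ ++ r) (l ++ δ ++ r) := by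
  refine Relation.ReflTransGen.lift (fun x => l ++ x ++ r) (fun γ δ hs => ?_) _ _ h
  obtain ⟨α, β, i, j, hij, rfl, rfl⟩ := hs
  exact ⟨l ++ α, β ++ r, i, j, hij, by simp, by simp⟩

/-- Interchanged entries differ by more than one, so at most one of them lies in the window. -/
theorem TupleEquiv.window_eq {γ δ : List ℤ} (h : TupleEquiv γ δ) (x : ℤ) :
    window x γ = window x δ := by
  induction h with
  | refl => rfl
  | tail _ h ih =>
    rw [ih]
    obtain ⟨α, β, i, j, hij, rfl, rfl⟩ := h
    simp only [window_append, window_cons]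
    have : ¬ ((i = x ∨ i = x + 1) ∧ (j = x ∨ j = x + 1)) := by
      rintro ⟨rfl | rfl, rfl | rfl⟩ <;> simp at hij
    split_ifs <;> tauto

theorem climb_append (x : ℤ) (p q : List ℤ) : climb x (p ++ q) = climb (climb x p) q := by
  induction p generalizing x with
  | nil => rfl
  | cons j p ih => simp only [List.cons_append, climb]; split_ifs <;> exact ih _

/-- Entries at distance greater than one are neither the same nor successive targets of the climb,
so their order does not matter. -/
theorem TupleEquiv.climb_eq {γ δ : List ℤ} (h : TupleEquiv γ δ) (x : ℤ) :
    climb x γ = climb x δ := by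
  induction h with
  | refl => rfl
  | tail _ h ih =>
    rw [ih]
    obtain ⟨α, β, i, j, hij, rfl, rfl⟩ := h
    rw [climb_append, climb_append]
    simp only [climb]
    have := lt_abs.1 hij
    split_ifs <;> first | rfl | omega

theorem TupleEquiv.reverse {γ δ : List ℤ} (h : TupleEquiv γ δ) :
    TupleEquiv γ.reverse δ.reverse := by
  refine Relation.ReflTransGen.lift List.reverse (fun γ δ hs => ?_) _ _ h
  obtain ⟨α, β, i, j, hij, rfl, rfl⟩ := hs
  exact ⟨β.reverse, α.reverse, j, i, by rwa [abs_sub_comm], by simp, by simp⟩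

theorem tupleEquiv_move {L : List ℤ} {p : ℤ} (h : ∀ i ∈ L, 1 < |i - p|) :
    TupleEquiv (L ++ [p]) (p :: L) := by
  induction L with
  | nil => exact Relation.ReflTransGen.refl
  | cons i L ih =>
    have h1 := (ih fun k hk => h k (by simp [hk])).append [i] []
    simp only [List.append_nil, List.singleton_append] at h1
    exact h1.tail ⟨[], L, i, p, h i (by simp), rfl, rfl⟩

/-! ### Consecutions and inversions -/

theorem climb_eq_self {x : ℤ} {p : List ℤ} (h : x + 1 ∉ p) : climb x p = x := by
  induction p with
  | nil => rfl
  | cons j p ih =>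
    simp only [List.mem_cons, not_or] at h
    simp only [climb, if_neg (Ne.symm h.1)]
    exact ih h.2

theorem climb_eq_succ {x : ℤ} {p : List ℤ} (h : x + 1 ∈ p) (h' : x + 2 ∉ p) :
    climb x p = x + 1 := by
  induction p with
  | nil => simp at h
  | cons j p ih =>
    simp only [List.mem_cons, not_or] at h h'
    simp only [climb]
    split_ifs with hj
    · exact climb_eq_self (by rw [add_assoc]; exact h'.2)
    · exact ih (h.resolve_left (Ne.symm hj)) h'.2

/-- The greedy choice is optimal: taking the first x + 1 leaves the longest rest in which to find
the remaining string. -/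
theorem seg_sublist_iff_le_climb {x : ℤ} {p : List ℤ} (s : ℕ) :
    (seg (x + 1) (x + s)).Sublist p ↔ x + s ≤ climb x p := by
  induction p generalizing x s with
  | nil =>
    simp only [List.sublist_nil, climb]
    rw [← List.length_eq_zero_iff, length_seg]; omega
  | cons j p ih =>
    cases s with
    | zero =>
      rw [seg_eq_nil (by simp)]
      have h0 := (ih (x := x) 0).1 (by rw [seg_eq_nil (by simp)]; simp)
      have h1 := (ih (x := x + 1) 0).1 (by rw [seg_eq_nil (by simp)]; simp)
      simp only [climb, List.nil_sublist, true_iff]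
      split_ifs <;> omega
    | succ s =>
      rw [seg_eq_cons (by push_cast; omega)]
      simp only [climb]
      split_ifs with hj
      · rw [hj, List.cons_sublist_cons]
        have := ih (x := x + 1) s
        push_cast
        rw [show x + ((s : ℤ) + 1) = x + 1 + s by ring]
        exact this
      · have := ih (x := x) (s + 1)
        rw [seg_eq_cons (by push_cast; omega)] at this
        rw [← this]
        constructor
        · intro h
          cases h with
          | cons _ h => exact h
          | cons_cons _ h => exact absurd rfl hj
        · exact fun h => h.cons _

theorem climb_le_length (x : ℤ) (p : List ℤ) : climb x p ≤ x + p.length := by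
  induction p generalizing x with
  | nil => simp [climb]
  | cons j p ih =>
    simp only [climb, List.length_cons, Nat.cast_add, Nat.cast_one]
    have h1 := ih (x + 1)
    have h2 := ih x
    split_ifs <;> omega

/-- A climb from -1 first looks for 0, so its result -1 for tuples without 0 agrees with the
convention. -/
theorem consecutions_zero (p : List ℤ) : consecutions 0 p = climb (-1) p := by
  unfold consecutions
  split_ifs with h
  · have h0 : 0 ≤ climb (-1) p := by
      have := (seg_sublist_iff_le_climb (x := -1) (p := p) 1).1
        (by rw [seg_eq_cons (by simp), seg_eq_nil (by simp)]; simpa using h)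
      simpa using this
    obtain ⟨c, hc⟩ := Int.eq_ofNat_of_zero_le h0
    rw [hc, Int.natCast_inj, Nat.findGreatest_eq_iff]
    have key : ∀ s : ℕ, (seg 0 (0 + s)).Sublist p ↔ s ≤ c := fun s => by
      have := seg_sublist_iff_le_climb (x := -1) (p := p) (s + 1)
      rw [hc] at this
      push_cast at this
      rw [show (-1 : ℤ) + ((s : ℤ) + 1) = 0 + s by ring] at this
      rw [this]; omega
    refine ⟨?_, fun _ => (key c).2 le_rfl, fun n hn _ => by rw [key]; omega⟩
    have := climb_le_length (-1) p
    omega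
  · rw [climb_eq_self (by simpa using h)]

theorem inversions_zero (p : List ℤ) : inversions 0 p = climb (-1) p.reverse := by
  rw [← consecutions_zero]
  unfold inversions consecutions
  simp only [List.mem_reverse, List.length_reverse]
  congr 3
  ext s
  rw [← List.reverse_sublist (l₂ := p.reverse), List.reverse_reverse]

/-! ### Admissible tuples -/

/-- `(ρ - 1, ρ - 3, …)`, the entries of `{0, …, ρ}` whose parity differs from that of `ρ`. -/
def offParity (ρ : ℕ) : List ℤ :=
  (List.range ((ρ + 1) / 2)).map fun j : ℕ => (ρ : ℤ) - 1 - 2 * (j : ℤ)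

/-- `(ρ, ρ - 2, …)`, the entries of `{0, …, ρ}` which have the parity of `ρ`. -/
def onParity (ρ : ℕ) : List ℤ :=
  (List.range (ρ / 2 + 1)).map fun j : ℕ => (ρ : ℤ) - 2 * (j : ℤ)

theorem mem_offParity {ρ : ℕ} {x : ℤ} :
    x ∈ offParity ρ ↔ 0 ≤ x ∧ x ≤ ρ ∧ ((ρ : ℤ) - x) % 2 = 1 := by
  simp only [offParity, List.mem_map, List.mem_range]
  constructor
  · rintro ⟨j, hj, rfl⟩; omega
  · intro h; exact ⟨(((ρ : ℤ) - 1 - x) / 2).toNat, by omega, by omega⟩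

theorem mem_onParity {ρ : ℕ} {x : ℤ} :
    x ∈ onParity ρ ↔ 0 ≤ x ∧ x ≤ ρ ∧ ((ρ : ℤ) - x) % 2 = 0 := by
  simp only [onParity, List.mem_map, List.mem_range]
  constructor
  · rintro ⟨j, hj, rfl⟩; omega
  · intro h; exact ⟨(((ρ : ℤ) - x) / 2).toNat, by omega, by omega⟩

theorem nodup_offParity (ρ : ℕ) : (offParity ρ).Nodup :=
  List.nodup_range.map fun i j h => by simpa using h

theorem nodup_onParity (ρ : ℕ) : (onParity ρ).Nodup :=
  List.nodup_range.map fun i j h => by simpa using h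

/-- The lower entry of the new pair moves left past the upper entries of the earlier pairs, from
each of which it differs by at least 3. -/
theorem tupleEquiv_pairs (ρ : ℤ) (n : ℕ) :
    TupleEquiv ((List.range n).flatMap fun j : ℕ => seg (ρ - 1 - 2 * (j : ℤ)) (ρ - 2 * (j : ℤ)))
      (((List.range n).map fun j : ℕ => ρ - 1 - 2 * (j : ℤ)) ++
        (List.range n).map fun j : ℕ => ρ - 2 * (j : ℤ)) := by
  induction n with
  | zero => exact Relation.ReflTransGen.refl
  | succ n ih =>
    have h1 := ih.append [] (seg (ρ - 1 - 2 * (n : ℤ)) (ρ - 2 * (n : ℤ)))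
    have h2 := (tupleEquiv_move (L := (List.range n).map fun j : ℕ => ρ - 2 * (j : ℤ))
      (p := ρ - 1 - 2 * (n : ℤ)) fun i hi => by
        simp only [List.mem_map, List.mem_range] at hi
        obtain ⟨j, hj, rfl⟩ := hi
        rw [lt_abs]; left; omega).append
      ((List.range n).map fun j : ℕ => ρ - 1 - 2 * (j : ℤ)) [ρ - 2 * (n : ℤ)]
    have h3 : seg (ρ - 1 - 2 * (n : ℤ)) (ρ - 2 * (n : ℤ)) =
        [ρ - 1 - 2 * (n : ℤ), ρ - 2 * (n : ℤ)] := by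
      rw [seg_eq_cons (by omega), seg_eq_cons (by omega), seg_eq_nil (by omega)]
      simp; ring
    rw [h3] at h1
    simp only [List.range_succ, List.flatMap_append, List.map_append, List.flatMap_singleton,
      List.map_singleton, h3]
    have h4 := Relation.ReflTransGen.trans h1 (by simpa [TupleEquiv] using h2)
    simpa [TupleEquiv] using h4

/-- The upper entries of the pairs have the parity of ρ. The last string (0 : q) is one more pair if
q = 1, and if q = 0 its single entry 0 has the parity of ρ; thus one normal form serves both
indices. -/
theorem admissibleForm_equiv {ρ q : ℕ} (hq : q ≤ ρ) (he : Even (ρ - q)) (h : q = 0 ∨ q = 1) :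
    TupleEquiv (admissibleForm ρ q) (offParity ρ ++ onParity ρ) := by
  have h0 : admissibleForm ρ q = ((List.range ((ρ - q) / 2)).flatMap
      fun j : ℕ => seg ((ρ : ℤ) - 1 - 2 * (j : ℤ)) ((ρ : ℤ) - 2 * (j : ℤ))) ++ seg 0 (q : ℤ) := by
    simp [admissibleForm, List.flatMap_assoc]
  rw [h0]
  obtain ⟨t, ht⟩ := he
  rcases h with rfl | rfl
  · obtain rfl : ρ = 2 * t := by omega
    have e1 : (2 * t - 0) / 2 = t := by omega
    have e2 : (2 * t + 1) / 2 = t := by omega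
    have e3 : 2 * t / 2 = t := by omega
    have h1 := (tupleEquiv_pairs ((2 * t : ℕ) : ℤ) t).append [] (seg 0 0)
    rw [e1, offParity, onParity, e2, e3, List.range_succ, List.map_append]
    have e4 : seg 0 ((0 : ℕ) : ℤ) = [0] := by
      rw [seg_eq_cons (by simp), seg_eq_nil (by simp)]
    rw [e4]
    rw [show seg 0 0 = [0] from e4] at h1
    simpa using h1
  · obtain rfl : ρ = 2 * t + 1 := by omega
    have e1 : (2 * t + 1 - 1) / 2 = t := by omega
    have e2 : (2 * t + 1 + 1) / 2 = t + 1 := by omega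
    have e3 : (2 * t + 1) / 2 = t := by omega
    have h1 := tupleEquiv_pairs ((2 * t + 1 : ℕ) : ℤ) (t + 1)
    rw [e1, offParity, onParity, e2, e3]
    rw [List.range_succ, List.flatMap_append, ← List.range_succ, List.flatMap_singleton] at h1
    have e4 : ((2 * t + 1 : ℕ) : ℤ) - 1 - 2 * (t : ℤ) = 0 := by push_cast; ring
    have e5 : ((2 * t + 1 : ℕ) : ℤ) - 2 * (t : ℤ) = (1 : ℕ) := by push_cast; ring
    rw [e4, e5] at h1
    exact h1

theorem symmComplement_eq {ρ q : ℕ} (hq : q ≤ ρ) (he : Even (ρ - q)) (h : q = 0 ∨ q = 1) :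
    symmComplement ρ q = offParity ρ := by
  have h0 : symmComplement ρ q = ((List.range ((ρ - q) / 2)).map
      fun j : ℕ => (ρ : ℤ) - 1 - 2 * (j : ℤ)) ++
      (List.range q).flatMap fun j : ℕ => seg 0 ((q : ℤ) - 1 - (j : ℤ)) := by
    simp [symmComplement, ← List.map_eq_flatMap, List.flatMap_map, Function.comp_def]
  rw [h0, offParity]
  obtain ⟨t, ht⟩ := he
  rcases h with rfl | rfl
  · obtain rfl : ρ = 2 * t := by omega
    have e1 : (2 * t - 0) / 2 = t := by omega
    have e2 : (2 * t + 1) / 2 = t := by omega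
    simp [e2]
  · obtain rfl : ρ = 2 * t + 1 := by omega
    have e1 : (2 * t + 1 - 1) / 2 = t := by omega
    have e2 : (2 * t + 1 + 1) / 2 = t + 1 := by omega
    rw [e1, e2, List.range_succ (n := t)]
    have e3 : seg 0 0 = [0] := by
      rw [seg_eq_cons (by simp), seg_eq_nil (by simp)]
    simp [e3]

theorem window_eq_nil {x : ℤ} {p : List ℤ} (h : x ∉ p) (h' : x + 1 ∉ p) : window x p = [] := by
  rw [window, List.filter_eq_nil_iff]
  intro a ha
  simp only [decide_eq_true_eq]
  rintro (rfl | rfl) <;> contradiction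

theorem window_eq_singleton {x y : ℤ} {p : List ℤ} (hp : p.Nodup) (hy : y = x ∨ y = x + 1)
    (h : y ∈ p) (h' : ∀ z ∈ p, z = x ∨ z = x + 1 → z = y) : window x p = [y] := by
  have h1 : window x p = p.filter fun i => i = y := by
    refine List.filter_congr fun z hz => ?_
    have := h' z hz
    rw [decide_eq_decide]
    constructor
    · exact this
    · rintro rfl; exact hy
  rw [h1]
  have := List.Nodup.count hp (a := y)
  rw [if_pos h] at this
  have h2 : p.filter (fun i => i = y) = List.replicate (p.count y) y := by
    rw [← List.filter_eq]
  rw [h2, this]; rfl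

/-- The only new neighbours occur at the two junctions, which mirror each other: either the outer
part does not present x there, or a nonempty middle part shows x at neither end. -/
theorem isChain_window_sandwich {x : ℤ} {l : List ℤ} {mid : List ℤ}
    (hl : List.IsChain (fun u v => ¬(u = x ∧ v = x)) l)
    (hm : List.IsChain (fun u v => ¬(u = x ∧ v = x)) mid)
    (h1 : l.getLast? ≠ some x ∨ (mid.head? ≠ some x ∧ mid.getLast? ≠ some x ∧ mid ≠ [])) :
    List.IsChain (fun u v => ¬(u = x ∧ v = x)) (l ++ mid ++ l.reverse) := by
  have hr : List.IsChain (fun u v => ¬(u = x ∧ v = x)) l.reverse := by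
    rw [List.isChain_reverse]
    exact hl.imp fun a b h => by tauto
  rw [List.isChain_append, List.isChain_append]
  refine ⟨⟨hl, hm, ?_⟩, hr, ?_⟩
  · rintro u hu v hv ⟨rfl, rfl⟩
    rcases h1 with h1 | h1
    · exact h1 hu
    · exact h1.1 hv
  · rintro u hu v hv ⟨rfl, rfl⟩
    rw [List.head?_reverse] at hv
    rcases h1 with h1 | h1
    · exact h1 hv
    · rw [List.getLast?_append] at hu
      cases hm : mid.getLast? with
      | none => exact h1.2.2 (List.getLast?_eq_none_iff.1 hm)
      | some y => rw [hm] at hu; simp at hu; exact h1.2.1 (hu ▸ hm)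

/-- The successor infix property of `(t, w, c, rev t)` for an admissible tuple `w` of index at
most one with symmetric complement `c` and a tuple `t` in canonical form. -/
theorem isSIP_extended {ρ : ℕ} {t w : List ℤ} (ht : IsCanonicalForm ρ t)
    (hw : TupleEquiv w (offParity ρ ++ onParity ρ)) :
    IsSIP (t ++ w ++ offParity ρ ++ t.reverse) := by
  refine isSIP_of_window fun x => ?_
  rw [List.append_assoc t w, window_append x (_ ++ _), window_append x t, window_append x w,
    hw.window_eq,
    window_append, window_reverse]
  have hc := ht.isChain_window x
  by_cases hx : 0 ≤ x + 1 ∧ x ≤ ρ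
  swap
  · rw [window_eq_nil (p := offParity ρ), window_eq_nil (p := onParity ρ),
      window_eq_nil (p := t)]
    · simp
    all_goals first | (rw [mem_offParity]; omega) | (rw [mem_onParity]; omega) | skip
    · intro h; have := ht.mem h; omega
    · intro h; have := ht.mem h; omega
  -- Away from the extreme values of x, if x has the parity of ρ, the middle part has the window (x
  -- + 1, x, x + 1), which shields its x. For the other parity it is (x, x + 1, x), and the
  -- canonical form is needed to know that the window of t does not end in x.
  rcases Int.emod_two_eq_zero_or_one ((ρ : ℤ) - x) with hp | hp
  · have h2 : window x (onParity ρ) = if 0 ≤ x then [x] else [] := by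
      split_ifs
      · refine window_eq_singleton (nodup_onParity ρ) (Or.inl rfl) (by rw [mem_onParity]; omega) ?_
        intro z hz; rw [mem_onParity] at hz; omega
      · refine window_eq_nil ?_ ?_ <;> rw [mem_onParity] <;> omega
    by_cases hlt : x < ρ
    · have h1 : window x (offParity ρ) = [x + 1] := by
        refine window_eq_singleton (nodup_offParity ρ) (Or.inr rfl)
          (by rw [mem_offParity]; omega) ?_
        intro z hz; rw [mem_offParity] at hz; omega
      rw [h1, h2]
      refine isChain_window_sandwich hc ?_ (Or.inr ?_)
      · split_ifs <;> simp
      · split_ifs <;> simp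
    · have h1 : window x (offParity ρ) = [] := by
        refine window_eq_nil ?_ ?_ <;> rw [mem_offParity] <;> omega
      have h3 : window x t = [] := by
        refine window_eq_nil ?_ ?_ <;> intro h <;> have := ht.mem h <;> omega
      rw [h1, h2, h3]
      split_ifs <;> simp
  · have h2 : window x (onParity ρ) = [x + 1] := by
      refine window_eq_singleton (nodup_onParity ρ) (Or.inr rfl) (by rw [mem_onParity]; omega) ?_
      intro z hz; rw [mem_onParity] at hz; omega
    have h1 : window x (offParity ρ) = if 0 ≤ x then [x] else [] := by
      split_ifs
      · refine window_eq_singleton (nodup_offParity ρ) (Or.inl rfl)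
          (by rw [mem_offParity]; omega) ?_
        intro z hz; rw [mem_offParity] at hz; omega
      · refine window_eq_nil ?_ ?_ <;> rw [mem_offParity] <;> omega
    rw [h1, h2]
    refine isChain_window_sandwich hc ?_ (Or.inl (ht.getLast_window hp))
    split_ifs <;> simp

/-- The successor infix property of `(t, c, rev t)` for the symmetric complement `c` of an
admissible tuple of index at most one and a tuple `t` in canonical form. -/
theorem isSIP_complement {ρ : ℕ} {t : List ℤ} (ht : IsCanonicalForm ρ t) :
    IsSIP (t ++ offParity ρ ++ t.reverse) := by
  refine isSIP_of_window fun x => ?_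
  rw [window_append, window_append x t, window_reverse]
  have hc := ht.isChain_window x
  by_cases hx : 0 ≤ x + 1 ∧ x < ρ
  swap
  · rw [window_eq_nil (p := offParity ρ), window_eq_nil (p := t)]
    · simp
    all_goals first | (rw [mem_offParity]; omega) | skip
    · intro h; have := ht.mem h; omega
    · intro h; have := ht.mem h; omega
  rcases Int.emod_two_eq_zero_or_one ((ρ : ℤ) - x) with hp | hp
  · have h1 : window x (offParity ρ) = [x + 1] := by
      refine window_eq_singleton (nodup_offParity ρ) (Or.inr rfl)
        (by rw [mem_offParity]; omega) ?_
      intro z hz; rw [mem_offParity] at hz; omega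
    rw [h1]
    exact isChain_window_sandwich hc (by simp) (Or.inr (by simp))
  · have h1 : window x (offParity ρ) = if 0 ≤ x then [x] else [] := by
      split_ifs
      · refine window_eq_singleton (nodup_offParity ρ) (Or.inl rfl)
          (by rw [mem_offParity]; omega) ?_
        intro z hz; rw [mem_offParity] at hz; omega
      · refine window_eq_nil ?_ ?_ <;> rw [mem_offParity] <;> omega
    rw [h1]
    refine isChain_window_sandwich hc ?_ (Or.inl (ht.getLast_window hp))
    split_ifs <;> simp

/-- For even ρ the entry 0 lies in the second group of the normal form and 1 only in the first, so
the climb finds 0 and stops. -/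
theorem climb_admissible {ρ : ℕ} {w : List ℤ} (hρ : Even ρ)
    (hw : TupleEquiv w (offParity ρ ++ onParity ρ)) : climb (-1) w = 0 := by
  obtain ⟨t, ht⟩ := hρ
  rw [hw.climb_eq, climb_append, climb_eq_self (p := offParity ρ)]
  · exact climb_eq_succ (by rw [mem_onParity]; omega) (by rw [mem_onParity]; omega)
  · rw [mem_offParity]; omega

/-- In the reversed normal form 0 precedes 1, while 2 belongs to the group already passed; for ρ = 0
there is no 1. -/
theorem climb_admissible_reverse {ρ : ℕ} {w : List ℤ} (hρ : Even ρ)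
    (hw : TupleEquiv w (offParity ρ ++ onParity ρ)) :
    climb (-1) w.reverse = if ρ = 0 then 0 else 1 := by
  obtain ⟨t, ht⟩ := hρ
  rw [hw.reverse.climb_eq, List.reverse_append, climb_append,
    climb_eq_succ (p := (onParity ρ).reverse)]
  · split_ifs with h
    · exact climb_eq_self (by rw [List.mem_reverse, mem_offParity]; omega)
    · exact climb_eq_succ (by rw [List.mem_reverse, mem_offParity]; omega)
        (by rw [List.mem_reverse, mem_offParity]; omega)
  · rw [List.mem_reverse, mem_onParity]; omega
  · rw [List.mem_reverse, mem_onParity]; omega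

/-- After w the climb stands at 0 and the complement offers 1 again, if there is a 1. This is where
c_0 catches up with i_0. -/
theorem climb_admissible_complement {ρ : ℕ} {w : List ℤ} (hρ : Even ρ)
    (hw : TupleEquiv w (offParity ρ ++ onParity ρ)) :
    climb (-1) (w ++ offParity ρ) = climb (-1) w.reverse := by
  rw [climb_admissible_reverse hρ hw, climb_append, climb_admissible hρ hw]
  obtain ⟨t, ht⟩ := hρ
  split_ifs with h
  · exact climb_eq_self (by rw [mem_offParity]; omega)
  · exact climb_eq_succ (by rw [mem_offParity]; omega) (by rw [mem_offParity]; omega)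

/-! ### Elementary matrices over a ring of blocks -/

section Blocks

variable {S : Type*} [Ring S] {m : ℕ}

/-- The elementary matrix `M_i(p)` over a ring `S` of blocks; the block rows and columns are
numbered from the last one upwards. -/
def elemBlock (m : ℕ) (i : ℤ) (p : S) : Matrix (Fin m) (Fin m) S :=
  Matrix.of fun x y =>
    let a : ℤ := (x : ℕ)
    let b : ℤ := (y : ℕ)
    if i = 0 then
      if a = b then (if a = 0 then p else 1) else 0
    else if i = -(m : ℤ) then
      if a = b then (if a = (m : ℤ) - 1 then p else 1) else 0
    else if a = |i| ∧ b = |i| then (if 0 < i then p else 0)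
    else if a = |i| - 1 ∧ b = |i| - 1 then (if 0 < i then 0 else p)
    else if (a = |i| ∧ b = |i| - 1) ∨ (a = |i| - 1 ∧ b = |i|) then 1
    else if a = b then 1 else 0

/-- The product of the elementary matrices given by a list of indices and blocks. -/
def elemProd (m : ℕ) (l : List (ℤ × S)) : Matrix (Fin m) (Fin m) S :=
  (l.map fun t => elemBlock m t.1 t.2).prod

/-- The standard basis row with entry one at place `x`, zero if `x` is out of range. -/
def stdRow (m : ℕ) (x : ℤ) : Fin m → S := fun a => if ((a : ℕ) : ℤ) = x then 1 else 0

/-- The map of index tuples to lists of indices and blocks given by a function on indices. -/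
def withBlocks (g : ℤ → S) (p : List ℤ) : List (ℤ × S) := p.map fun i => (i, g i)

theorem elemProd_append (l l' : List (ℤ × S)) :
    elemProd m (l ++ l') = elemProd m l * elemProd m l' := by
  simp [elemProd]

theorem elemProd_cons (t : ℤ × S) (l : List (ℤ × S)) :
    elemProd m (t :: l) = elemBlock m t.1 t.2 * elemProd m l := by
  simp [elemProd]

theorem elemProd_nil : elemProd m ([] : List (ℤ × S)) = 1 := by
  simp [elemProd]

theorem stdRow_vecMul (a : Fin m) (M : Matrix (Fin m) (Fin m) S) :
    stdRow m ((a : ℕ) : ℤ) ᵥ* M = M a := by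
  have : stdRow m ((a : ℕ) : ℤ) = Pi.single (M := fun _ => S) a 1 := by
    ext b; simp [stdRow, Pi.single_apply, Fin.ext_iff]
  rw [this]; exact Matrix.single_one_vecMul ..

theorem ext_stdRow {M N : Matrix (Fin m) (Fin m) S}
    (h : ∀ x : ℤ, 0 ≤ x → x < m → stdRow m x ᵥ* M = stdRow m x ᵥ* N) : M = N := by
  funext a
  exact (stdRow_vecMul a M).symm.trans ((h _ (by simp) (by simp)).trans (stdRow_vecMul a N))

theorem stdRow_of_neg {x : ℤ} (h : x < 0) : stdRow m x = (0 : Fin m → S) := by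
  ext a; simp only [stdRow, Pi.zero_apply]; rw [if_neg]; omega

theorem stdRow_of_le {x : ℤ} (h : (m : ℤ) ≤ x) : stdRow m x = (0 : Fin m → S) := by
  ext a; simp only [stdRow, Pi.zero_apply]; rw [if_neg]; omega

/-- A numbering of the standard basis rows for which every elementary matrix `M_j(p)` with index in
`[lo, hi]` sends row `j` to `p` times row `j` plus row `j - 1`, sends row `j - 1` to row `j` and
fixes the other rows with numbers in `[lo, hi]`. -/
structure IsLadder (m : ℕ) (lo hi : ℤ) (e : ℤ → Fin m → S) : Prop where
  pivot : ∀ j p, lo ≤ j → j ≤ hi → e j ᵥ* elemBlock m j p = p • e j + e (j - 1)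
  up : ∀ x p, lo ≤ x → x + 1 ≤ hi → e x ᵥ* elemBlock m (x + 1) p = e (x + 1)
  fix : ∀ x j p, lo ≤ x → x ≤ hi → lo ≤ j → j ≤ hi → j ≠ x → j ≠ x + 1 →
    e x ᵥ* elemBlock m j p = e x
  zero : e (lo - 1) = 0

/-- Since `stdRow` vanishes out of range, one formula also covers i = 0, where row i - 1 is missing.
-/
theorem elemBlock_row_pos {i : ℤ} (p : S) {x : ℤ} (hi : 0 ≤ i) (him : i < m) (hx : 0 ≤ x)
    (hxm : x < m) : stdRow m x ᵥ* elemBlock m i p =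
      if x = i then p • stdRow m i + stdRow m (i - 1) else if x = i - 1 then stdRow m i
      else stdRow m x := by
  obtain ⟨a, rfl⟩ : ∃ a : Fin m, ((a : ℕ) : ℤ) = x := ⟨⟨x.toNat, by omega⟩, by simp [hx]⟩
  rw [stdRow_vecMul]
  ext b
  simp only [elemBlock, Matrix.of_apply, abs_of_nonneg hi, apply_ite (fun f : Fin m → S => f b),
    Pi.add_apply, Pi.smul_apply, stdRow, smul_eq_mul]
  split_ifs <;> first | omega | simp

theorem elemBlock_row_neg {i : ℤ} (p : S) {x : ℤ} (hi : i < 0) (him : -(m : ℤ) ≤ i) (hx : 0 ≤ x)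
    (hxm : x < m) : stdRow m x ᵥ* elemBlock m i p =
      if x = -i - 1 then p • stdRow m (-i - 1) + stdRow m (-i) else
      if x = -i then stdRow m (-i - 1) else stdRow m x := by
  obtain ⟨a, rfl⟩ : ∃ a : Fin m, ((a : ℕ) : ℤ) = x := ⟨⟨x.toNat, by omega⟩, by simp [hx]⟩
  rw [stdRow_vecMul]
  ext b
  simp only [elemBlock, Matrix.of_apply, abs_of_neg hi, apply_ite (fun f : Fin m → S => f b),
    Pi.add_apply, Pi.smul_apply, stdRow, smul_eq_mul]
  split_ifs <;> first | omega | simp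

theorem isLadder_pos : IsLadder m 0 ((m : ℤ) - 1) (stdRow m : ℤ → Fin m → S) where
  pivot j p h1 h2 := by
    rw [elemBlock_row_pos p h1 (by omega) h1 (by omega), if_pos rfl]
  up x p h1 h2 := by
    rw [elemBlock_row_pos p (by omega) (by omega) h1 (by omega), if_neg (by omega),
      if_pos (by omega)]
  fix x j p h1 h2 h3 h4 h5 h6 := by
    rw [elemBlock_row_pos p (by omega) (by omega) h1 (by omega), if_neg (by omega),
      if_neg (by omega)]
  zero := stdRow_of_neg (by omega)

/-- Giving row -y - 1 the number y puts the block of M_j, j < 0, into the row numbered j. The row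
numbered -m - 1 would be row m, which is out of range. -/
theorem isLadder_neg :
    IsLadder m (-(m : ℤ)) (-1) (fun y => (stdRow m (-y - 1) : Fin m → S)) where
  pivot j p h1 h2 := by
    rw [elemBlock_row_neg p (by omega) h1 (by omega) (by omega), if_pos rfl,
      show -(j - 1) - 1 = -j by ring]
  up x p h1 h2 := by
    rw [elemBlock_row_neg p (by omega) (by omega) (by omega) (by omega), if_neg (by omega),
      if_pos (by omega)]
  fix x j p h1 h2 h3 h4 h5 h6 := by
    rw [elemBlock_row_neg p (by omega) (by omega) (by omega) (by omega), if_neg (by omega),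
      if_neg (by omega)]
  zero := stdRow_of_le (by omega)

variable {lo hi : ℤ} {e : ℤ → Fin m → S}

/-- The orbit of a row which never meets a pivot. -/
theorem IsLadder.climb_row (H : IsLadder m lo hi e) {l : List (ℤ × S)} {x : ℤ}
    (hl : ∀ t ∈ l, lo ≤ t.1 ∧ t.1 ≤ hi) (hx : lo ≤ x ∧ x ≤ hi) (hs : IsSIP (l.map Prod.fst))
    (hlead : Lead x (l.map Prod.fst)) :
    e x ᵥ* elemProd m l = e (climb x (l.map Prod.fst)) ∧
      lo ≤ climb x (l.map Prod.fst) ∧ climb x (l.map Prod.fst) ≤ hi := by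
  induction l generalizing x with
  | nil => simp [climb, hx, elemProd_nil]
  | cons t l ih =>
    simp only [List.map_cons, lead_cons, climb] at hlead ⊢
    have hl' : ∀ t ∈ l, lo ≤ t.1 ∧ t.1 ≤ hi := fun t ht => hl t (by simp [ht])
    have ht := hl t (by simp)
    rw [elemProd_cons, ← Matrix.vecMul_vecMul]
    split_ifs with h
    · have h1 := H.up x t.2 hx.1 (by omega)
      rw [← h] at h1
      rw [h1, ← h]
      -- The SIP at the head index is exactly the hypothesis needed to go on from the raised row.
      exact ih hl' ht hs.2 hs.1
    · rcases hlead with h' | ⟨h1, h2⟩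
      · exact absurd h' h
      · rw [H.fix x t.1 t.2 hx.1 hx.2 ht.1 ht.2 h1 h]
        exact ih hl' hx hs.2 h2

/-- The rows of a product of elementary matrices with pairwise distant indices. -/
theorem IsLadder.row_distant (H : IsLadder m lo hi e) (g : ℤ → S) {l : List ℤ} {x : ℤ}
    (hl : ∀ j ∈ l, lo ≤ j ∧ j ≤ hi) (hx : lo ≤ x ∧ x ≤ hi) (hn : l.Nodup)
    (hd : ∀ i ∈ l, i + 1 ∉ l) :
    e x ᵥ* elemProd m (withBlocks g l) =
      if x ∈ l then g x • e x + e (x - 1) else if x + 1 ∈ l then e (x + 1) else e x := by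
  induction l generalizing x with
  | nil => simp [withBlocks, elemProd_nil]
  | cons j l ih =>
    have hl' : ∀ j ∈ l, lo ≤ j ∧ j ≤ hi := fun t ht => hl t (by simp [ht])
    have hj := hl j (by simp)
    rw [List.nodup_cons] at hn
    have hd' : ∀ i ∈ l, i + 1 ∉ l := fun i hi h => hd i (by simp [hi]) (by simp [h])
    have hd1 : j + 1 ∉ l := fun h => hd j (by simp) (by simp [h])
    have hd2 : j - 1 ∉ l := fun h => hd (j - 1) (by simp [h]) (by simp)
    simp only [withBlocks, List.map_cons] at ih ⊢
    rw [elemProd_cons, ← Matrix.vecMul_vecMul]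
    by_cases h1 : x = j
    · subst h1
      rw [H.pivot x _ hj.1 hj.2, Matrix.add_vecMul, Matrix.smul_vecMul, ih hl' hj hn.2 hd',
        if_neg hn.1, if_neg hd1, if_pos (by simp)]
      congr 1
      -- The summand of row x - 1 has to survive the remaining factors; at x = lo it is zero, and
      -- the induction hypothesis does not apply to it.
      by_cases h2 : x = lo
      · rw [h2, H.zero, Matrix.zero_vecMul]
      · rw [ih hl' (by omega) hn.2 hd', if_neg hd2, if_neg (by simpa using hn.1)]
    · by_cases h2 : j = x + 1
      · subst h2
        rw [H.up x _ hx.1 hj.2, ih hl' hj hn.2 hd', if_neg hn.1, if_neg hd1, if_neg,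
          if_pos (by simp)]
        simp only [add_sub_cancel_right] at hd2
        simpa using hd2
      · rw [H.fix x j _ hx.1 hx.2 hj.1 hj.2 (Ne.symm h1) h2, ih hl' hx hn.2 hd']
        simp [h1, Ne.symm h2]

theorem IsLadder.fix_row (H : IsLadder m lo hi e) {l : List (ℤ × S)} {x : ℤ}
    (hl : ∀ t ∈ l, lo ≤ t.1 ∧ t.1 ≤ hi) (hx : lo ≤ x ∧ x ≤ hi)
    (h : ∀ t ∈ l, t.1 ≠ x ∧ t.1 ≠ x + 1) : e x ᵥ* elemProd m l = e x := by
  induction l with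
  | nil => simp [elemProd_nil]
  | cons t l ih =>
    have ht := hl t (by simp)
    have h' := h t (by simp)
    rw [elemProd_cons, ← Matrix.vecMul_vecMul, H.fix x _ _ hx.1 hx.2 ht.1 ht.2 h'.1 h'.2]
    exact ih (fun t ht => hl t (by simp [ht])) fun t ht => h t (by simp [ht])

/-! ### Block transposes -/

theorem transpose_mul_of_commute {M N : Matrix (Fin m) (Fin m) S}
    (h : ∀ a b c, Commute (M a c) (N c b)) : (M * N)ᵀ = Nᵀ * Mᵀ := by
  ext b a
  simp only [Matrix.transpose_apply, Matrix.mul_apply]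
  exact Finset.sum_congr rfl fun c _ => h a b c

theorem stdRow_apply_commute (x : ℤ) (b : Fin m) (s : S) : Commute s (stdRow m x b) := by
  unfold stdRow; split_ifs
  · exact Commute.one_right s
  · exact Commute.zero_right s

theorem elemBlock_transpose (i : ℤ) (p : S) : (elemBlock m i p)ᵀ = elemBlock m i p := by
  ext a b
  simp only [elemBlock, Matrix.transpose_apply, Matrix.of_apply]
  congr 1
  · simp only [eq_comm (a := ((b : ℕ) : ℤ)) (b := ((a : ℕ) : ℤ))]
    split_ifs with h1 h2 h3 h4 <;> first | rfl | omega
  · simp only [eq_comm (a := ((b : ℕ) : ℤ)) (b := ((a : ℕ) : ℤ))]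
    congr 1
    · split_ifs with h1 h2 h3 h4 <;> first | rfl | omega
    · split_ifs with h1 h2 h3 h4 <;> first | rfl | omega

/-- The block transpose of a product whose index tuple has the successor infix property. -/
theorem IsLadder.transpose_elemProd (H : IsLadder m lo hi e)
    (hrow : ∀ a : Fin m, ∃ x, lo ≤ x ∧ x ≤ hi ∧ e x = stdRow m ((a : ℕ) : ℤ))
    (hstd : ∀ x, ∃ y, e x = stdRow m y)
    {l : List (ℤ × S)} (hl : ∀ t ∈ l, lo ≤ t.1 ∧ t.1 ≤ hi) (hs : IsSIP (l.map Prod.fst)) :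
    (elemProd m l)ᵀ = elemProd m l.reverse := by
  induction l with
  | nil => simp [elemProd_nil]
  | cons t l ih =>
    have ht := hl t (by simp)
    have hl' : ∀ t ∈ l, lo ≤ t.1 ∧ t.1 ≤ hi := fun t ht => hl t (by simp [ht])
    rw [List.reverse_cons, elemProd_append, ← ih hl' hs.2, elemProd_cons, elemProd_cons,
      elemProd_nil, mul_one]
    nth_rewrite 2 [← elemBlock_transpose]
    refine transpose_mul_of_commute fun a b c => ?_
    obtain ⟨x, hx1, hx2, hx⟩ := hrow c
    -- For every c one of the two multiplied entries is 0 or 1. If c is the pivot of the first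
    -- matrix, the SIP makes row c of the remaining product standard; otherwise row c of the first
    -- matrix, which equals its column c, is standard.
    by_cases hxt : x = t.1
    · have h1 := (H.climb_row hl' ht hs.2 hs.1).1
      rw [← hxt, hx, stdRow_vecMul] at h1
      obtain ⟨y, hy⟩ := hstd (climb x (List.map Prod.fst l))
      rw [h1, hy]
      exact stdRow_apply_commute _ _ _
    · rw [← elemBlock_transpose, Matrix.transpose_apply]
      have h2 : ∃ y, e x ᵥ* elemBlock m t.1 t.2 = stdRow m y := by
        by_cases h3 : t.1 = x + 1
        · rw [h3, H.up x _ hx1 (by omega)]; exact hstd _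
        · rw [H.fix x _ _ hx1 hx2 ht.1 ht.2 (Ne.symm hxt) h3]; exact hstd _
      obtain ⟨y, hy⟩ := h2
      rw [hx, stdRow_vecMul] at hy
      rw [hy]
      exact (stdRow_apply_commute _ _ _).symm

theorem transpose_elemProd_pos {l : List (ℤ × S)} (hl : ∀ t ∈ l, 0 ≤ t.1 ∧ t.1 < m)
    (hs : IsSIP (l.map Prod.fst)) : (elemProd m l)ᵀ = elemProd m l.reverse :=
  isLadder_pos.transpose_elemProd (fun a => ⟨(a : ℕ), by omega, by omega, rfl⟩)
    (fun x => ⟨x, rfl⟩) (fun t ht => by have := hl t ht; omega) hs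

theorem transpose_elemProd_neg {l : List (ℤ × S)} (hl : ∀ t ∈ l, -(m : ℤ) ≤ t.1 ∧ t.1 < 0)
    (hs : IsSIP (l.map Prod.fst)) : (elemProd m l)ᵀ = elemProd m l.reverse :=
  isLadder_neg.transpose_elemProd
    (fun a => ⟨-((a : ℕ) : ℤ) - 1, by omega, by omega, by ring_nf⟩)
    (fun x => ⟨_, rfl⟩) (fun t ht => by have := hl t ht; omega) hs

/-! ### Commutation -/

/-- M_i only moves the rows i - 1 and i, so the two factors act on disjoint sets of rows. -/
theorem commute_elemBlock_pos {i j : ℤ} (p q : S) (hi : 0 ≤ i) (him : i < m) (hj : 0 ≤ j)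
    (hjm : j < m) (hij : 1 < |i - j|) : Commute (elemBlock m i p) (elemBlock m j q) := by
  refine ext_stdRow fun x hx hxm => ?_
  have := lt_abs.1 hij
  have key : ∀ i j : ℤ, ∀ p q : S, 0 ≤ i → i < m → 0 ≤ j → j < m → (1 < i - j ∨ 1 < -(i - j)) →
      stdRow m (i - 1) ᵥ* elemBlock m j q = stdRow m (i - 1) := by
    intro i j p q hi him hj hjm hij
    rcases hi.eq_or_lt with rfl | hi'
    · rw [stdRow_of_neg (by omega), Matrix.zero_vecMul]
    · rw [elemBlock_row_pos q hj hjm (by omega) (by omega), if_neg (by omega), if_neg (by omega)]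
  rw [← Matrix.vecMul_vecMul, ← Matrix.vecMul_vecMul, elemBlock_row_pos p hi him hx hxm,
    elemBlock_row_pos q hj hjm hx hxm]
  have h1 := key i j p q hi him hj hjm this
  have h2 := key j i q p hj hjm hi him (by omega)
  have h3 := elemBlock_row_pos p hi him hj hjm
  have h4 := elemBlock_row_pos q hj hjm hi him
  have h5 := elemBlock_row_pos p hi him hx hxm
  have h6 := elemBlock_row_pos q hj hjm hx hxm
  rw [if_neg (by omega), if_neg (by omega)] at h3 h4
  split_ifs at h5 h6 ⊢ <;>
    first
    | omega
    | simp only [Matrix.add_vecMul, Matrix.smul_vecMul, h1, h2, h3, h4, h5, h6]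

theorem commute_elemBlock_neg {i j : ℤ} (p q : S) (hi : i < 0) (him : -(m : ℤ) ≤ i) (hj : j < 0)
    (hjm : -(m : ℤ) ≤ j) (hij : 1 < |i - j|) : Commute (elemBlock m i p) (elemBlock m j q) := by
  refine ext_stdRow fun x hx hxm => ?_
  have := lt_abs.1 hij
  have key : ∀ i j : ℤ, ∀ p q : S, i < 0 → -(m : ℤ) ≤ i → j < 0 → -(m : ℤ) ≤ j →
      (1 < i - j ∨ 1 < -(i - j)) → stdRow m (-i) ᵥ* elemBlock m j q = stdRow m (-i) := by
    intro i j p q hi him hj hjm hij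
    rcases him.eq_or_lt with rfl | hi'
    · rw [stdRow_of_le (by omega), Matrix.zero_vecMul]
    · rw [elemBlock_row_neg q hj hjm (by omega) (by omega), if_neg (by omega), if_neg (by omega)]
  rw [← Matrix.vecMul_vecMul, ← Matrix.vecMul_vecMul, elemBlock_row_neg p hi him hx hxm,
    elemBlock_row_neg q hj hjm hx hxm]
  have h1 := key i j p q hi him hj hjm this
  have h2 := key j i q p hj hjm hi him (by omega)
  have h3 := elemBlock_row_neg p hi him (x := -j - 1) (by omega) (by omega)
  have h4 := elemBlock_row_neg q hj hjm (x := -i - 1) (by omega) (by omega)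
  have h5 := elemBlock_row_neg p hi him hx hxm
  have h6 := elemBlock_row_neg q hj hjm hx hxm
  rw [if_neg (by omega), if_neg (by omega)] at h3 h4
  split_ifs at h5 h6 ⊢ <;>
    first
    | omega
    | simp only [Matrix.add_vecMul, Matrix.smul_vecMul, h1, h2, h3, h4, h5, h6]

/-- The rows i - 1, i moved by the first matrix lie below the rows -j - 1, -j moved by the second.
-/
theorem commute_elemBlock_pos_neg {i j : ℤ} (p q : S) (hi : 0 ≤ i) (hj : -(m : ℤ) ≤ j)
    (hij : i + 1 < -j) : Commute (elemBlock m i p) (elemBlock m j q) := by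
  refine ext_stdRow fun x hx hxm => ?_
  rw [← Matrix.vecMul_vecMul, ← Matrix.vecMul_vecMul,
    elemBlock_row_pos p hi (by omega) hx hxm, elemBlock_row_neg q (by omega) hj hx hxm]
  have h1 : stdRow m (i - 1) ᵥ* elemBlock m j q = stdRow m (i - 1) := by
    rcases hi.eq_or_lt with rfl | hi'
    · rw [stdRow_of_neg (by omega), Matrix.zero_vecMul]
    · rw [elemBlock_row_neg q (by omega) hj (by omega) (by omega), if_neg (by omega),
        if_neg (by omega)]
  have h2 : stdRow m (-j) ᵥ* elemBlock m i p = stdRow m (-j) := by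
    rcases hj.eq_or_lt with rfl | hi'
    · rw [stdRow_of_le (by omega), Matrix.zero_vecMul]
    · rw [elemBlock_row_pos p (by omega) (by omega) (by omega) (by omega), if_neg (by omega),
        if_neg (by omega)]
  have h3 := elemBlock_row_pos (m := m) p hi (by omega) (x := -j - 1) (by omega) (by omega)
  have h4 := elemBlock_row_neg q (by omega) hj (x := i) (by omega) (by omega)
  have h5 := elemBlock_row_pos p hi (by omega) hx hxm
  have h6 := elemBlock_row_neg q (by omega) hj hx hxm
  rw [if_neg (by omega), if_neg (by omega)] at h3 h4
  split_ifs at h5 h6 ⊢ <;>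
    first
    | omega
    | simp only [Matrix.add_vecMul, Matrix.smul_vecMul, h1, h2, h3, h4, h5, h6]

theorem commute_elemProd {l l' : List (ℤ × S)}
    (h : ∀ t ∈ l, ∀ t' ∈ l', Commute (elemBlock m t.1 t.2) (elemBlock m t'.1 t'.2)) :
    Commute (elemProd m l) (elemProd m l') := by
  refine Commute.list_prod_left _ _ fun M hM => Commute.list_prod_right _ _ fun N hN => ?_
  obtain ⟨t, ht, rfl⟩ := List.mem_map.1 hM
  obtain ⟨t', ht', rfl⟩ := List.mem_map.1 hN
  exact h t ht t' ht'

theorem commute_elemProd_pos_neg {l l' : List (ℤ × S)} {b : ℤ} (hl : ∀ t ∈ l, 0 ≤ t.1 ∧ t.1 ≤ b)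
    (hl' : ∀ t ∈ l', -(m : ℤ) ≤ t.1 ∧ t.1 ≤ -b - 2) :
    Commute (elemProd m l) (elemProd m l') :=
  commute_elemProd fun t ht t' ht' => by
    have h1 := hl t ht
    have h2 := hl' t' ht'
    exact commute_elemBlock_pos_neg _ _ h1.1 h2.1 (by omega)

theorem TupleEquiv.elemProd_pos {γ δ : List ℤ} (h : TupleEquiv γ δ) (g : ℤ → S)
    (hγ : ∀ i ∈ γ, 0 ≤ i ∧ i < m) :
    elemProd m (withBlocks g γ) = elemProd m (withBlocks g δ) := by
  induction h with
  | refl => rfl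
  | @tail γ' δ' h1 h ih =>
    rw [ih]
    have hp := TupleEquiv.perm h1
    obtain ⟨α, β, i, j, hij, rfl, rfl⟩ := h
    have h2 := hγ i (hp.mem_iff.2 (by simp))
    have h3 := hγ j (hp.mem_iff.2 (by simp))
    simp only [withBlocks, List.map_append, List.map_cons, elemProd_append, elemProd_cons]
    rw [← mul_assoc (elemBlock m i _), ← mul_assoc (elemBlock m j _),
      commute_elemBlock_pos _ _ h2.1 h2.2 h3.1 h3.2 hij]

theorem TupleEquiv.elemProd_neg {γ δ : List ℤ} (h : TupleEquiv γ δ) (g : ℤ → S)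
    (hγ : ∀ i ∈ γ, -(m : ℤ) ≤ i ∧ i < 0) :
    elemProd m (withBlocks g γ) = elemProd m (withBlocks g δ) := by
  induction h with
  | refl => rfl
  | @tail γ' δ' h1 h ih =>
    rw [ih]
    have hp := TupleEquiv.perm h1
    obtain ⟨α, β, i, j, hij, rfl, rfl⟩ := h
    have h2 := hγ i (hp.mem_iff.2 (by simp))
    have h3 := hγ j (hp.mem_iff.2 (by simp))
    simp only [withBlocks, List.map_append, List.map_cons, elemProd_append, elemProd_cons]
    rw [← mul_assoc (elemBlock m i _), ← mul_assoc (elemBlock m j _),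
      commute_elemBlock_neg _ _ h2.2 h2.1 h3.2 h3.1 hij]

/-! ### Invertibility -/

/-- For i other than 0 and -m the inverse of M_i(P) is M_{-i}(-P), whatever P is; in the two
remaining cases the matrix is block diagonal. -/
theorem isUnit_elemBlock {i : ℤ} {p : S} (h1 : -(m : ℤ) ≤ i) (h2 : i < m)
    (hp : i = 0 ∨ i = -(m : ℤ) → IsUnit p) : IsUnit (elemBlock m i p) := by
  by_cases h : i = 0 ∨ i = -(m : ℤ)
  · obtain ⟨u, rfl⟩ := hp h
    have key : ∀ u v : Sˣ, (u : S) * v = 1 → elemBlock m i (u : S) * elemBlock m i (v : S) = 1 := by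
      intro u v huv
      refine ext_stdRow fun x hx hxm => ?_
      rw [← Matrix.vecMul_vecMul, Matrix.vecMul_one]
      rcases h with rfl | rfl
      · have h3 := fun p : S => elemBlock_row_pos p le_rfl (by omega) hx hxm
        by_cases h0 : x = 0
        · subst h0
          simp only [if_true, stdRow_of_neg (show (0 : ℤ) - 1 < 0 by omega), add_zero] at h3
          rw [h3, Matrix.smul_vecMul, h3, smul_smul, huv, one_smul]
        · simp only [if_neg h0, if_neg (show x ≠ 0 - 1 by omega)] at h3
          rw [h3, h3]
      · have h3 := fun p : S => elemBlock_row_neg p (show -(m : ℤ) < 0 by omega) le_rfl hx hxm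
        simp only [neg_neg] at h3
        by_cases h0 : x = (m : ℤ) - 1
        · subst h0
          simp only [if_true, stdRow_of_le (le_refl (m : ℤ)), add_zero] at h3
          rw [h3, Matrix.smul_vecMul, h3, smul_smul, huv, one_smul]
        · simp only [if_neg h0, if_neg (show x ≠ m by omega)] at h3
          rw [h3, h3]
    exact ⟨⟨_, _, key u u⁻¹ (by simp), key u⁻¹ u (by simp)⟩, rfl⟩
  · have key : ∀ i : ℤ, ∀ p : S, -(m : ℤ) < i → i < m → i ≠ 0 →
        elemBlock m i p * elemBlock m (-i) (-p) = 1 := by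
      intro i p h1 h2 h0
      refine ext_stdRow fun x hx hxm => ?_
      rw [← Matrix.vecMul_vecMul, Matrix.vecMul_one]
      rcases lt_or_gt_of_ne h0 with hi | hi
      · have h3 := fun y hy hy' => elemBlock_row_neg (m := m) p (x := y) hi h1.le hy hy'
        have h4 := fun y hy hy' => elemBlock_row_pos (m := m) (i := -i) (-p) (x := y)
          (by omega) (by omega) hy hy'
        rw [h3 x hx hxm]
        split_ifs with ha hb
        · rw [Matrix.add_vecMul, Matrix.smul_vecMul, h4 _ (by omega) (by omega), if_neg (by omega),
            if_pos rfl, h4 _ (by omega) (by omega), if_pos rfl, ha]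
          simp
        · rw [h4 _ (by omega) (by omega), if_neg (by omega), if_pos rfl, hb]
        · rw [h4 _ (by omega) (by omega), if_neg (by omega), if_neg (by omega)]
      · have h3 := fun y hy hy' => elemBlock_row_pos (m := m) p (x := y) hi.le h2 hy hy'
        have h4 := fun y hy hy' => elemBlock_row_neg (m := m) (i := -i) (-p) (x := y)
          (by omega) (by omega) hy hy'
        simp only [neg_neg] at h4
        rw [h3 x hx hxm]
        split_ifs with ha hb
        · rw [Matrix.add_vecMul, Matrix.smul_vecMul, h4 _ (by omega) (by omega), if_neg (by omega),
            if_pos rfl, h4 _ (by omega) (by omega), if_pos rfl, ha]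
          simp
        · rw [h4 _ (by omega) (by omega), if_neg (by omega), if_pos rfl, hb]
        · rw [h4 _ (by omega) (by omega), if_neg (by omega), if_neg (by omega)]
    have h3 := key i p (by omega) h2 (by omega)
    have h4 := key (-i) (-p) (by omega) (by omega) (by omega)
    rw [neg_neg, neg_neg] at h4
    exact ⟨⟨_, _, h3, h4⟩, rfl⟩

theorem isUnit_elemProd {l : List (ℤ × S)} (hl : ∀ t ∈ l, -(m : ℤ) ≤ t.1 ∧ t.1 < m)
    (hp : ∀ t ∈ l, t.1 = 0 ∨ t.1 = -(m : ℤ) → IsUnit t.2) : IsUnit (elemProd m l) := by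
  induction l with
  | nil => rw [elemProd_nil]; exact isUnit_one
  | cons t l ih =>
    rw [elemProd_cons]
    have ht := hl t (by simp)
    exact (isUnit_elemBlock ht.1 ht.2 (hp t (by simp))).mul
      (ih (fun t ht => hl t (by simp [ht])) fun t ht => hp t (by simp [ht]))

end Blocks

/-! ### Elimination with a unitriangular complement -/

section Elimination

variable {S ι : Type*} [Ring S] [Fintype ι] [DecidableEq ι]

/-- A nonzero entry of N^k comes from a path of k steps, each of which lowers the rank. -/
theorem isNilpotent_of_rank_lt {N : Matrix ι ι S} (rk : ι → ℕ)
    (h : ∀ y z, N y z ≠ 0 → rk z < rk y) : IsNilpotent N := by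
  have key : ∀ (k : ℕ) (y z : ι), (N ^ k) y z ≠ 0 → rk z + k ≤ rk y := by
    intro k
    induction k with
    | zero =>
      intro y z hyz
      rw [pow_zero, Matrix.one_apply] at hyz
      by_cases hh : y = z
      · simp [hh]
      · simp [hh] at hyz
    | succ k ih =>
      intro y z hyz
      rw [pow_succ, Matrix.mul_apply] at hyz
      obtain ⟨w, -, hw⟩ := Finset.exists_ne_zero_of_sum_ne_zero hyz
      have h1 := ih y w (left_ne_zero_of_mul hw)
      have h2 := h w z (right_ne_zero_of_mul hw)
      omega
  refine ⟨Finset.univ.sup rk + 1, ?_⟩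
  ext y z
  by_contra hne
  have h1 := key _ y z hne
  have h2 := Finset.le_sup (f := rk) (Finset.mem_univ y)
  omega

/-- If the rows of `T` other than `i₀` can be matched with the columns other than `c₀` so that the
resulting square matrix is triangular with diagonal entries `-1`, then `T` is equivalent to
`diag(I, A)`, where `A` is obtained from a column `H` with `T H = A e_{i₀}` and `H_{c₀} = 1`. -/
theorem exists_elimination (T : Matrix ι ι S) (i₀ c₀ t : ι) (π : Equiv.Perm ι) (hπ : π c₀ = i₀)
    (rk : ι → ℕ) (h1 : ∀ y, y ≠ c₀ → T (π y) y = -1)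
    (h2 : ∀ y z, y ≠ c₀ → z ≠ y → T (π y) z ≠ 0 → rk z < rk y) (H : ι → S) (hH : H c₀ = 1)
    (A : S) (hT : T *ᵥ H = Pi.single i₀ A) :
    ∃ U V : Matrix ι ι S, IsUnit U ∧ IsUnit V ∧
      U * T * V = Matrix.diagonal (fun x => if x = t then A else 1) ∧
      (∀ x, U x i₀ = if x = t then 1 else 0) ∧ ∀ z, V c₀ z = if z = t then 1 else 0 := by
  set T' : Matrix ι ι S := T.submatrix π id with hT'
  -- The rows of -T' other than c₀, completed by a unit row. The difference 1 - G strictly lowers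
  -- the rank, so G is invertible.
  set G : Matrix ι ι S := Matrix.of fun y z =>
    if y = c₀ then (if z = c₀ then 1 else 0) else -T' y z with hG
  have hGu : IsUnit G := by
    have hn : IsNilpotent (1 - G) := by
      refine isNilpotent_of_rank_lt rk fun y z hyz => ?_
      simp only [hG, hT', Matrix.sub_apply, Matrix.of_apply, Matrix.submatrix_apply, id] at hyz
      by_cases hy : y = c₀
      · subst hy
        rw [if_pos rfl, Matrix.one_apply] at hyz
        simp [eq_comm] at hyz
      · rw [if_neg hy] at hyz
        by_cases hz : z = y
        · subst hz; simp [h1 z hy] at hyz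
        · refine h2 y z hy hz fun h0 => ?_
          simp [h0, Ne.symm hz] at hyz
    simpa using hn.isUnit_one_sub
  obtain ⟨Gu, hGu⟩ := hGu
  set V₀ : Matrix ι ι S := (↑Gu⁻¹ : Matrix ι ι S) with hV₀
  have hGV : G * V₀ = 1 := by rw [← hGu]; exact Gu.mul_inv
  have hVG : V₀ * G = 1 := by rw [← hGu]; exact Gu.inv_mul
  have hVc : ∀ z, V₀ c₀ z = if z = c₀ then 1 else 0 := by
    intro z
    have h3 := congrFun (congrFun hGV c₀) z
    rw [Matrix.mul_apply] at h3
    simp only [hG, Matrix.of_apply, if_true, ite_mul, one_mul, zero_mul, Finset.sum_ite_eq',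
      Finset.mem_univ] at h3
    rw [h3, Matrix.one_apply]
    simp only [eq_comm]
  -- T H vanishes outside the row i₀ = π c₀, hence G H is the unit column at c₀, and H is the column
  -- c₀ of the inverse of G.
  have hVH : V₀ *ᵥ Pi.single c₀ 1 = H := by
    have h3 : G *ᵥ H = Pi.single c₀ 1 := by
      ext y
      by_cases hy : y = c₀
      · subst hy
        simp [Matrix.mulVec, dotProduct, hG, hH]
      · have h4 := congrFun hT (π y)
        rw [← hπ, Pi.single_eq_of_ne (by simpa using hy)] at h4
        rw [Pi.single_eq_of_ne hy]
        simp only [Matrix.mulVec, dotProduct, hG, Matrix.of_apply, if_neg hy, hT',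
          Matrix.submatrix_apply, id, neg_mul, Finset.sum_neg_distrib] at h4 ⊢
        rw [h4, neg_zero]
    rw [← h3, Matrix.mulVec_mulVec, hVG, Matrix.one_mulVec]
  -- All rows of W but row c₀ are negative unit rows, and its entry at (c₀, c₀) is A; only the rest
  -- of row c₀ is left to be cleared.
  set W : Matrix ι ι S := T' * V₀ with hW
  have hW1 : ∀ y z, y ≠ c₀ → W y z = if y = z then -1 else 0 := by
    intro y z hy
    have h3 := congrFun (congrFun hGV y) z
    rw [Matrix.mul_apply] at h3
    simp only [hG, Matrix.of_apply, if_neg hy, neg_mul, Finset.sum_neg_distrib] at h3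
    rw [← Matrix.mul_apply, ← hW, neg_eq_iff_eq_neg, Matrix.one_apply] at h3
    rw [h3]; split_ifs <;> simp
  have hW2 : W c₀ c₀ = A := by
    have h3 : (W *ᵥ Pi.single c₀ 1) c₀ = A := by
      rw [hW, ← Matrix.mulVec_mulVec, hVH]
      have h4 := congrFun hT (π c₀)
      rw [hπ, Pi.single_eq_same] at h4
      rw [← h4]
      simp [Matrix.mulVec, dotProduct, hT', hπ]
    simpa using h3
  -- K clears row c₀ by means of the negative unit rows and changes the sign of the latter. It is an
  -- involution, and its column c₀ is a unit column, which gives control of column i₀ of U.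
  set K : Matrix ι ι S := Matrix.of fun y z =>
    if y = c₀ then (if z = c₀ then 1 else W c₀ z) else (if y = z then -1 else 0) with hK
  have hKmul : ∀ (X : Matrix ι ι S), (∀ y z, y ≠ c₀ → X y z = if y = z then -1 else 0) →
      ∀ y z, (K * X) y z = if y = c₀ then (if z = c₀ then X c₀ c₀ else X c₀ z - W c₀ z)
        else (if y = z then 1 else 0) := by
    intro X hX y z
    rw [Matrix.mul_apply]
    by_cases hy : y = c₀
    · subst hy
      rw [← Finset.add_sum_erase _ _ (Finset.mem_univ y)]
      have h3 : ∀ w ∈ Finset.univ.erase y, K y w * X w z = if w = z then -W y w else 0 := by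
        intro w hw
        have hw' := Finset.ne_of_mem_erase hw
        rw [hX w z hw']
        simp [hK, hw']
      rw [Finset.sum_congr rfl h3, Finset.sum_ite_eq']
      by_cases hz : z = y
      · subst hz; simp [hK]
      · simp [hK, hz, sub_eq_add_neg]
    · simp only [hK, Matrix.of_apply, if_neg hy, ite_mul, neg_mul, one_mul, zero_mul,
        Finset.sum_ite_eq, Finset.mem_univ, if_true]
      rw [hX y z hy]
      split_ifs <;> simp
  have hKK : K * K = 1 := by
    ext y z
    rw [hKmul K (fun y z hy => by simp [hK, hy]), Matrix.one_apply]
    by_cases hy : y = c₀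
    · subst hy
      by_cases hz : z = y
      · subst hz; simp [hK]
      · simp [hK, hz, Ne.symm hz]
    · simp [hy]
  set sw : Equiv.Perm ι := Equiv.swap c₀ t with hsw
  have hKT : K.submatrix sw π.symm * T = (K * T').submatrix sw id := by
    have h3 : T = T'.submatrix π.symm id := by ext; simp [hT']
    conv_lhs => rw [h3]
    exact Matrix.submatrix_mul_equiv _ _ _ _ _
  have hsub : ∀ x, (sw x = c₀) = (x = t) := by
    intro x
    rw [hsw, Equiv.swap_apply_eq_iff, Equiv.swap_apply_left]
  refine ⟨K.submatrix sw π.symm, V₀.submatrix id sw, ?_, ?_, ?_, ?_, ?_⟩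
  · refine ⟨⟨_, K.submatrix π.symm sw, ?_, ?_⟩, rfl⟩
    · exact (Matrix.submatrix_mul_equiv K K sw π.symm sw).trans
        (by rw [hKK]; exact Matrix.submatrix_one_equiv sw)
    · exact (Matrix.submatrix_mul_equiv K K π.symm sw π.symm).trans
        (by rw [hKK]; exact Matrix.submatrix_one_equiv π.symm)
  · refine ⟨⟨_, G.submatrix sw id, ?_, ?_⟩, rfl⟩
    · exact (Matrix.submatrix_mul_equiv V₀ G id sw id).trans
        (by rw [hVG]; exact Matrix.submatrix_one_equiv (Equiv.refl ι))
    · exact (Matrix.submatrix_mul_equiv G V₀ sw (Equiv.refl ι) sw).trans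
        (by rw [hGV]; exact Matrix.submatrix_one_equiv sw)
  · rw [hKT]
    have := Matrix.submatrix_mul_equiv (K * T') V₀ sw (Equiv.refl ι) sw
    refine Eq.trans this ?_
    rw [mul_assoc, ← hW]
    ext y z
    rw [Matrix.submatrix_apply, hKmul W hW1, Matrix.diagonal_apply]
    simp only [hsub, EmbeddingLike.apply_eq_iff_eq, hW2, sub_self]
    by_cases hy : y = t
    · subst hy
      by_cases hz : z = y
      · subst hz; simp
      · simp [hz, Ne.symm hz]
    · simp [hy]
  · intro x
    have h3 : π.symm i₀ = c₀ := by rw [← hπ]; simp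
    rw [Matrix.submatrix_apply, h3]
    simp only [hK, Matrix.of_apply, hsub, if_true]
    by_cases hx : x = t
    · simp [hx]
    · rw [if_neg hx, if_neg hx, if_neg hx]
  · intro z
    rw [Matrix.submatrix_apply, id, hVc]
    simp only [hsub]

end Elimination

/-! ### The pencil of an admissible pair of tuples -/

section Pencil

variable {S : Type*} [Ring S] {m h : ℕ}

/-- The block `-a_i` at `i ≥ 0` and `a_{-i}` at `i < 0`. -/
def signedBlock (a : ℕ → S) (i : ℤ) : S := if 0 ≤ i then -a i.toNat else a (-i).toNat

theorem row_distant_pos (g : ℤ → S) {l : List ℤ} {x : ℤ} (hl : ∀ j ∈ l, 0 ≤ j ∧ j < m)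
    (hx : 0 ≤ x ∧ x < m) (hn : l.Nodup) (hd : ∀ i ∈ l, i + 1 ∉ l) :
    stdRow m x ᵥ* elemProd m (withBlocks g l) =
      if x ∈ l then g x • stdRow m x + stdRow m (x - 1) else
      if x + 1 ∈ l then stdRow m (x + 1) else stdRow m x :=
  isLadder_pos.row_distant g (fun j hj => by have := hl j hj; omega) (by omega) hn hd

theorem row_distant_neg (g : ℤ → S) {l : List ℤ} {x : ℤ} (hl : ∀ j ∈ l, -(m : ℤ) ≤ j ∧ j < 0)
    (hx : 0 ≤ x ∧ x < m) (hn : l.Nodup) (hd : ∀ i ∈ l, i + 1 ∉ l) :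
    stdRow m x ᵥ* elemProd m (withBlocks g l) =
      if -x - 1 ∈ l then g (-x - 1) • stdRow m x + stdRow m (x + 1) else
      if -x ∈ l then stdRow m (x - 1) else stdRow m x := by
  have := (isLadder_neg (m := m)).row_distant g (x := -x - 1)
    (fun j hj => by have := hl j hj; omega)
    (by omega) hn hd
  ring_nf at this ⊢
  exact this

/-- Row `x` of the product of the elementary matrices of an admissible tuple of `{0, …, h}`. -/
theorem row_admissible (g : ℤ → S) (hh : Even h) (hm : h < m) {x : ℤ} (hx : 0 ≤ x) (hxm : x < m) :
    stdRow m x ᵥ* elemProd m (withBlocks g (offParity h ++ onParity h)) =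
      if (h : ℤ) < x then stdRow m x else
      if x = h then g h • stdRow m h + stdRow m (h - 1) else
      if x % 2 = 0 then stdRow m (x + 2) else
      g x • stdRow m (x + 1) + (g (x - 1) • stdRow m (x - 1) + stdRow m (x - 2)) := by
  obtain ⟨t, ht⟩ := hh
  have hoff := fun y hy hy' => row_distant_pos (m := m) g (l := offParity h) (x := y)
    (fun j hj => by rw [mem_offParity] at hj; omega) ⟨hy, hy'⟩ (nodup_offParity h)
    (fun i hi => by rw [mem_offParity] at hi ⊢; omega)
  have hon := fun y hy hy' => row_distant_pos (m := m) g (l := onParity h) (x := y)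
    (fun j hj => by rw [mem_onParity] at hj; omega) ⟨hy, hy'⟩ (nodup_onParity h)
    (fun i hi => by rw [mem_onParity] at hi ⊢; omega)
  simp only [mem_offParity] at hoff
  simp only [mem_onParity] at hon
  rw [withBlocks, List.map_append, elemProd_append, ← Matrix.vecMul_vecMul]
  simp only [withBlocks] at hoff hon
  rw [hoff x hx hxm]
  by_cases h1 : (h : ℤ) < x
  · rw [if_neg (by omega), if_neg (by omega), hon x hx hxm, if_neg (by omega), if_neg (by omega),
      if_pos h1]
  by_cases h2 : x = h
  · subst h2
    rw [if_neg (by omega), if_neg (by omega), hon _ hx hxm, if_pos (by omega), if_neg (by omega),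
      if_pos rfl]
  by_cases h3 : x % 2 = 0
  · rw [if_neg (by omega), if_pos (by omega), hon (x + 1) (by omega) (by omega),
      if_neg (by omega), if_pos (by omega), if_neg h1, if_neg h2, if_pos h3]
    congr 1; ring
  · rw [if_pos (by omega), Matrix.add_vecMul, Matrix.smul_vecMul, hon x hx hxm,
      hon (x - 1) (by omega) (by omega), if_neg (by omega), if_pos (by omega), if_pos (by omega),
      if_neg h1, if_neg h2, if_neg h3]
    congr 3; ring

/-- Row `x` of the product of the elementary matrices of an admissible tuple of
`{-m, …, -h - 1}`. -/
theorem row_admissible_neg (g : ℤ → S) (hh : Even h) (hm : h < m)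
    (hg : ∀ i < -(m : ℤ), g i = 0) {x : ℤ} (hx : 0 ≤ x) (hxm : x < m) :
    stdRow m x ᵥ* elemProd m (withBlocks g
      (shiftTuple (offParity (m - h - 1) ++ onParity (m - h - 1)) (-(m : ℤ)))) =
      if x < h then stdRow m x else
      if x = h then g (-h - 1) • stdRow m h + stdRow m (h + 1) else
      if x % 2 = 0 then stdRow m (x - 2) else
      g (-x - 1) • stdRow m (x - 1) + (g (-x - 2) • stdRow m (x + 1) + stdRow m (x + 2)) := by
  obtain ⟨t, ht⟩ := hh
  have hsub : ((m - h - 1 : ℕ) : ℤ) = m - h - 1 := by omega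
  have hoff := fun y hy hy' => row_distant_neg (m := m) g
    (l := shiftTuple (offParity (m - h - 1)) (-(m : ℤ))) (x := y)
    (fun j hj => by rw [mem_shiftTuple, mem_offParity] at hj; omega) ⟨hy, hy'⟩
    ((nodup_offParity _).map (add_left_injective _))
    (fun i hi => by rw [mem_shiftTuple, mem_offParity] at hi ⊢; omega)
  have hon := fun y hy hy' => row_distant_neg (m := m) g
    (l := shiftTuple (onParity (m - h - 1)) (-(m : ℤ))) (x := y)
    (fun j hj => by rw [mem_shiftTuple, mem_onParity] at hj; omega) ⟨hy, hy'⟩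
    ((nodup_onParity _).map (add_left_injective _))
    (fun i hi => by rw [mem_shiftTuple, mem_onParity] at hi ⊢; omega)
  simp only [mem_shiftTuple, mem_offParity, hsub] at hoff
  simp only [mem_shiftTuple, mem_onParity, hsub] at hon
  rw [shiftTuple_append, withBlocks, List.map_append, elemProd_append, ← Matrix.vecMul_vecMul]
  simp only [withBlocks] at hoff hon
  rw [hoff x hx hxm]
  by_cases h1 : x < h
  · rw [if_neg (by omega), if_neg (by omega), hon x hx hxm, if_neg (by omega), if_neg (by omega),
      if_pos h1]
  by_cases h2 : x = h
  · subst h2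
    rw [if_neg (by omega), if_neg (by omega), hon _ hx hxm, if_pos (by omega), if_neg (by omega),
      if_pos rfl]
  by_cases h3 : x % 2 = 0
  · rw [if_neg (by omega), if_pos (by omega), hon (x - 1) (by omega) (by omega),
      if_neg (by omega), if_pos (by omega), if_neg h1, if_neg h2, if_pos h3]
    congr 1; ring
  · rw [if_pos (by omega), Matrix.add_vecMul, Matrix.smul_vecMul, hon x hx hxm,
      if_neg (by omega), if_pos (by omega), if_neg h1, if_neg h2, if_neg h3]
    congr 1
    -- For x = m - 1 the rows x + 1 and x + 2 are out of range, and both sides vanish.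
    by_cases h4 : x + 1 < m
    · rw [hon (x + 1) (by omega) h4, if_pos (by omega), show -(x + 1) - 1 = -x - 2 by ring,
        show x + 1 + 1 = x + 2 by ring]
    · rw [stdRow_of_le (by omega), stdRow_of_le (by omega), hg _ (by omega)]
      simp

/-- Row `x` of the pencil `λ M_v - M_w`. -/
def pencilRow (m h : ℕ) (lam : S) (g : ℤ → S) (x : ℤ) : Fin m → S :=
  if x = h then
    lam • (g (-h - 1) • stdRow m h + stdRow m (h + 1)) - (g h • stdRow m h + stdRow m (h - 1))
  else if x < h then
    if x % 2 = 0 then lam • stdRow m x - stdRow m (x + 2)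
    else lam • stdRow m x -
      (g x • stdRow m (x + 1) + (g (x - 1) • stdRow m (x - 1) + stdRow m (x - 2)))
  else
    if x % 2 = 0 then lam • stdRow m (x - 2) - stdRow m x
    else lam • (g (-x - 1) • stdRow m (x - 1) +
      (g (-x - 2) • stdRow m (x + 1) + stdRow m (x + 2))) - stdRow m x

theorem pencil_apply (lam : S) (g : ℤ → S) (hh : Even h) (hm : h < m)
    (hg : ∀ i < -(m : ℤ), g i = 0) (x : Fin m) :
    (lam • elemProd m (withBlocks g
        (shiftTuple (offParity (m - h - 1) ++ onParity (m - h - 1)) (-(m : ℤ)))) -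
      elemProd m (withBlocks g (offParity h ++ onParity h))) x =
      pencilRow m h lam g ((x : ℕ) : ℤ) := by
  have h1 := row_admissible g hh hm (x := ((x : ℕ) : ℤ)) (by omega) (by omega)
  have h2 := row_admissible_neg g hh hm hg (x := ((x : ℕ) : ℤ)) (by omega) (by omega)
  rw [stdRow_vecMul] at h1 h2
  refine Eq.trans (congrArg₂ (fun u v => lam • u - v) h2 h1) ?_
  unfold pencilRow
  split_ifs <;> first | omega | rfl

/-! ### The Horner column and its image under the pencil -/

/-- The blocks `Σ_{i ≥ 0} λ^{t+i} a_{2t+i}` of the last column of the eliminating matrix. -/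
def hornerBlock (m : ℕ) (lam : S) (a : ℕ → S) (t : ℕ) : S :=
  ∑ i ∈ Finset.range (m + 1), lam ^ (t + i) * a (2 * t + i)

/-- Formally the block is λ^{-t} times the part of A(λ) of degree at least 2t; two coefficients are
split off at a time. -/
theorem hornerBlock_succ (lam : S) {a : ℕ → S} (ha : ∀ j, m < j → a j = 0) (t : ℕ) :
    hornerBlock m lam a t =
      lam ^ t * a (2 * t) + lam ^ (t + 1) * a (2 * t + 1) + lam * hornerBlock m lam a (t + 1) := by
  -- Two vanishing terms are appended so that a range of length m + 1 remains after two terms are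
  -- split off.
  have h1 : hornerBlock m lam a t =
      ∑ i ∈ Finset.range (m + 1 + 1 + 1), lam ^ (t + i) * a (2 * t + i) := by
    rw [Finset.sum_range_succ, Finset.sum_range_succ, ha (2 * t + (m + 1)) (by omega),
      ha (2 * t + (m + 1 + 1)) (by omega)]
    simp [hornerBlock]
  rw [h1, Finset.sum_range_succ', Finset.sum_range_succ', hornerBlock, Finset.mul_sum]
  have h2 : ∀ i, lam ^ (t + (i + 1 + 1)) * a (2 * t + (i + 1 + 1)) =
      lam * (lam ^ (t + 1 + i) * a (2 * (t + 1) + i)) := by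
    intro i
    rw [← mul_assoc, ← pow_succ', show t + (i + 1 + 1) = t + 1 + i + 1 by ring,
      show 2 * t + (i + 1 + 1) = 2 * (t + 1) + i by ring]
  rw [Finset.sum_congr rfl fun i _ => h2 i]
  simp only [add_zero, zero_add]
  abel

theorem hornerBlock_eq_zero (lam : S) {a : ℕ → S} (ha : ∀ j, m < j → a j = 0) {t : ℕ}
    (ht : m < 2 * t) : hornerBlock m lam a t = 0 :=
  Finset.sum_eq_zero fun i _ => by rw [ha _ (by omega), mul_zero]

/-- The last column of the eliminating matrix. -/
def hornerColumn (m : ℕ) (lam : S) (a : ℕ → S) (x : Fin m) : S :=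
  if (x : ℕ) % 2 = 0 then lam ^ ((x : ℕ) / 2) else hornerBlock m lam a (((x : ℕ) + 1) / 2)

theorem stdRow_dotProduct (v : Fin m → S) (x : Fin m) : stdRow m ((x : ℕ) : ℤ) ⬝ᵥ v = v x := by
  simp [dotProduct, stdRow, Fin.val_inj]

theorem stdRow_dot_even (lam : S) (a : ℕ → S) {t : ℕ} {x : ℤ} (hx : x = 2 * t) (ht : 2 * t < m) :
    stdRow m x ⬝ᵥ hornerColumn m lam a = lam ^ t := by
  have := stdRow_dotProduct (hornerColumn m lam a) ⟨2 * t, ht⟩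
  simp [hornerColumn] at this
  rw [hx, this]

theorem stdRow_dot_odd (lam : S) {a : ℕ → S} (ha : ∀ j, m < j → a j = 0) {t : ℕ} {x : ℤ}
    (hx : x = 2 * t + 1) :
    stdRow m x ⬝ᵥ hornerColumn m lam a = hornerBlock m lam a (t + 1) := by
  by_cases ht : 2 * t + 1 < m
  · have := stdRow_dotProduct (hornerColumn m lam a) ⟨2 * t + 1, ht⟩
    rw [hx]
    push_cast at this
    rw [this, hornerColumn]
    simp only
    rw [if_neg (by omega)]
    congr 1; omega
  · rw [stdRow_of_le (by omega), zero_dotProduct, hornerBlock_eq_zero lam ha (by omega)]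

/-- Even rows other than h compare consecutive powers of λ. Odd rows and row h express the recursion
`hornerBlock_succ`. In row 1, or in row 0 if h = 0, the entry at place -1 that would cancel
`hornerBlock` at 0, that is A(λ), is missing. -/
theorem pencilRow_dot (lam : S) (hlam : ∀ s, Commute lam s) {a : ℕ → S}
    (ha : ∀ j, m < j → a j = 0) (hh : Even h) (hm : h < m) {x : ℤ} (hx : 0 ≤ x) (hxm : x < m) :
    pencilRow m h lam (signedBlock a) x ⬝ᵥ hornerColumn m lam a =
      if x = (if h = 0 then 0 else 1) then hornerBlock m lam a 0 else 0 := by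
  obtain ⟨s, hs⟩ := hh
  have hodd := fun t x hx => stdRow_dot_odd (m := m) lam ha (t := t) (x := x) hx
  have heven := fun t x hx ht => stdRow_dot_even (m := m) lam a (t := t) (x := x) hx ht
  have hneg : ∀ x : ℤ, x < 0 → stdRow m x ⬝ᵥ hornerColumn m lam a = 0 := fun x hx => by
    rw [stdRow_of_neg hx, zero_dotProduct]
  have hc : ∀ (b : S) (t : ℕ), b * lam ^ t = lam ^ t * b := fun b t => ((hlam b).pow_left t).symm
  have hc' : ∀ (b : S) (t : ℕ), lam * (b * lam ^ t) = lam ^ (t + 1) * b := fun b t => by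
    rw [hc, pow_succ', mul_assoc]
  have hg1 : ∀ (t : ℕ) (x : ℤ), x = t → signedBlock a x = -a t := by
    rintro t x rfl; simp [signedBlock]
  have hg2 : ∀ (t : ℕ) (x : ℤ), x = -t → 0 < t → signedBlock a x = a t := by
    rintro t x rfl ht; simp [signedBlock, ht.ne']
  by_cases h1 : x = h
  · rw [pencilRow, if_pos h1]
    simp only [sub_dotProduct, add_dotProduct, smul_dotProduct, smul_eq_mul]
    rw [heven s h (by omega) (by omega), hodd s (h + 1) (by omega),
      hg2 (2 * s + 1) _ (by omega) (by omega), hg1 (2 * s) _ (by omega), mul_add, hc', neg_mul, hc]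
    have h2 := hornerBlock_succ lam ha s
    by_cases h3 : h = 0
    · obtain rfl : s = 0 := by omega
      rw [hneg _ (by omega), if_pos (by rw [if_pos h3]; omega), h2]
      abel
    · obtain ⟨u, rfl⟩ : ∃ u, s = u + 1 := ⟨s - 1, by omega⟩
      rw [hodd u (h - 1) (by omega), if_neg (by rw [if_neg h3]; omega), h2]
      abel
  by_cases h2 : x < h
  · by_cases h3 : x % 2 = 0
    · obtain ⟨t, ht⟩ : ∃ t : ℕ, x = 2 * t := ⟨(x / 2).toNat, by omega⟩
      rw [pencilRow, if_neg h1, if_pos h2, if_pos h3, if_neg (by split_ifs <;> omega)]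
      simp only [sub_dotProduct, smul_dotProduct, smul_eq_mul]
      rw [heven t x ht (by omega), heven (t + 1) (x + 2) (by omega) (by omega), pow_succ', sub_self]
    · obtain ⟨t, ht⟩ : ∃ t : ℕ, x = 2 * t + 1 := ⟨(x / 2).toNat, by omega⟩
      rw [pencilRow, if_neg h1, if_pos h2, if_neg h3]
      simp only [sub_dotProduct, add_dotProduct, smul_dotProduct, smul_eq_mul]
      rw [hodd t x ht, heven (t + 1) (x + 1) (by omega) (by omega),
        heven t (x - 1) (by omega) (by omega), hg1 (2 * t + 1) _ (by omega),
        hg1 (2 * t) _ (by omega), neg_mul, neg_mul, hc, hc]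
      have h4 := hornerBlock_succ lam ha t
      by_cases h5 : t = 0
      · subst h5
        rw [hneg _ (by omega), if_pos (by rw [if_neg (by omega)]; omega), h4]
        abel
      · obtain ⟨u, rfl⟩ : ∃ u, t = u + 1 := ⟨t - 1, by omega⟩
        rw [hodd u (x - 2) (by omega), if_neg (by rw [if_neg (by omega)]; omega), h4]
        abel
  · rw [if_neg (by split_ifs <;> omega)]
    by_cases h3 : x % 2 = 0
    · obtain ⟨t, ht⟩ : ∃ t : ℕ, x = 2 * t + 2 := ⟨(x / 2 - 1).toNat, by omega⟩
      rw [pencilRow, if_neg h1, if_neg h2, if_pos h3]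
      simp only [sub_dotProduct, smul_dotProduct, smul_eq_mul]
      rw [heven t (x - 2) (by omega) (by omega), heven (t + 1) x (by omega) (by omega), pow_succ',
        sub_self]
    · obtain ⟨t, ht⟩ : ∃ t : ℕ, x = 2 * t + 1 := ⟨(x / 2).toNat, by omega⟩
      rw [pencilRow, if_neg h1, if_neg h2, if_neg h3]
      simp only [sub_dotProduct, add_dotProduct, smul_dotProduct, smul_eq_mul]
      -- For x = m - 1 there is no entry at x + 1, but then the coefficient is a_{m+1} = 0.
      have h5 : a (2 * t + 3) * stdRow m (x + 1) ⬝ᵥ hornerColumn m lam a =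
          a (2 * t + 3) * lam ^ (t + 1) := by
        by_cases h6 : x + 1 < m
        · rw [heven (t + 1) (x + 1) (by omega) (by omega)]
        · rw [ha _ (by omega), zero_mul, zero_mul]
      rw [hg2 (2 * t + 2) _ (by omega) (by omega), hg2 (2 * t + 3) _ (by omega) (by omega), h5,
        hodd t x ht, hodd (t + 1) (x + 2) (by omega), heven t (x - 1) (by omega) (by omega),
        sub_eq_zero, hornerBlock_succ lam ha (t + 1), mul_add, mul_add, hc', hc', ← add_assoc]
      rfl

/-! ### The triangular matching of rows and columns -/

/-- The pairing of the columns other than the last with the rows of the pencil. -/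
def pencilPairing (h y : ℕ) : ℕ :=
  if y = 0 then (if h = 0 then 0 else 1)
  else if y % 2 = 0 then (if y ≤ h then y - 2 else y)
  else if h < y then y else if y + 1 = h then h else y + 2

/-- The inverse of the pairing. -/
def pencilPairingInv (h x : ℕ) : ℕ :=
  if x % 2 = 0 then (if x < h then x + 2 else if x = h then h - 1 else x)
  else if h < x then x else if x = 1 then 0 else x - 2

/-- The row matched with an even y has its only other possible entry in column y - 2. The row
matched with an odd y has its other entries in the even columns y - 1, y + 1, y + 3 or in column y +
2. So the even columns are ranked first, in increasing order, and then the odd ones in decreasing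
order, by 2m - z. -/
theorem pencilRow_pairing (lam : S) (g : ℤ → S) (hh : Even h) {y : ℕ} (hy : y ≠ 0) (z : Fin m)
    (hz : y ≤ 2 * m) :
    ((z : ℕ) = y → pencilRow m h lam g (pencilPairing h y : ℕ) z = -1) ∧
    ((z : ℕ) ≠ y → pencilRow m h lam g (pencilPairing h y : ℕ) z ≠ 0 →
      (if (z : ℕ) % 2 = 0 then (z : ℕ) else 2 * m - z) < if y % 2 = 0 then y else 2 * m - y) := by
  obtain ⟨s, hs⟩ := hh
  have hzm := z.2
  have key : ∀ w : ℤ, (stdRow m w : Fin m → S) z = if ((z : ℕ) : ℤ) = w then 1 else 0 :=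
    fun w => rfl
  have hrow : ∀ x : ℤ, ((pencilPairing h y : ℕ) : ℤ) = x →
      pencilRow m h lam g (pencilPairing h y : ℕ) z = pencilRow m h lam g x z := by
    rintro x rfl; rfl
  by_cases hy2 : y % 2 = 0
  · have h1 : pencilRow m h lam g (pencilPairing h y : ℕ) z =
        (lam • stdRow m ((y : ℤ) - 2) - stdRow m (y : ℤ) : Fin m → S) z := by
      by_cases hyh : y ≤ h
      · rw [hrow (y - 2) (by unfold pencilPairing; rw [if_neg hy, if_pos hy2, if_pos hyh]; omega),
          pencilRow, if_neg (by omega), if_pos (by omega), if_pos (by omega)]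
        simp
      · rw [hrow y (by unfold pencilPairing; rw [if_neg hy, if_pos hy2, if_neg hyh]),
          pencilRow, if_neg (by omega), if_neg (by omega), if_pos (by omega)]
    rw [h1, if_pos hy2]
    simp only [Pi.sub_apply, Pi.smul_apply, key, smul_eq_mul]
    refine ⟨fun h2 => ?_, fun h2 => ?_⟩
    · rw [if_neg (by omega), if_pos (by omega), mul_zero, zero_sub]
    · contrapose!
      intro h3
      have e1 : ((z : ℕ) : ℤ) ≠ (y : ℤ) - 2 := fun h4 => by
        rw [if_pos (by omega)] at h3; omega
      rw [if_neg e1, if_neg (by omega), mul_zero, sub_zero]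
  · rw [if_neg hy2]
    have e1 : (z : ℕ) ≠ y → ¬ ((if (z : ℕ) % 2 = 0 then (z : ℕ) else 2 * m - z) < 2 * m - y) →
        ((z : ℕ) : ℤ) ≠ (y : ℤ) - 1 ∧ ((z : ℕ) : ℤ) ≠ (y : ℤ) ∧ ((z : ℕ) : ℤ) ≠ (y : ℤ) + 1 ∧
        ((z : ℕ) : ℤ) ≠ (y : ℤ) + 2 ∧ ((z : ℕ) : ℤ) ≠ (y : ℤ) + 3 := by
      intro h1 h2
      split_ifs at h2 <;> refine ⟨?_, ?_, ?_, ?_, ?_⟩ <;> omega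
    have e2 : (z : ℕ) = y →
        ((z : ℕ) : ℤ) ≠ (y : ℤ) - 1 ∧ ((z : ℕ) : ℤ) = (y : ℤ) ∧ ((z : ℕ) : ℤ) ≠ (y : ℤ) + 1 ∧
        ((z : ℕ) : ℤ) ≠ (y : ℤ) + 2 ∧ ((z : ℕ) : ℤ) ≠ (y : ℤ) + 3 := by
      intro h1
      refine ⟨?_, ?_, ?_, ?_, ?_⟩ <;> omega
    -- The three kinds of rows that can be matched with an odd y have this common shape.
    have h1 : ∃ b c d e : S, pencilRow m h lam g (pencilPairing h y : ℕ) z =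
        b * (stdRow m ((y : ℤ) - 1) : Fin m → S) z + c * (stdRow m ((y : ℤ) + 1) : Fin m → S) z +
        d * (stdRow m ((y : ℤ) + 2) : Fin m → S) z + e * (stdRow m ((y : ℤ) + 3) : Fin m → S) z -
        (stdRow m (y : ℤ) : Fin m → S) z := by
      by_cases hyh : h < y
      · rw [hrow y (by unfold pencilPairing; rw [if_neg hy, if_neg hy2, if_pos hyh]),
          pencilRow, if_neg (by omega), if_neg (by omega), if_neg (by omega)]
        refine ⟨lam * g (-y - 1), lam * g (-y - 2), lam, 0, ?_⟩
        simp only [Pi.sub_apply, Pi.add_apply, Pi.smul_apply, smul_eq_mul]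
        noncomm_ring
      by_cases hyh' : y + 1 = h
      · rw [hrow h (by unfold pencilPairing
                       rw [if_neg hy, if_neg hy2, if_neg hyh, if_pos hyh']),
          pencilRow, if_pos rfl]
        refine ⟨0, lam * g (-h - 1) - g h, lam, 0, ?_⟩
        simp only [Pi.sub_apply, Pi.add_apply, Pi.smul_apply, smul_eq_mul]
        rw [show (h : ℤ) = y + 1 by omega, show (y : ℤ) + 1 - 1 = y by ring,
          show (y : ℤ) + 1 + 1 = y + 2 by ring]
        noncomm_ring
      · rw [hrow (y + 2) (by unfold pencilPairing
                             rw [if_neg hy, if_neg hy2, if_neg hyh, if_neg hyh']; push_cast; rfl),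
          pencilRow, if_neg (by omega), if_pos (by omega), if_neg (by omega)]
        refine ⟨0, - g (y + 1), lam, - g (y + 2), ?_⟩
        simp only [Pi.sub_apply, Pi.add_apply, Pi.smul_apply, smul_eq_mul]
        rw [show (y : ℤ) + 2 + 1 = y + 3 by ring, show (y : ℤ) + 2 - 1 = y + 1 by ring,
          show (y : ℤ) + 2 - 2 = y by ring]
        noncomm_ring
    obtain ⟨b, c, d, e, h1⟩ := h1
    rw [h1]
    simp only [key]
    refine ⟨fun h2 => ?_, fun h2 => ?_⟩
    · obtain ⟨f1, f2, f3, f4, f5⟩ := e2 h2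
      rw [if_neg f1, if_pos f2, if_neg f3, if_neg f4, if_neg f5]
      simp
    · contrapose!
      intro h3
      obtain ⟨f1, f2, f3, f4, f5⟩ := e1 h2 (by omega)
      rw [if_neg f1, if_neg f2, if_neg f3, if_neg f4, if_neg f5]
      simp

theorem pencilPairing_lt (hh : Even h) (hm : h < m) {y : ℕ} (hy : y < m) :
    pencilPairing h y < m := by
  have h2 := Nat.even_iff.1 hh
  unfold pencilPairing; split_ifs <;> omega

theorem pencilPairingInv_lt (hh : Even h) (hm : h < m) {y : ℕ} (hy : y < m) :
    pencilPairingInv h y < m := by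
  have h2 := Nat.even_iff.1 hh
  unfold pencilPairingInv; split_ifs <;> omega

theorem pencilPairingInv_pencilPairing (hh : Even h) (y : ℕ) :
    pencilPairingInv h (pencilPairing h y) = y := by
  have h2 := Nat.even_iff.1 hh
  unfold pencilPairing
  split_ifs <;> unfold pencilPairingInv <;> split_ifs <;> first | omega | contradiction

theorem pencilPairing_pencilPairingInv (hh : Even h) (x : ℕ) :
    pencilPairing h (pencilPairingInv h x) = x := by
  have h2 := Nat.even_iff.1 hh
  unfold pencilPairingInv
  split_ifs <;> unfold pencilPairing <;> split_ifs <;> first | omega | contradiction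

/-- The pencil `λ M_v - M_w` of simple admissible tuples is unimodularly equivalent to
`diag(I, A(λ))`, with control over one column of the left and one row of the right factor. -/
theorem exists_pencil_reduction (lam : S) (hlam : ∀ s, Commute lam s) {a : ℕ → S}
    (ha : ∀ j, m < j → a j = 0) (hh : Even h) (hm : h < m) (t : Fin m) :
    ∃ U V : Matrix (Fin m) (Fin m) S, IsUnit U ∧ IsUnit V ∧
      U * (lam • elemProd m (withBlocks (signedBlock a)
        (shiftTuple (offParity (m - h - 1) ++ onParity (m - h - 1)) (-(m : ℤ)))) -
      elemProd m (withBlocks (signedBlock a) (offParity h ++ onParity h))) * V =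
        Matrix.diagonal (fun x => if x = t then ∑ i ∈ Finset.range (m + 1), lam ^ i * a i else 1) ∧
      U *ᵥ stdRow m (if h = 0 then 0 else 1) = stdRow m (t : ℕ) ∧
      stdRow m 0 ᵥ* V = stdRow m (t : ℕ) := by
  have hm0 : 0 < m := by omega
  have hhe := hh
  obtain ⟨s, hs⟩ := hhe
  have hg : ∀ i < -(m : ℤ), signedBlock a i = 0 := fun i hi => by
    rw [signedBlock, if_neg (by omega)]; exact ha _ (by omega)
  let c₀ : Fin m := ⟨0, hm0⟩
  let i₀ : Fin m := ⟨if h = 0 then 0 else 1, by split_ifs <;> omega⟩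
  let π : Equiv.Perm (Fin m) :=
    { toFun := fun y => ⟨pencilPairing h y, pencilPairing_lt hh hm y.2⟩
      invFun := fun x => ⟨pencilPairingInv h x, pencilPairingInv_lt hh hm x.2⟩
      left_inv := fun y => Fin.ext (pencilPairingInv_pencilPairing hh y)
      right_inv := fun x => Fin.ext (pencilPairing_pencilPairingInv hh x) }
  obtain ⟨U, V, hU, hV, hUV, hU', hV'⟩ := exists_elimination
    (lam • elemProd m (withBlocks (signedBlock a)
        (shiftTuple (offParity (m - h - 1) ++ onParity (m - h - 1)) (-(m : ℤ)))) -
      elemProd m (withBlocks (signedBlock a) (offParity h ++ onParity h))) i₀ c₀ t π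
    (Fin.ext (by simp [π, i₀, c₀, pencilPairing]))
    (fun z => if (z : ℕ) % 2 = 0 then (z : ℕ) else 2 * m - z)
    (fun y hy => by
      rw [pencil_apply lam _ hh hm hg]
      exact (pencilRow_pairing lam _ hh (fun h0 => hy (Fin.ext h0)) y (by omega)).1 rfl)
    (fun y z hy hz => by
      rw [pencil_apply lam _ hh hm hg]
      exact (pencilRow_pairing lam _ hh (fun h0 => hy (Fin.ext h0)) z (by omega)).2
        fun h0 => hz (Fin.ext h0))
    (hornerColumn m lam a) (by simp [hornerColumn, c₀])
    (hornerBlock m lam a 0) (by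
      ext x
      have h1 := pencilRow_dot lam hlam ha hh hm (x := ((x : ℕ) : ℤ)) (by omega) (by omega)
      rw [← pencil_apply lam _ hh hm hg] at h1
      refine Eq.trans h1 ?_
      rw [Pi.single_apply]
      congr 1
      simp only [Fin.ext_iff, i₀, eq_iff_iff]
      split_ifs <;> omega)
  refine ⟨U, V, hU, hV, ?_, ?_, ?_⟩
  · rw [hUV]; simp [hornerBlock]
  · ext x
    have h1 : (stdRow m (if h = 0 then 0 else 1) : Fin m → S) = Pi.single i₀ 1 := by
      ext b
      simp only [stdRow, Pi.single_apply, Fin.ext_iff, i₀]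
      congr 1
      split_ifs <;> simp
    rw [h1, Matrix.mulVec_single_one]
    refine Eq.trans (hU' x) ?_
    simp [stdRow, Fin.ext_iff]
  · have h1 := stdRow_vecMul c₀ V
    simp only [c₀, Nat.cast_zero] at h1
    rw [h1]
    ext z
    refine Eq.trans (hV' z) ?_
    simp [stdRow, Fin.ext_iff]

end Pencil

/-! ### Palindromes and transfer to block matrices -/

theorem tupleEquiv_reverse {l : List ℤ} (h : l.Pairwise fun i j => 1 < |i - j|) :
    TupleEquiv l.reverse l := by
  induction l with
  | nil => exact Relation.ReflTransGen.refl
  | cons j l ih =>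
    rw [List.pairwise_cons] at h
    rw [List.reverse_cons]
    have h1 := tupleEquiv_move (L := l.reverse) (p := j) fun i hi => by
      rw [abs_sub_comm]; exact h.1 i (List.mem_reverse.1 hi)
    have h2 := (ih h.2).append [j] []
    simp only [List.append_nil, List.singleton_append] at h2
    exact h1.trans h2

theorem pairwise_offParity (ρ : ℕ) : (offParity ρ).Pairwise fun i j => 1 < |i - j| :=
  (nodup_offParity ρ).pairwise_of_forall_ne fun i hi j hj hij => by
    rw [mem_offParity] at hi hj; rw [lt_abs]; omega

theorem pairwise_onParity (ρ : ℕ) : (onParity ρ).Pairwise fun i j => 1 < |i - j| :=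
  (nodup_onParity ρ).pairwise_of_forall_ne fun i hi j hj hij => by
    rw [mem_onParity] at hi hj; rw [lt_abs]; omega

theorem TupleEquiv.symm {γ δ : List ℤ} (h : TupleEquiv γ δ) : TupleEquiv δ γ := by
  induction h with
  | refl => exact Relation.ReflTransGen.refl
  | tail _ hs ih =>
    obtain ⟨α, β, i, j, hij, rfl, rfl⟩ := hs
    exact ih.head ⟨α, β, j, i, by rwa [abs_sub_comm], rfl, rfl⟩

/-- Up to equivalence (w, c_w) consists of three groups, the first equal to the last, and each group
has pairwise distant entries, so it is equivalent to its own reversal. -/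
theorem tupleEquiv_palindrome {ρ : ℕ} {w : List ℤ}
    (hw : TupleEquiv w (offParity ρ ++ onParity ρ)) :
    TupleEquiv ((offParity ρ).reverse ++ w.reverse) (w ++ offParity ρ) := by
  have h1 := hw.reverse.append (offParity ρ).reverse []
  have h2 := hw.symm.append [] (offParity ρ)
  have h3 := (tupleEquiv_reverse (pairwise_offParity ρ)).append []
    ((onParity ρ).reverse ++ (offParity ρ).reverse)
  have h4 := (tupleEquiv_reverse (pairwise_onParity ρ)).append (offParity ρ) (offParity ρ).reverse
  have h5 := (tupleEquiv_reverse (pairwise_offParity ρ)).append (offParity ρ ++ onParity ρ) []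
  simp only [List.nil_append, List.append_nil, List.append_assoc, List.reverse_append]
    at h1 h2 h3 h4 h5 ⊢
  exact (((h1.trans h3).trans h4).trans h5).trans h2

section Transfer

variable {R : Type*} [CommRing R] {m n : ℕ}

/-- The matrix with the given blocks, whose block rows and columns are numbered from the last one
upwards. -/
def unblock (m n : ℕ) (R : Type*) [CommRing R] :
    Matrix (Fin m) (Fin m) (Matrix (Fin n) (Fin n) R) →+*
      Matrix (Fin m × Fin n) (Fin m × Fin n) R where
  toFun M := Matrix.of fun x y => M x.1.rev y.1.rev x.2 y.2
  map_one' := by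
    ext x y
    simp only [Matrix.of_apply, Matrix.one_apply, Prod.ext_iff, Fin.rev_inj]
    split_ifs <;> simp_all [Matrix.one_apply]
  map_zero' := by ext; simp
  map_add' M N := by ext; simp
  map_mul' M N := by
    ext x y
    simp only [Matrix.of_apply, Matrix.mul_apply, Fintype.sum_prod_type, Matrix.sum_apply]
    exact (Equiv.sum_comp Fin.revPerm
      (fun c => ∑ i, M x.1.rev c x.2 i * N c y.1.rev i y.2)).symm

theorem unblock_apply (M : Matrix (Fin m) (Fin m) (Matrix (Fin n) (Fin n) R))
    (x y : Fin m × Fin n) : unblock m n R M x y = M x.1.rev y.1.rev x.2 y.2 := rfl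

/-- The block column with the given blocks, numbered from the last one upwards. -/
def blockCol (v : Fin m → Matrix (Fin n) (Fin n) R) : Matrix (Fin m × Fin n) (Fin n) R :=
  Matrix.of fun x i => v x.1.rev x.2 i

/-- The block row with the given blocks, numbered from the last one upwards. -/
def blockRow (v : Fin m → Matrix (Fin n) (Fin n) R) : Matrix (Fin n) (Fin m × Fin n) R :=
  Matrix.of fun i x => v x.1.rev i x.2

theorem unblock_mul_blockCol (M : Matrix (Fin m) (Fin m) (Matrix (Fin n) (Fin n) R))
    (v : Fin m → Matrix (Fin n) (Fin n) R) :
    unblock m n R M * blockCol v = blockCol (M *ᵥ v) := by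
  ext x i
  simp only [blockCol, unblock_apply, Matrix.of_apply, Matrix.mul_apply, Fintype.sum_prod_type,
    Matrix.mulVec, dotProduct, Matrix.sum_apply]
  exact Equiv.sum_comp Fin.revPerm (fun c => ∑ j, M x.1.rev c x.2 j * v c j i)

theorem blockRow_mul_unblock (M : Matrix (Fin m) (Fin m) (Matrix (Fin n) (Fin n) R))
    (v : Fin m → Matrix (Fin n) (Fin n) R) :
    blockRow v * unblock m n R M = blockRow (v ᵥ* M) := by
  ext i x
  simp only [blockRow, unblock_apply, Matrix.of_apply, Matrix.mul_apply, Fintype.sum_prod_type,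
    Matrix.vecMul, dotProduct, Matrix.sum_apply]
  exact Equiv.sum_comp Fin.revPerm (fun c => ∑ j, v c i j * M c x.1.rev j x.2)

theorem unblock_elemBlock (i : ℤ) (P : Matrix (Fin n) (Fin n) R) :
    unblock m n R (elemBlock m i P) = elemMatrix m i P := by
  ext x y
  have hx := x.1.2
  have hy := y.1.2
  have h1 : ((x.1.rev : ℕ) : ℤ) = m - 1 - (x.1 : ℕ) := by rw [Fin.val_rev]; omega
  have h2 : ((y.1.rev : ℕ) : ℤ) = m - 1 - (y.1 : ℕ) := by rw [Fin.val_rev]; omega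
  simp only [unblock_apply, elemBlock, elemMatrix, Matrix.of_apply, h1, h2]
  split_ifs <;> first | rfl | omega

theorem unblock_elemProd_zip (p : List ℤ) (P : List (Matrix (Fin n) (Fin n) R)) :
    unblock m n R (elemProd m (List.zip p P)) = assignProd m p P := by
  induction p generalizing P with
  | nil => simp [assignProd, elemProd_nil]
  | cons i p ih =>
    cases P with
    | nil => simp [assignProd, elemProd_nil]
    | cons Q P =>
      rw [List.zip_cons_cons, elemProd_cons, map_mul, ih, unblock_elemBlock]
      simp [assignProd]

theorem unblock_elemProd_withBlocks (A : Matrix (Fin n) (Fin n) ℂ[X]) (p : List ℤ) :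
    unblock m n ℂ (elemProd m (withBlocks (signedBlock (matCoeff A)) p)) = fiedlerProd m A p := by
  rw [fiedlerProd, ← unblock_elemProd_zip]
  congr 2
  rw [trivialAssignment, withBlocks]
  induction p with
  | nil => rfl
  | cons i p ih => simp only [List.map_cons, List.zip_cons_cons, ih]; rfl

theorem blockTranspose_unblock (M : Matrix (Fin m) (Fin m) (Matrix (Fin n) (Fin n) R)) :
    blockTranspose (unblock m n R M) = unblock m n R Mᵀ := rfl

theorem elemMatrix_transpose (i : ℤ) {P : Matrix (Fin n) (Fin n) R} (hP : P.IsSymm) :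
    (unblock m n R (elemBlock m i P))ᵀ = unblock m n R (elemBlock m i P) := by
  ext x y
  rw [Matrix.transpose_apply, unblock_apply, unblock_apply]
  conv_lhs => rw [← elemBlock_transpose, Matrix.transpose_apply]
  have h1 : ∀ a b, ((elemBlock m i P) a b)ᵀ = elemBlock m i P a b := by
    intro a b
    simp only [elemBlock, Matrix.of_apply]
    split_ifs <;> simp [hP.eq]
  conv_rhs => rw [← h1]
  rfl

/-- With symmetric blocks every factor is a symmetric matrix, so the ordinary transpose reverses the
product without any SIP. -/
theorem transpose_unblock_elemProd {l : List (ℤ × Matrix (Fin n) (Fin n) R)}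
    (hl : ∀ t ∈ l, t.2.IsSymm) :
    (unblock m n R (elemProd m l))ᵀ = unblock m n R (elemProd m l.reverse) := by
  induction l with
  | nil => simp [elemProd_nil]
  | cons t l ih =>
    rw [List.reverse_cons, elemProd_append, elemProd_cons, elemProd_cons, elemProd_nil, mul_one,
      map_mul, map_mul, Matrix.transpose_mul, ih fun t ht => hl t (by simp [ht]),
      elemMatrix_transpose t.1 (hl t (by simp))]

end Transfer

theorem mapMatrix_elemProd {S S' : Type*} [Ring S] [Ring S'] {m : ℕ} (f : S →+* S')
    (l : List (ℤ × S)) :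
    f.mapMatrix (elemProd m l) = elemProd m (l.map fun t => (t.1, f t.2)) := by
  induction l with
  | nil => simp [elemProd_nil]
  | cons t l ih =>
    rw [List.map_cons, elemProd_cons, elemProd_cons, map_mul, ih]
    congr 1
    ext a b
    simp only [RingHom.mapMatrix_apply, Matrix.map_apply, elemBlock, Matrix.of_apply]
    split_ifs <;> simp

theorem signedBlock_map {S S' : Type*} [Ring S] [Ring S'] (f : S →+* S') (a : ℕ → S) (i : ℤ) :
    f (signedBlock a i) = signedBlock (fun j => f (a j)) i := by
  unfold signedBlock; split_ifs <;> simp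

/-- The entries 0 and 1 are central, so columns can be treated as rows of the transpose even over
noncommuting blocks. -/
theorem mulVec_stdRow {S : Type*} [Ring S] {m : ℕ} (M : Matrix (Fin m) (Fin m) S) (x : ℤ) :
    M *ᵥ stdRow m x = stdRow m x ᵥ* Mᵀ := by
  ext a
  simp only [Matrix.mulVec, Matrix.vecMul, dotProduct, Matrix.transpose_apply]
  exact Finset.sum_congr rfl fun b _ => stdRow_apply_commute x b _

theorem zip_map_fst {α β : Type*} {l : List α} {l' : List β} (h : l'.length = l.length) :
    (List.zip l l').map Prod.fst = l := List.map_fst_zip h.ge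

theorem zip_reverse {α β : Type*} {l : List α} {l' : List β} (h : l'.length = l.length) :
    List.zip l.reverse l'.reverse = (List.zip l l').reverse :=
  (List.reverse_zipWith h.symm).symm

theorem withBlocks_map_fst {S : Type*} [Ring S] (g : ℤ → S) (p : List ℤ) :
    (withBlocks g p).map Prod.fst = p := by
  simp [withBlocks, Function.comp_def]

theorem withBlocks_append {S : Type*} [Ring S] (g : ℤ → S) (p q : List ℤ) :
    withBlocks g (p ++ q) = withBlocks g p ++ withBlocks g q := List.map_append ..

theorem withBlocks_reverse {S : Type*} [Ring S] (g : ℤ → S) (p : List ℤ) :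
    withBlocks g p.reverse = (withBlocks g p).reverse := List.map_reverse ..

theorem zip_trivialAssignment {n : ℕ} (A : Matrix (Fin n) (Fin n) ℂ[X]) (p : List ℤ) :
    List.zip p (trivialAssignment A p) = withBlocks (signedBlock (matCoeff A)) p := by
  rw [trivialAssignment, withBlocks]
  induction p with
  | nil => rfl
  | cons i p ih => simp only [List.map_cons, List.zip_cons_cons, ih]; rfl

theorem mem_withBlocks {S : Type*} [Ring S] {g : ℤ → S} {p : List ℤ} {t : ℤ × S}
    (h : t ∈ withBlocks g p) : t.1 ∈ p ∧ t.2 = g t.1 := by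
  obtain ⟨i, hi, rfl⟩ := List.mem_map.1 h
  exact ⟨hi, rfl⟩

/-! ### Ranges, SIP and palindromes of the given tuples -/

namespace SimpleData

variable {m n : ℕ} (d : SimpleData m n)

theorem cast_sub : ((m - d.h - 1 : ℕ) : ℤ) = m - d.h - 1 := by have := d.h_lt; omega

theorem w_equiv : TupleEquiv d.w (offParity d.h ++ onParity d.h) := by
  obtain ⟨⟨h1, h2, h3, h4⟩, h5⟩ := d.simple_w
  exact h4.trans (admissibleForm_equiv h1 h2 h5)

theorem shift_v_equiv : TupleEquiv (shiftTuple d.v m)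
    (offParity (m - d.h - 1) ++ onParity (m - d.h - 1)) := by
  obtain ⟨⟨h1, h2, h3, h4⟩, h5⟩ := d.simple_v
  exact h4.trans (admissibleForm_equiv h1 h2 h5)

theorem v_equiv : TupleEquiv d.v
    (shiftTuple (offParity (m - d.h - 1) ++ onParity (m - d.h - 1)) (-(m : ℤ))) := by
  have := d.shift_v_equiv.shift (-(m : ℤ))
  rwa [shiftTuple_shiftTuple_neg] at this

theorem cw_eq : d.cw = offParity d.h := by
  obtain ⟨⟨h1, h2, h3, h4⟩, h5⟩ := d.simple_w
  exact symmComplement_eq h1 h2 h5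

theorem cv_eq : d.cv = shiftTuple (offParity (m - d.h - 1)) (-(m : ℤ)) := by
  obtain ⟨⟨h1, h2, h3, h4⟩, h5⟩ := d.simple_v
  rw [cv, symmComplement_eq h1 h2 h5]

theorem mem_w {i : ℤ} (hi : i ∈ d.w) : 0 ≤ i ∧ i ≤ d.h := by
  rwa [d.simple_w.1.2.2.1.mem_iff, mem_seg] at hi

theorem mem_v {i : ℤ} (hi : i ∈ d.v) : -(m : ℤ) ≤ i ∧ i ≤ -d.h - 1 := by
  have h1 : i + m ∈ shiftTuple d.v m := mem_shiftTuple.2 (by simpa using hi)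
  rw [d.simple_v.1.2.2.1.mem_iff, mem_seg, d.cast_sub] at h1
  omega

theorem mem_cw {i : ℤ} (hi : i ∈ d.cw) : 0 ≤ i ∧ i ≤ (d.h : ℤ) - 1 := by
  rw [d.cw_eq, mem_offParity] at hi; omega

theorem mem_cv {i : ℤ} (hi : i ∈ d.cv) : -(m : ℤ) ≤ i ∧ i ≤ -d.h - 2 := by
  rw [d.cv_eq, mem_shiftTuple, mem_offParity, d.cast_sub] at hi; omega

theorem mem_tw {i : ℤ} (hi : i ∈ d.tw) : 0 ≤ i ∧ i ≤ (d.h : ℤ) - 2 := d.canonical_tw.mem hi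

theorem mem_tv {i : ℤ} (hi : i ∈ d.tv) : -(m : ℤ) ≤ i ∧ i ≤ -d.h - 3 := by
  have h1 : i + m ∈ shiftTuple d.tv m := mem_shiftTuple.2 (by simpa using hi)
  have h2 := d.canonical_tv.mem h1
  rw [d.cast_sub] at h2
  omega

theorem isSIP_w : IsSIP (d.tw ++ d.w ++ d.cw ++ d.tw.reverse) := by
  rw [d.cw_eq]; exact isSIP_extended d.canonical_tw d.w_equiv

theorem isSIP_cw : IsSIP (d.tw ++ d.cw ++ d.tw.reverse) := by
  rw [d.cw_eq]; exact isSIP_complement d.canonical_tw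

theorem isSIP_v : IsSIP (d.tv ++ d.v ++ d.cv ++ d.tv.reverse) := by
  have := (isSIP_extended d.canonical_tv d.shift_v_equiv).shift (-(m : ℤ))
  simp only [shiftTuple_append, shiftTuple_reverse, shiftTuple_shiftTuple_neg] at this
  rwa [d.cv_eq]

theorem isSIP_cv : IsSIP (d.tv ++ d.cv ++ d.tv.reverse) := by
  have := (isSIP_complement d.canonical_tv).shift (-(m : ℤ))
  simp only [shiftTuple_append, shiftTuple_reverse, shiftTuple_shiftTuple_neg] at this
  rwa [d.cv_eq]

theorem palindrome_w : TupleEquiv (d.cw.reverse ++ d.w.reverse) (d.w ++ d.cw) := by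
  rw [d.cw_eq]; exact tupleEquiv_palindrome d.w_equiv

theorem palindrome_cw : TupleEquiv d.cw.reverse d.cw := by
  rw [d.cw_eq]; exact tupleEquiv_reverse (pairwise_offParity _)

theorem palindrome_v : TupleEquiv (d.cv.reverse ++ d.v.reverse) (d.v ++ d.cv) := by
  have := (tupleEquiv_palindrome d.shift_v_equiv).shift (-(m : ℤ))
  simp only [shiftTuple_append, shiftTuple_reverse, shiftTuple_shiftTuple_neg] at this
  rwa [d.cv_eq]

theorem palindrome_cv : TupleEquiv d.cv.reverse d.cv := by
  have := (tupleEquiv_reverse (pairwise_offParity (m - d.h - 1))).shift (-(m : ℤ))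
  rwa [shiftTuple_reverse, ← d.cv_eq] at this

theorem length_X : d.X.length = d.tw.length := d.nonsing_X.1

theorem length_Y : d.Y.length = d.tv.length := d.nonsing_Y.1

end SimpleData

namespace SimpleData

variable {m n : ℕ} (d : SimpleData m n)

/-! ### The coefficients of the pencil and their symmetry -/

/-- The indices and blocks given by a tuple and the coefficients of `A(λ)`. -/
def coeffs (A : Matrix (Fin n) (Fin n) ℂ[X]) (p : List ℤ) :
    List (ℤ × Matrix (Fin n) (Fin n) ℂ) := withBlocks (signedBlock (matCoeff A)) p

/-- The indices and blocks in `[-m, -h - 1]` of the leading coefficient. -/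
def leadNeg (A : Matrix (Fin n) (Fin n) ℂ[X]) : List (ℤ × Matrix (Fin n) (Fin n) ℂ) :=
  List.zip d.tv d.Y ++ coeffs A d.v ++ coeffs A d.cv ++ (List.zip d.tv d.Y).reverse

/-- The indices and blocks in `[0, h - 1]` of the leading coefficient. -/
def leadPos (A : Matrix (Fin n) (Fin n) ℂ[X]) : List (ℤ × Matrix (Fin n) (Fin n) ℂ) :=
  List.zip d.tw d.X ++ coeffs A d.cw ++ (List.zip d.tw d.X).reverse

/-- The indices and blocks in `[-m, -h - 2]` of the constant coefficient. -/
def constNeg (A : Matrix (Fin n) (Fin n) ℂ[X]) : List (ℤ × Matrix (Fin n) (Fin n) ℂ) :=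
  List.zip d.tv d.Y ++ coeffs A d.cv ++ (List.zip d.tv d.Y).reverse

/-- The indices and blocks in `[0, h]` of the constant coefficient. -/
def constPos (A : Matrix (Fin n) (Fin n) ℂ[X]) : List (ℤ × Matrix (Fin n) (Fin n) ℂ) :=
  List.zip d.tw d.X ++ coeffs A d.w ++ coeffs A d.cw ++ (List.zip d.tw d.X).reverse

variable (A : Matrix (Fin n) (Fin n) ℂ[X])

theorem mem_zip_X {t : ℤ × Matrix (Fin n) (Fin n) ℂ} (ht : t ∈ List.zip d.tw d.X) :
    0 ≤ t.1 ∧ t.1 ≤ (d.h : ℤ) - 2 := d.mem_tw (List.of_mem_zip ht).1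

theorem mem_zip_Y {t : ℤ × Matrix (Fin n) (Fin n) ℂ} (ht : t ∈ List.zip d.tv d.Y) :
    -(m : ℤ) ≤ t.1 ∧ t.1 ≤ -d.h - 3 := d.mem_tv (List.of_mem_zip ht).1

theorem mem_leadNeg {t : ℤ × Matrix (Fin n) (Fin n) ℂ} (ht : t ∈ d.leadNeg A) :
    -(m : ℤ) ≤ t.1 ∧ t.1 ≤ -d.h - 1 := by
  simp only [leadNeg, List.mem_append, List.mem_reverse] at ht
  rcases ht with ((ht | ht) | ht) | ht
  · have := d.mem_zip_Y ht; omega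
  · exact d.mem_v (mem_withBlocks ht).1
  · have := d.mem_cv (mem_withBlocks ht).1; omega
  · have := d.mem_zip_Y ht; omega

theorem mem_leadPos {t : ℤ × Matrix (Fin n) (Fin n) ℂ} (ht : t ∈ d.leadPos A) :
    0 ≤ t.1 ∧ t.1 ≤ (d.h : ℤ) - 1 := by
  simp only [leadPos, List.mem_append, List.mem_reverse] at ht
  rcases ht with (ht | ht) | ht
  · have := d.mem_zip_X ht; omega
  · exact d.mem_cw (mem_withBlocks ht).1
  · have := d.mem_zip_X ht; omega

theorem mem_constNeg {t : ℤ × Matrix (Fin n) (Fin n) ℂ} (ht : t ∈ d.constNeg A) :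
    -(m : ℤ) ≤ t.1 ∧ t.1 ≤ -d.h - 2 := by
  simp only [constNeg, List.mem_append, List.mem_reverse] at ht
  rcases ht with (ht | ht) | ht
  · have := d.mem_zip_Y ht; omega
  · exact d.mem_cv (mem_withBlocks ht).1
  · have := d.mem_zip_Y ht; omega

theorem mem_constPos {t : ℤ × Matrix (Fin n) (Fin n) ℂ} (ht : t ∈ d.constPos A) :
    0 ≤ t.1 ∧ t.1 ≤ (d.h : ℤ) := by
  simp only [constPos, List.mem_append, List.mem_reverse] at ht
  rcases ht with ((ht | ht) | ht) | ht
  · have := d.mem_zip_X ht; omega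
  · exact d.mem_w (mem_withBlocks ht).1
  · have := d.mem_cw (mem_withBlocks ht).1; omega
  · have := d.mem_zip_X ht; omega

theorem commute_lead : Commute (elemProd m (d.leadPos A)) (elemProd m (d.leadNeg A)) :=
  commute_elemProd_pos_neg (fun _ ht => d.mem_leadPos A ht)
    (fun _ ht => by have := d.mem_leadNeg A ht; omega)

theorem commute_const : Commute (elemProd m (d.constPos A)) (elemProd m (d.constNeg A)) :=
  commute_elemProd_pos_neg (fun _ ht => d.mem_constPos A ht)
    (fun _ ht => by have := d.mem_constNeg A ht; omega)

/-- Reversal turns (t, v, c, rev t) into (t, rev c, rev v, rev t), and the middle part is equivalent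
to (v, c). -/
theorem reverse_leadNeg : elemProd m (d.leadNeg A).reverse = elemProd m (d.leadNeg A) := by
  have h1 := d.palindrome_v.elemProd_neg (m := m) (signedBlock (matCoeff A)) fun i hi => by
    simp only [List.mem_append, List.mem_reverse] at hi
    rcases hi with hi | hi
    · have := d.mem_cv hi; omega
    · have := d.mem_v hi; omega
  simp only [withBlocks_append, withBlocks_reverse, elemProd_append] at h1
  simp only [leadNeg, coeffs, List.reverse_append, List.reverse_reverse, elemProd_append]
  rw [mul_assoc _ (elemProd m (withBlocks _ d.v)), ← h1]
  simp only [mul_assoc]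

theorem reverse_constPos : elemProd m (d.constPos A).reverse = elemProd m (d.constPos A) := by
  have hm := d.h_lt
  have h1 := d.palindrome_w.elemProd_pos (m := m) (signedBlock (matCoeff A)) fun i hi => by
    simp only [List.mem_append, List.mem_reverse] at hi
    rcases hi with hi | hi
    · have := d.mem_cw hi; omega
    · have := d.mem_w hi; omega
  simp only [withBlocks_append, withBlocks_reverse, elemProd_append] at h1
  simp only [constPos, coeffs, List.reverse_append, List.reverse_reverse, elemProd_append]
  rw [mul_assoc _ (elemProd m (withBlocks _ d.w)), ← h1]
  simp only [mul_assoc]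

theorem reverse_constNeg : elemProd m (d.constNeg A).reverse = elemProd m (d.constNeg A) := by
  have h1 := d.palindrome_cv.elemProd_neg (m := m) (signedBlock (matCoeff A)) fun i hi => by
    have := d.mem_cv (List.mem_reverse.1 hi); omega
  rw [withBlocks_reverse] at h1
  simp only [constNeg, coeffs, List.reverse_append, List.reverse_reverse, elemProd_append]
  rw [← h1, mul_assoc]

theorem reverse_leadPos : elemProd m (d.leadPos A).reverse = elemProd m (d.leadPos A) := by
  have hm := d.h_lt
  have h1 := d.palindrome_cw.elemProd_pos (m := m) (signedBlock (matCoeff A)) fun i hi => by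
    have := d.mem_cw (List.mem_reverse.1 hi); omega
  rw [withBlocks_reverse] at h1
  simp only [leadPos, coeffs, List.reverse_append, List.reverse_reverse, elemProd_append]
  rw [← h1, mul_assoc]

theorem transpose_leadNeg : (elemProd m (d.leadNeg A))ᵀ = elemProd m (d.leadNeg A) := by
  rw [transpose_elemProd_neg (fun t ht => by have := d.mem_leadNeg A ht; omega), d.reverse_leadNeg]
  simp only [leadNeg, coeffs, List.map_append, List.map_reverse, zip_map_fst d.length_Y,
    withBlocks_map_fst]
  exact d.isSIP_v

theorem transpose_constPos : (elemProd m (d.constPos A))ᵀ = elemProd m (d.constPos A) := by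
  have hm := d.h_lt
  rw [transpose_elemProd_pos (fun t ht => by have := d.mem_constPos A ht; omega),
    d.reverse_constPos]
  simp only [constPos, coeffs, List.map_append, List.map_reverse, zip_map_fst d.length_X,
    withBlocks_map_fst]
  exact d.isSIP_w

theorem transpose_constNeg : (elemProd m (d.constNeg A))ᵀ = elemProd m (d.constNeg A) := by
  rw [transpose_elemProd_neg (fun t ht => by have := d.mem_constNeg A ht; omega),
    d.reverse_constNeg]
  simp only [constNeg, coeffs, List.map_append, List.map_reverse, zip_map_fst d.length_Y,
    withBlocks_map_fst]
  exact d.isSIP_cv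

theorem transpose_leadPos : (elemProd m (d.leadPos A))ᵀ = elemProd m (d.leadPos A) := by
  have hm := d.h_lt
  rw [transpose_elemProd_pos (fun t ht => by have := d.mem_leadPos A ht; omega),
    d.reverse_leadPos]
  simp only [leadPos, coeffs, List.map_append, List.map_reverse, zip_map_fst d.length_X,
    withBlocks_map_fst]
  exact d.isSIP_cw

/-- The first product acts on the rows up to b, the second on the rows above b. In each term of the
matrix product one factor thus comes from a standard row: of the second matrix for c ≤ b, of the
first, which equals its transpose, for c > b. -/
theorem transpose_mul_pos_neg {S : Type*} [Ring S] {l l' : List (ℤ × S)} {b : ℤ}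
    (hl : ∀ t ∈ l, 0 ≤ t.1 ∧ t.1 ≤ b) (hb : b < m)
    (hl' : ∀ t ∈ l', -(m : ℤ) ≤ t.1 ∧ t.1 ≤ -b - 2)
    (h : (elemProd m l)ᵀ = elemProd m l) (h' : (elemProd m l')ᵀ = elemProd m l') :
    (elemProd m l * elemProd m l')ᵀ = elemProd m l * elemProd m l' := by
  rw [transpose_mul_of_commute, h, h', (commute_elemProd_pos_neg hl hl').eq]
  intro x y c
  by_cases hc : ((c : ℕ) : ℤ) ≤ b
  · have h1 := isLadder_neg.fix_row (m := m) (l := l') (x := -((c : ℕ) : ℤ) - 1)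
      (fun t ht => by have := hl' t ht; omega) (by omega)
      (fun t ht => by have := hl' t ht; omega)
    have h2 : -(-((c : ℕ) : ℤ) - 1) - 1 = ((c : ℕ) : ℤ) := by ring
    rw [h2, stdRow_vecMul] at h1
    rw [h1]
    exact stdRow_apply_commute _ _ _
  · have h1 := isLadder_pos.fix_row (m := m) (l := l) (x := ((c : ℕ) : ℤ))
      (fun t ht => by have := hl t ht; omega) (by omega)
      (fun t ht => by have := hl t ht; omega)
    rw [stdRow_vecMul] at h1
    rw [← h, Matrix.transpose_apply, h1]
    exact (stdRow_apply_commute _ _ _).symm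

theorem transpose_lead :
    (elemProd m (d.leadPos A) * elemProd m (d.leadNeg A))ᵀ =
      elemProd m (d.leadPos A) * elemProd m (d.leadNeg A) :=
  transpose_mul_pos_neg (fun _ ht => d.mem_leadPos A ht) (by have := d.h_lt; omega)
    (fun _ ht => by have := d.mem_leadNeg A ht; omega) (d.transpose_leadPos A)
    (d.transpose_leadNeg A)

theorem transpose_const :
    (elemProd m (d.constPos A) * elemProd m (d.constNeg A))ᵀ =
      elemProd m (d.constPos A) * elemProd m (d.constNeg A) :=
  transpose_mul_pos_neg (fun _ ht => d.mem_constPos A ht) (by have := d.h_lt; omega)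
    (fun _ ht => by have := d.mem_constNeg A ht; omega) (d.transpose_constPos A)
    (d.transpose_constNeg A)

/-! ### Separating nonnegative from negative indices -/

theorem mul_lead_eq :
    (elemProd m (List.zip d.tv d.Y) * elemProd m (List.zip d.tw d.X)) *
      elemProd m (coeffs A d.v) * ((elemProd m (coeffs A d.cw) * elemProd m (coeffs A d.cv)) *
      (elemProd m (List.zip d.tw d.X).reverse * elemProd m (List.zip d.tv d.Y).reverse)) =
    elemProd m (d.leadPos A) * elemProd m (d.leadNeg A) := by
  have key : ∀ p ∈ [List.zip d.tw d.X, coeffs A d.cw, (List.zip d.tw d.X).reverse],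
      ∀ q ∈ [List.zip d.tv d.Y, coeffs A d.v, coeffs A d.cv, (List.zip d.tv d.Y).reverse],
      Commute (elemProd m p) (elemProd m q) := by
    intro p hp q hq
    refine commute_elemProd_pos_neg (b := (d.h : ℤ) - 1)
      (fun t ht => d.mem_leadPos A ?_) (fun t ht => ?_)
    · simp only [leadPos, List.mem_append]
      simp only [List.mem_cons, List.not_mem_nil, or_false] at hp
      rcases hp with rfl | rfl | rfl <;> simp only [ht, true_or, or_true]
    · have : t ∈ d.leadNeg A := by
        simp only [leadNeg, List.mem_append]
        simp only [List.mem_cons, List.not_mem_nil, or_false] at hq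
        rcases hq with rfl | rfl | rfl | rfl <;> simp only [ht, true_or, or_true]
      have := d.mem_leadNeg A this
      omega
  simp only [List.forall_mem_cons, List.not_mem_nil, IsEmpty.forall_iff, implies_true,
    and_true] at key
  obtain ⟨⟨x1, x2, x3, x4⟩, ⟨c1, c2, c3, c4⟩, r1, r2, r3, r4⟩ := key
  simp only [leadPos, leadNeg, elemProd_append, mul_assoc, x1.symm.eq, c1.symm.left_comm,
    c2.symm.left_comm, r1.symm.left_comm, r2.symm.left_comm, r3.symm.left_comm]

/-- Here v is absent, so the negative indices are at most -h - 2 and commute with the index h of w.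
In the leading coefficient w is absent instead, which makes room for the index -h - 1 of v. -/
theorem mul_const_eq :
    (elemProd m (List.zip d.tv d.Y) * elemProd m (List.zip d.tw d.X)) *
      elemProd m (coeffs A d.w) * ((elemProd m (coeffs A d.cw) * elemProd m (coeffs A d.cv)) *
      (elemProd m (List.zip d.tw d.X).reverse * elemProd m (List.zip d.tv d.Y).reverse)) =
    elemProd m (d.constPos A) * elemProd m (d.constNeg A) := by
  have key : ∀ p ∈ [List.zip d.tw d.X, coeffs A d.w, coeffs A d.cw, (List.zip d.tw d.X).reverse],
      ∀ q ∈ [List.zip d.tv d.Y, coeffs A d.cv, (List.zip d.tv d.Y).reverse],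
      Commute (elemProd m p) (elemProd m q) := by
    intro p hp q hq
    refine commute_elemProd_pos_neg (b := (d.h : ℤ))
      (fun t ht => d.mem_constPos A ?_) (fun t ht => ?_)
    · simp only [constPos, List.mem_append]
      simp only [List.mem_cons, List.not_mem_nil, or_false] at hp
      rcases hp with rfl | rfl | rfl | rfl <;> simp only [ht, true_or, or_true]
    · have : t ∈ d.constNeg A := by
        simp only [constNeg, List.mem_append]
        simp only [List.mem_cons, List.not_mem_nil, or_false] at hq
        rcases hq with rfl | rfl | rfl <;> simp only [ht, true_or, or_true]
      exact d.mem_constNeg A this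
  simp only [List.forall_mem_cons, List.not_mem_nil, IsEmpty.forall_iff, implies_true,
    and_true] at key
  obtain ⟨⟨x1, x2, x3⟩, ⟨w1, w2, w3⟩, ⟨c1, c2, c3⟩, r1, r2, r3⟩ := key
  simp only [constPos, constNeg, elemProd_append, mul_assoc, x1.symm.eq, w1.symm.eq,
    c1.symm.left_comm, r1.symm.left_comm, r2.symm.left_comm]

theorem assign_left : assignProd m (d.tv ++ d.tw) (d.Y ++ d.X) =
    unblock m n ℂ (elemProd m (List.zip d.tv d.Y) * elemProd m (List.zip d.tw d.X)) := by
  rw [← unblock_elemProd_zip, List.zip_append d.length_Y.symm, elemProd_append]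

theorem assign_right : fiedlerProd m A (d.cw ++ d.cv) *
      assignProd m (d.tw.reverse ++ d.tv.reverse) (d.X.reverse ++ d.Y.reverse) =
    unblock m n ℂ ((elemProd m (coeffs A d.cw) * elemProd m (coeffs A d.cv)) *
      (elemProd m (List.zip d.tw d.X).reverse * elemProd m (List.zip d.tv d.Y).reverse)) := by
  rw [← unblock_elemProd_zip, List.zip_append (by simp [d.length_X]), zip_reverse d.length_X,
    zip_reverse d.length_Y, ← unblock_elemProd_withBlocks, withBlocks_append, elemProd_append,
    elemProd_append, ← map_mul]
  rfl

end SimpleData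

theorem constMat_mul {ι : Type*} [Fintype ι] (M N : Matrix ι ι ℂ) :
    constMat (M * N) = constMat M * constMat N := Matrix.map_mul (f := Polynomial.C)

theorem pencilProd_eq {ι : Type*} [Fintype ι] (P E F Q : Matrix ι ι ℂ) :
    pencilProd P E F Q = (Polynomial.X : ℂ[X]) • constMat (P * E * Q) - constMat (P * F * Q) := by
  rw [pencilProd, constMat_mul, constMat_mul, constMat_mul, constMat_mul, mul_sub, sub_mul,
    Matrix.mul_smul, Matrix.smul_mul]

namespace SimpleData

variable {m n : ℕ} (d : SimpleData m n) (A : Matrix (Fin n) (Fin n) ℂ[X])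

theorem pencil_eq : d.pencil A =
    (Polynomial.X : ℂ[X]) • constMat
      (unblock m n ℂ (elemProd m (d.leadPos A) * elemProd m (d.leadNeg A))) -
      constMat (unblock m n ℂ (elemProd m (d.constPos A) * elemProd m (d.constNeg A))) := by
  rw [pencil, pencilProd_eq, assign_left, assign_right, ← unblock_elemProd_withBlocks,
    ← unblock_elemProd_withBlocks, ← map_mul, ← map_mul, ← map_mul, ← map_mul,
    ← d.mul_lead_eq, ← d.mul_const_eq]
  rfl

theorem blockTranspose_pencil : blockTranspose (d.pencil A) = d.pencil A := by
  have h1 := congrArg (unblock m n ℂ) (d.transpose_lead A)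
  have h2 := congrArg (unblock m n ℂ) (d.transpose_const A)
  rw [← blockTranspose_unblock] at h1 h2
  rw [pencil_eq]
  conv_rhs => rw [← h1, ← h2]
  rfl

theorem transpose_unblock_lead (hA : A.IsSymm) (hd : d.HasSymmetricAssignments) :
    (unblock m n ℂ (elemProd m (d.leadPos A) * elemProd m (d.leadNeg A)))ᵀ =
      unblock m n ℂ (elemProd m (d.leadPos A) * elemProd m (d.leadNeg A)) ∧
    (unblock m n ℂ (elemProd m (d.constPos A) * elemProd m (d.constNeg A)))ᵀ =
      unblock m n ℂ (elemProd m (d.constPos A) * elemProd m (d.constNeg A)) := by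
  have hc : ∀ j, (matCoeff A j).IsSymm := fun j => by
    ext x y
    simp only [matCoeff, Matrix.transpose_apply, Matrix.map_apply]
    rw [hA.apply]
  have hs : ∀ p, ∀ t ∈ coeffs A p, t.2.IsSymm := fun p t ht => by
    rw [(mem_withBlocks ht).2, signedBlock]
    split_ifs
    · exact (hc _).neg
    · exact hc _
  have hX : ∀ t ∈ List.zip d.tw d.X, t.2.IsSymm := fun t ht => hd.1 _ (List.of_mem_zip ht).2
  have hY : ∀ t ∈ List.zip d.tv d.Y, t.2.IsSymm := fun t ht => hd.2 _ (List.of_mem_zip ht).2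
  constructor
  · rw [map_mul, Matrix.transpose_mul, transpose_unblock_elemProd, transpose_unblock_elemProd,
      d.reverse_leadPos, d.reverse_leadNeg, ← map_mul, ← map_mul, (d.commute_lead A).eq]
    all_goals
      intro t ht
      simp only [leadPos, leadNeg, List.mem_append, List.mem_reverse] at ht
      first
      | rcases ht with (ht | ht) | ht <;>
          first | exact hX t ht | exact hY t ht | exact hs _ t ht
      | rcases ht with ((ht | ht) | ht) | ht <;>
          first | exact hX t ht | exact hY t ht | exact hs _ t ht
  · rw [map_mul, Matrix.transpose_mul, transpose_unblock_elemProd, transpose_unblock_elemProd,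
      d.reverse_constPos, d.reverse_constNeg, ← map_mul, ← map_mul, (d.commute_const A).eq]
    all_goals
      intro t ht
      simp only [constPos, constNeg, List.mem_append, List.mem_reverse] at ht
      first
      | rcases ht with (ht | ht) | ht <;>
          first | exact hX t ht | exact hY t ht | exact hs _ t ht
      | rcases ht with ((ht | ht) | ht) | ht <;>
          first | exact hX t ht | exact hY t ht | exact hs _ t ht

theorem transpose_pencil (hA : A.IsSymm) (hd : d.HasSymmetricAssignments) :
    (d.pencil A)ᵀ = d.pencil A := by
  obtain ⟨h1, h2⟩ := d.transpose_unblock_lead A hA hd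
  rw [pencil_eq]
  conv_rhs => rw [← h1, ← h2]
  rfl

theorem natDegree_pencil (x y : Fin m × Fin n) : (d.pencil A x y).natDegree ≤ 1 := by
  rw [pencil_eq]
  refine (Polynomial.natDegree_sub_le _ _).trans (max_le ?_ ?_)
  · refine (Polynomial.natDegree_mul_le).trans ?_
    rw [Polynomial.natDegree_X]
    exact add_le_add le_rfl (Polynomial.natDegree_C _).le
  · exact (Polynomial.natDegree_C _).le.trans (by norm_num)

/-! ### The pencil as a generalized Fiedler pencil with repetition -/

/-- The tuples and matrix assignments which exhibit the pencil as a generalized Fiedler pencil with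
repetition. -/
def toGFPRData : GFPRData m n where
  h := d.h
  h_lt := d.h_lt
  σ := d.w
  τ := d.v
  σ₁ := d.tw
  σ₂ := d.cw ++ d.tw.reverse
  τ₁ := d.tv
  τ₂ := d.cv ++ d.tv.reverse
  perm_σ := d.simple_w.1.2.2.1
  perm_τ := by
    have h1 := d.simple_v.1.2.2.1.map fun i => i + -(m : ℤ)
    have h2 : shiftTuple (shiftTuple d.v m) (-m) = d.v := shiftTuple_shiftTuple_neg _ _
    have h3 := shiftTuple_seg 0 ((m - d.h - 1 : ℕ) : ℤ) (-(m : ℤ))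
    rw [d.cast_sub, zero_add, show (m : ℤ) - d.h - 1 + -m = -d.h - 1 by ring] at h3
    rw [d.cast_sub] at h1
    rw [← h3, ← h2]
    exact h1
  mem_σ₁ i hi := by have := d.mem_tw hi; omega
  mem_σ₂ i hi := by
    rcases List.mem_append.1 hi with hi | hi
    · exact d.mem_cw hi
    · have := d.mem_tw (List.mem_reverse.1 hi); omega
  mem_τ₁ i hi := by have := d.mem_tv hi; omega
  mem_τ₂ i hi := by
    rcases List.mem_append.1 hi with hi | hi
    · exact d.mem_cv hi
    · have := d.mem_tv (List.mem_reverse.1 hi); omega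
  sip_σ := by rw [← List.append_assoc]; exact d.isSIP_w.sip
  sip_τ := by rw [← List.append_assoc]; exact d.isSIP_v.sip
  X₁ := d.X
  X₂ := trivialAssignment A d.cw ++ d.X.reverse
  Y₁ := d.Y
  Y₂ := trivialAssignment A d.cv ++ d.Y.reverse
  asg_X₁ := d.length_X
  asg_X₂ := by simp [IsAssignment, trivialAssignment, d.length_X]
  asg_Y₁ := d.length_Y
  asg_Y₂ := by simp [IsAssignment, trivialAssignment, d.length_Y]

/-- The two pencils differ only in the order of the commuting factors for rev t_w and c_v. -/
theorem toGFPRData_pencil : (d.toGFPRData A).pencil A = d.pencil A := by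
  have h1 : assignProd m ((d.cw ++ d.tw.reverse) ++ (d.cv ++ d.tv.reverse))
      ((trivialAssignment A d.cw ++ d.X.reverse) ++ (trivialAssignment A d.cv ++ d.Y.reverse)) =
      fiedlerProd m A (d.cw ++ d.cv) *
        assignProd m (d.tw.reverse ++ d.tv.reverse) (d.X.reverse ++ d.Y.reverse) := by
    rw [assign_right, ← unblock_elemProd_zip,
      List.zip_append (by simp [trivialAssignment, d.length_X]),
      List.zip_append (by simp [trivialAssignment]), List.zip_append (by simp [trivialAssignment]),
      zip_reverse d.length_X, zip_reverse d.length_Y, zip_trivialAssignment, zip_trivialAssignment]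
    congr 1
    have h2 : Commute (elemProd m (List.zip d.tw d.X).reverse) (elemProd m (coeffs A d.cv)) :=
      commute_elemProd_pos_neg (b := d.h)
        (fun t ht => by have := d.mem_zip_X (List.mem_reverse.1 ht); omega)
        (fun t ht => d.mem_cv (mem_withBlocks ht).1)
    simp only [elemProd_append, mul_assoc]
    rw [← coeffs, ← coeffs, h2.left_comm]
  unfold GFPRData.pencil pencil
  rw [← h1]
  rfl

/-- Both climbs end by running through rev t_w, and they enter it at the same height. -/
theorem inversions_eq_consecutions (hd : Even d.h) :
    inversions 0 (d.tw ++ d.w) = consecutions 0 (d.w ++ d.cw ++ d.tw.reverse) := by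
  rw [inversions_zero, consecutions_zero, List.reverse_append, climb_append, climb_append,
    d.cw_eq, climb_admissible_complement hd d.w_equiv]

/-! ### Linearization -/

/-- For even h the number 1 has the other parity, so by the canonical form the window of t_w at 1
does not end in 1. -/
theorem lead_tw (hd : Even d.h) : Lead (if d.h = 0 then 0 else 1) d.tw.reverse := by
  by_cases h : d.h = 0
  · have h1 : d.tw = [] := List.eq_nil_iff_forall_not_mem.2 fun i hi => by
      have := d.mem_tw hi; omega
    rw [h1]; exact lead_nil _
  · rw [if_neg h, Lead, window_reverse, List.head?_reverse]
    have := Nat.even_iff.1 hd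
    exact d.canonical_tw.getLast_window (by omega)

theorem lead_cw_tw (hd : Even d.h) : Lead 0 (d.cw ++ d.tw.reverse) := by
  have he := Nat.even_iff.1 hd
  by_cases h : d.h = 0
  · have h1 : d.tw = [] := List.eq_nil_iff_forall_not_mem.2 fun i hi => by
      have := d.mem_tw hi; omega
    have h2 : d.cw = [] := List.eq_nil_iff_forall_not_mem.2 fun i hi => by
      have := d.mem_cw hi; omega
    rw [h1, h2]; exact lead_nil _
  · have h1 : window 0 d.cw = [1] := by
      rw [d.cw_eq]
      refine window_eq_singleton (nodup_offParity _) (Or.inr rfl) (by rw [mem_offParity]; omega) ?_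
      intro z hz; rw [mem_offParity] at hz; omega
    rw [Lead, window_append, h1]
    simp

theorem isSIP_cw_tw : IsSIP (d.cw ++ d.tw.reverse) := by
  have := d.isSIP_cw
  rw [List.append_assoc] at this
  exact this.of_append

theorem isSIP_tw_reverse : IsSIP d.tw.reverse := d.isSIP_cw_tw.of_append

theorem isSIP_tv_reverse : IsSIP d.tv.reverse := d.isSIP_cv.of_append

/-! ### Orbits of the special unit vectors -/

section Orbits

variable {S : Type*} [Ring S]

/-- The orbit of the first special unit vector under the left factor of the pencil. -/
theorem left_factor_mulVec (hd : Even d.h) {lX lY : List (ℤ × S)}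
    (hX : lX.map Prod.fst = d.tw) (hY : lY.map Prod.fst = d.tv) :
    (elemProd m lY * elemProd m lX) *ᵥ stdRow m (if d.h = 0 then 0 else 1) =
      stdRow m (inversions 0 (d.tw ++ d.w)) := by
  have hm := d.h_lt
  have he := Nat.even_iff.1 hd
  have mX : ∀ t ∈ lX, 0 ≤ t.1 ∧ t.1 ≤ (d.h : ℤ) - 2 := fun t ht =>
    d.mem_tw (hX ▸ List.mem_map_of_mem ht)
  have mY : ∀ t ∈ lY, -(m : ℤ) ≤ t.1 ∧ t.1 ≤ -d.h - 3 := fun t ht =>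
    d.mem_tv (hY ▸ List.mem_map_of_mem ht)
  have hXr : (lX.reverse).map Prod.fst = d.tw.reverse := by rw [List.map_reverse, hX]
  have hYr : (lY.reverse).map Prod.fst = d.tv.reverse := by rw [List.map_reverse, hY]
  have tX := transpose_elemProd_pos (m := m) (l := lX.reverse)
    (fun t ht => by have := mX t (List.mem_reverse.1 ht); omega)
    (by rw [hXr]; exact d.isSIP_tw_reverse)
  have tY := transpose_elemProd_neg (m := m) (l := lY.reverse)
    (fun t ht => by have := mY t (List.mem_reverse.1 ht); omega)
    (by rw [hYr]; exact d.isSIP_tv_reverse)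
  rw [List.reverse_reverse] at tX tY
  have hc : Commute (elemProd m lX) (elemProd m lY) :=
    commute_elemProd_pos_neg (b := (d.h : ℤ) - 2) mX
      (fun t ht => by have := mY t ht; omega)
  rw [← hc.eq, ← Matrix.mulVec_mulVec, ← tX, ← tY, mulVec_stdRow, Matrix.transpose_transpose]
  -- The indices of t_v are at most -h - 3 and move only rows from h + 2 upwards, so row 0 or 1
  -- stays.
  have h1 := isLadder_neg.fix_row (m := m) (l := lY.reverse)
    (x := -(if d.h = 0 then 0 else 1) - 1)
    (fun t ht => by have := mY t (List.mem_reverse.1 ht); omega) (by split_ifs <;> omega)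
    (fun t ht => by have := mY t (List.mem_reverse.1 ht); split_ifs <;> omega)
  have h2 : ∀ x : ℤ, -(-x - 1) - 1 = x := fun x => by ring
  rw [h2] at h1
  rw [h1, mulVec_stdRow, Matrix.transpose_transpose]
  have h3 := isLadder_pos.climb_row (m := m) (l := lX.reverse) (x := if d.h = 0 then 0 else 1)
    (fun t ht => by have := mX t (List.mem_reverse.1 ht); omega) (by split_ifs <;> omega)
    (by rw [hXr]; exact d.isSIP_tw_reverse) (by rw [hXr]; exact d.lead_tw hd)
  -- The starting row is numbered by i_0(w), so the climb through rev t_w ends at i_0(t_w, w).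
  rw [h3.1, hXr, inversions_zero, List.reverse_append, climb_append,
    climb_admissible_reverse hd d.w_equiv]

/-- The orbit of the second special unit vector under the right factor of the pencil. -/
theorem vecMul_right_factor (hd : Even d.h) {lX lY lC lC' : List (ℤ × S)}
    (hX : lX.map Prod.fst = d.tw.reverse) (hY : lY.map Prod.fst = d.tv.reverse)
    (hC : lC.map Prod.fst = d.cw) (hC' : lC'.map Prod.fst = d.cv) :
    stdRow m 0 ᵥ* ((elemProd m lC * elemProd m lC') * (elemProd m lX * elemProd m lY)) =
      stdRow m (consecutions 0 (d.w ++ d.cw ++ d.tw.reverse)) := by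
  have hm := d.h_lt
  have mX : ∀ t ∈ lX, 0 ≤ t.1 ∧ t.1 ≤ (d.h : ℤ) - 2 := fun t ht =>
    d.mem_tw (List.mem_reverse.1 (hX ▸ List.mem_map_of_mem ht))
  have mY : ∀ t ∈ lY, -(m : ℤ) ≤ t.1 ∧ t.1 ≤ -d.h - 3 := fun t ht =>
    d.mem_tv (List.mem_reverse.1 (hY ▸ List.mem_map_of_mem ht))
  have mC : ∀ t ∈ lC, 0 ≤ t.1 ∧ t.1 ≤ (d.h : ℤ) - 1 := fun t ht =>
    d.mem_cw (hC ▸ List.mem_map_of_mem ht)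
  have mC' : ∀ t ∈ lC', -(m : ℤ) ≤ t.1 ∧ t.1 ≤ -d.h - 2 := fun t ht =>
    d.mem_cv (hC' ▸ List.mem_map_of_mem ht)
  have mCX : ∀ t ∈ lC ++ lX, 0 ≤ t.1 ∧ t.1 ≤ (d.h : ℤ) - 1 := fun t ht => by
    rcases List.mem_append.1 ht with ht | ht
    · exact mC t ht
    · have := mX t ht; omega
  have mCY : ∀ t ∈ lC' ++ lY, -(m : ℤ) ≤ t.1 ∧ t.1 ≤ -d.h - 2 := fun t ht => by
    rcases List.mem_append.1 ht with ht | ht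
    · exact mC' t ht
    · have := mY t ht; omega
  have hc1 : Commute (elemProd m lX) (elemProd m lC') :=
    commute_elemProd_pos_neg (b := (d.h : ℤ)) (fun t ht => by have := mX t ht; omega) mC'
  have hc2 : Commute (elemProd m (lC ++ lX)) (elemProd m (lC' ++ lY)) :=
    commute_elemProd_pos_neg (b := (d.h : ℤ)) (fun t ht => by have := mCX t ht; omega) mCY
  have h1 : (elemProd m lC * elemProd m lC') * (elemProd m lX * elemProd m lY) =
      elemProd m (lC' ++ lY) * elemProd m (lC ++ lX) := by
    rw [← hc2.eq]
    simp only [elemProd_append, mul_assoc, hc1.symm.left_comm]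
  have h2 := isLadder_neg.fix_row (m := m) (l := lC' ++ lY) (x := -0 - 1)
    (fun t ht => by have := mCY t ht; omega) (by omega)
    (fun t ht => by have := mCY t ht; omega)
  have hCX : (lC ++ lX).map Prod.fst = d.cw ++ d.tw.reverse := by rw [List.map_append, hC, hX]
  have h3 := isLadder_pos.climb_row (m := m) (l := lC ++ lX) (x := 0)
    (fun t ht => by have := mCX t ht; omega) (by omega)
    (by rw [hCX]; exact d.isSIP_cw_tw) (by rw [hCX]; exact d.lead_cw_tw hd)
  have h4 : -(-0 - 1) - 1 = (0 : ℤ) := by ring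
  rw [h4] at h2
  -- Row 0 is the right start because c_0(w) = 0; the climb continues through c_w and rev t_w.
  rw [h1, ← Matrix.vecMul_vecMul, h2, h3.1, hCX, consecutions_zero, List.append_assoc,
    climb_append (-1) d.w, climb_admissible hd d.w_equiv]

end Orbits

end SimpleData

/-! ### Rosenbrock linearizations -/

/-- Constant blocks regarded as blocks of matrix polynomials. -/
noncomputable def constBlocks {n : ℕ} (l : List (ℤ × Matrix (Fin n) (Fin n) ℂ)) :
    List (ℤ × Matrix (Fin n) (Fin n) ℂ[X]) :=
  l.map fun t => (t.1, (Polynomial.C (R := ℂ)).mapMatrix t.2)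

theorem constBlocks_map_fst {n : ℕ} (l : List (ℤ × Matrix (Fin n) (Fin n) ℂ)) :
    (constBlocks l).map Prod.fst = l.map Prod.fst := by
  simp [constBlocks, Function.comp_def]

theorem constMat_unblock_elemProd {m n : ℕ} (l : List (ℤ × Matrix (Fin n) (Fin n) ℂ)) :
    constMat (unblock m n ℂ (elemProd m l)) = unblock m n ℂ[X] (elemProd m (constBlocks l)) := by
  rw [constBlocks, ← mapMatrix_elemProd]
  rfl

theorem constBlocks_coeffs {n : ℕ} (A : Matrix (Fin n) (Fin n) ℂ[X]) (p : List ℤ) :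
    constBlocks (SimpleData.coeffs A p) = withBlocks
      (signedBlock fun j => (Polynomial.C (R := ℂ)).mapMatrix (matCoeff A j)) p := by
  simp only [constBlocks, SimpleData.coeffs, withBlocks, List.map_map, Function.comp_def,
    signedBlock_map]

theorem isUnit_elemProd_constBlocks {m n : ℕ} {l : List (ℤ × Matrix (Fin n) (Fin n) ℂ)}
    (hl : ∀ t ∈ l, -(m : ℤ) ≤ t.1 ∧ t.1 < m)
    (hp : ∀ t ∈ l, t.1 = 0 ∨ t.1 = -(m : ℤ) → IsUnit t.2.det) :
    IsUnit (elemProd m (constBlocks l)) := by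
  refine isUnit_elemProd (fun t ht => ?_) (fun t ht h => ?_)
  · obtain ⟨s, hs, rfl⟩ := List.mem_map.1 ht
    exact hl s hs
  · obtain ⟨s, hs, rfl⟩ := List.mem_map.1 ht
    exact ((Matrix.isUnit_iff_isUnit_det _).2 (hp s hs h)).map (Polynomial.C (R := ℂ)).mapMatrix

theorem sum_scalar_pow_mul_matCoeff {m n : ℕ} {A : Matrix (Fin n) (Fin n) ℂ[X]}
    (hA : ∀ j, m < j → matCoeff A j = 0) :
    ∑ i ∈ Finset.range (m + 1), Matrix.scalar (Fin n) (Polynomial.X : ℂ[X]) ^ i *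
      (Polynomial.C (R := ℂ)).mapMatrix (matCoeff A i) = A := by
  refine Matrix.ext fun x y => ?_
  rw [Matrix.sum_apply]
  have h1 : ∀ i, (Matrix.scalar (Fin n) (Polynomial.X : ℂ[X]) ^ i *
      (Polynomial.C (R := ℂ)).mapMatrix (matCoeff A i)) x y =
      Polynomial.C ((A x y).coeff i) * Polynomial.X ^ i := fun i => by
    rw [← map_pow, Matrix.scalar_apply, Matrix.diagonal_mul, mul_comm]
    rfl
  rw [Finset.sum_congr rfl fun i _ => h1 i]
  have h2 : (A x y).natDegree < m + 1 := by
    refine Nat.lt_succ_of_le (Polynomial.natDegree_le_iff_coeff_eq_zero.2 fun j hj => ?_)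
    exact congrFun (congrFun (hA j hj) x) y
  exact ((A x y).as_sum_range_C_mul_X_pow' h2).symm

theorem smul_unblock {m n : ℕ}
    (M : Matrix (Fin m) (Fin m) (Matrix (Fin n) (Fin n) ℂ[X])) :
    (Polynomial.X : ℂ[X]) • unblock m n ℂ[X] M =
      unblock m n ℂ[X] (Matrix.scalar (Fin n) (Polynomial.X : ℂ[X]) • M) := by
  refine Matrix.ext fun x y => ?_
  simp only [Matrix.smul_apply, unblock_apply, smul_eq_mul, Matrix.scalar_apply,
    Matrix.diagonal_mul]

theorem cancel_units {R : Type*} [Monoid R] (P Q : Rˣ) (U V E : R) :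
    U * P⁻¹.val * (P * E * Q) * (Q⁻¹.val * V) = U * E * V := by
  simp only [mul_assoc, Units.inv_mul_cancel_left, Units.mul_inv_cancel_left]

namespace SimpleData

variable {m n : ℕ} (d : SimpleData m n) (A : Matrix (Fin n) (Fin n) ℂ[X])

theorem zero_notMem_cw (hd : Even d.h) : (0 : ℤ) ∉ d.cw := by
  have := Nat.even_iff.1 hd
  rw [d.cw_eq, mem_offParity]; omega

/-- The number 0 lies in c_v + m only if m - h - 1 is odd. So the block A_m occurs in the
complement, and must be nonsingular, only for even m. -/
theorem even_of_neg_mem_cv (hd : Even d.h) (h : -(m : ℤ) ∈ d.cv) : Even m := by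
  have := Nat.even_iff.1 hd
  rw [d.cv_eq, mem_shiftTuple, mem_offParity, d.cast_sub] at h
  rw [Nat.even_iff]; omega

/-- The pencil is unimodularly equivalent to `diag(I, A(λ))` with `A(λ)` in any prescribed block
place, with control over one block column and one block row of the transforming matrices. -/
theorem exists_reduction (hd : Even d.h) (hA : ∀ j, m < j → matCoeff A j = 0)
    (hm : Even m → IsUnit (matCoeff A m).det) (t : Fin m) :
    ∃ U V : Matrix (Fin m × Fin n) (Fin m × Fin n) ℂ[X], IsUnit U ∧ IsUnit V ∧
      U * d.pencil A * V =
        unblock m n ℂ[X] (Matrix.diagonal fun x => if x = t then A else 1) ∧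
      U * (blockCol (stdRow m (inversions 0 (d.tw ++ d.w))) :
        Matrix (Fin m × Fin n) (Fin n) ℂ[X]) = blockCol (stdRow m (t : ℕ)) ∧
      (blockRow (stdRow m (consecutions 0 (d.w ++ d.cw ++ d.tw.reverse))) :
        Matrix (Fin n) (Fin m × Fin n) ℂ[X]) * V = blockRow (stdRow m (t : ℕ)) := by
  have hlt := d.h_lt
  set a : ℕ → Matrix (Fin n) (Fin n) ℂ[X] :=
    fun j => (Polynomial.C (R := ℂ)).mapMatrix (matCoeff A j) with ha
  -- The indeterminate becomes a central element of the ring of polynomial blocks, where the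
  -- elimination takes place.
  set lam : Matrix (Fin n) (Fin n) ℂ[X] := Matrix.scalar (Fin n) (Polynomial.X : ℂ[X]) with hlam
  obtain ⟨U₀, V₀, hU₀, hV₀, hUV, hU₀t, hV₀t⟩ := exists_pencil_reduction (m := m) (h := d.h) lam
    (fun s => Matrix.scalar_commute _ (fun r => Commute.all _ r) s) (a := a)
    (fun j hj => by simp [ha, hA j hj]) hd hlt t
  rw [← d.v_equiv.elemProd_neg _ fun i hi => by have := d.mem_v hi; omega,
    ← d.w_equiv.elemProd_pos _ fun i hi => by have := d.mem_w hi; omega,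
    sum_scalar_pow_mul_matCoeff hA] at hUV
  have hnX : ∀ t ∈ List.zip d.tw d.X, t.1 = 0 ∨ t.1 = -(m : ℤ) → IsUnit t.2.det := d.nonsing_X.2
  have hnY : ∀ t ∈ List.zip d.tv d.Y, t.1 = 0 ∨ t.1 = -(m : ℤ) → IsUnit t.2.det := d.nonsing_Y.2
  have uX : IsUnit (elemProd m (constBlocks (List.zip d.tw d.X))) :=
    isUnit_elemProd_constBlocks (fun t ht => by have := d.mem_zip_X ht; omega) hnX
  have uY : IsUnit (elemProd m (constBlocks (List.zip d.tv d.Y))) :=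
    isUnit_elemProd_constBlocks (fun t ht => by have := d.mem_zip_Y ht; omega) hnY
  have uX' : IsUnit (elemProd m (constBlocks (List.zip d.tw d.X).reverse)) :=
    isUnit_elemProd_constBlocks
      (fun t ht => by have := d.mem_zip_X (List.mem_reverse.1 ht); omega)
      (fun t ht => hnX t (List.mem_reverse.1 ht))
  have uY' : IsUnit (elemProd m (constBlocks (List.zip d.tv d.Y).reverse)) :=
    isUnit_elemProd_constBlocks
      (fun t ht => by have := d.mem_zip_Y (List.mem_reverse.1 ht); omega)
      (fun t ht => hnY t (List.mem_reverse.1 ht))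
  have uC : IsUnit (elemProd m (constBlocks (coeffs A d.cw))) :=
    isUnit_elemProd_constBlocks
      (fun t ht => by have := d.mem_cw (mem_withBlocks ht).1; omega)
      (fun t ht h => by
        have h1 := (mem_withBlocks ht).1
        rcases h with h | h
        · exact absurd (h ▸ h1) (d.zero_notMem_cw hd)
        · have := d.mem_cw h1; omega)
  have uC' : IsUnit (elemProd m (constBlocks (coeffs A d.cv))) :=
    isUnit_elemProd_constBlocks
      (fun t ht => by have := d.mem_cv (mem_withBlocks ht).1; omega)
      (fun t ht h => by
        obtain ⟨h1, h2⟩ := mem_withBlocks ht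
        rcases h with h | h
        · have := d.mem_cv h1; omega
        · have h3 := hm (d.even_of_neg_mem_cv hd (h ▸ h1))
          rw [h2, h, signedBlock, if_neg (by omega)]
          simpa using h3)
  -- The outer factors are units P and Q, so the inverses of P and Q are absorbed into the
  -- transformations of the inner pencil.
  obtain ⟨P, hP⟩ := uY.mul uX
  obtain ⟨Q, hQ⟩ := (uC.mul uC').mul (uX'.mul uY')
  have hpen : d.pencil A = unblock m n ℂ[X]
      ((P : Matrix (Fin m) (Fin m) (Matrix (Fin n) (Fin n) ℂ[X])) *
        (lam • elemProd m (withBlocks (signedBlock a) d.v) -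
          elemProd m (withBlocks (signedBlock a) d.w)) * Q) := by
    rw [pencil, pencilProd, assign_left, assign_right, ← unblock_elemProd_withBlocks,
      ← unblock_elemProd_withBlocks, hP, hQ]
    simp only [map_mul, map_sub, constMat_mul, constMat_unblock_elemProd]
    rw [smul_unblock, ← coeffs, ← coeffs, constBlocks_coeffs, constBlocks_coeffs]
  refine ⟨unblock m n ℂ[X] (U₀ * P⁻¹.val), unblock m n ℂ[X] (Q⁻¹.val * V₀),
    (hU₀.mul P⁻¹.isUnit).map _, (Q⁻¹.isUnit.mul hV₀).map _, ?_, ?_, ?_⟩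
  · rw [hpen, ← map_mul, ← map_mul, cancel_units, hUV]
  · have h1 := d.left_factor_mulVec hd (lX := constBlocks (List.zip d.tw d.X))
      (lY := constBlocks (List.zip d.tv d.Y))
      (by rw [constBlocks_map_fst, zip_map_fst d.length_X])
      (by rw [constBlocks_map_fst, zip_map_fst d.length_Y])
    rw [← hP] at h1
    rw [unblock_mul_blockCol, ← h1, Matrix.mulVec_mulVec, mul_assoc, Units.inv_mul, mul_one, hU₀t]
  · have h1 := d.vecMul_right_factor hd (lX := constBlocks (List.zip d.tw d.X).reverse)
      (lY := constBlocks (List.zip d.tv d.Y).reverse) (lC := constBlocks (coeffs A d.cw))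
      (lC' := constBlocks (coeffs A d.cv))
      (by rw [constBlocks_map_fst, List.map_reverse, zip_map_fst d.length_X])
      (by rw [constBlocks_map_fst, List.map_reverse, zip_map_fst d.length_Y])
      (by rw [constBlocks_map_fst, coeffs, withBlocks_map_fst])
      (by rw [constBlocks_map_fst, coeffs, withBlocks_map_fst])
    rw [← hQ] at h1
    rw [blockRow_mul_unblock, ← h1, Matrix.vecMul_vecMul, ← mul_assoc, Units.mul_inv, one_mul,
      hV₀t]

end SimpleData

/-- The vector e_{m-c}, numbered from one from the top, is place c from the bottom. The coupling
block factors into a block column, B and a block row, on which the left and right transformations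
act separately. -/
theorem constMat_kronecker {m n k r : ℕ} (c c' : ℤ) (B : Matrix (Fin n) (Fin r) ℂ) :
    constMat (Matrix.kroneckerMap (fun x y => x * y)
      (Matrix.vecMulVec (stdVec m ((m : ℤ) - c)) (stdVec k ((k : ℤ) - c'))) B) =
    (blockCol (stdRow m c) : Matrix (Fin m × Fin n) (Fin n) ℂ[X]) * constMat B *
      (blockRow (stdRow k c') : Matrix (Fin r) (Fin k × Fin r) ℂ[X]) := by
  refine Matrix.ext fun x y => ?_
  have h1 : (stdRow m c : Fin m → Matrix (Fin n) (Fin n) ℂ[X]) x.1.rev =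
      Matrix.scalar (Fin n) (Polynomial.C (stdVec m ((m : ℤ) - c) x.1)) := by
    have := x.1.2
    simp only [stdRow, stdVec, Fin.val_rev]
    split_ifs <;> first | omega | simp
  have h2 : (stdRow k c' : Fin k → Matrix (Fin r) (Fin r) ℂ[X]) y.1.rev =
      Matrix.scalar (Fin r) (Polynomial.C (stdVec k ((k : ℤ) - c') y.1)) := by
    have := y.1.2
    simp only [stdRow, stdVec, Fin.val_rev]
    split_ifs <;> first | omega | simp
  have h3 : ((blockCol (stdRow m c) : Matrix (Fin m × Fin n) (Fin n) ℂ[X]) * constMat B *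
      (blockRow (stdRow k c') : Matrix (Fin r) (Fin k × Fin r) ℂ[X])) x y =
      ((stdRow m c : Fin m → Matrix (Fin n) (Fin n) ℂ[X]) x.1.rev * constMat B *
        (stdRow k c' : Fin k → Matrix (Fin r) (Fin r) ℂ[X]) y.1.rev) x.2 y.2 := rfl
  rw [h3, h1, h2, Matrix.scalar_apply, Matrix.scalar_apply, Matrix.mul_diagonal,
    Matrix.diagonal_mul]
  simp only [constMat, Matrix.map_apply, Matrix.kroneckerMap_apply, Matrix.vecMulVec_apply,
    map_mul]
  ring

/-! ### Assembly of the system pencil -/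

section Main

variable {m n k r : ℕ} (A : Matrix (Fin n) (Fin n) ℂ[X]) (B : Matrix (Fin n) (Fin r) ℂ)
  (C : Matrix (Fin r) (Fin n) ℂ) (D : Matrix (Fin r) (Fin r) ℂ[X])
  (a : SimpleData m n) (d : SimpleData k r)

theorem paddedSystem_inl_inl (h : 0 < m) (x y : Fin m × Fin n) :
    unblock m n ℂ[X] (Matrix.diagonal fun z => if z = ⟨0, h⟩ then A else 1) x y =
      paddedSystem m k (systemMatrix A B C D) (Sum.inl x) (Sum.inl y) := by
  obtain ⟨x, i⟩ := x
  obtain ⟨y, j⟩ := y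
  have hx := x.2
  have hy := y.2
  simp only [unblock_apply, paddedSystem, Matrix.of_apply, middleIndex, Matrix.diagonal_apply,
    Fin.ext_iff, Fin.val_rev, Sum.inl.injEq, Prod.mk.injEq]
  by_cases h1 : (x : ℕ) + 1 = m <;> by_cases h2 : (y : ℕ) + 1 = m
  · rw [if_pos (by omega), if_pos (by omega), if_pos h1, if_pos h2]; rfl
  · rw [if_neg (by omega), if_pos h1, if_neg h2, if_neg (by omega)]; rfl
  · rw [if_neg (by omega), if_neg h1, if_pos h2, if_neg (by omega)]; rfl
  · rw [if_neg h1, if_neg h2]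
    by_cases h3 : (x : ℕ) = y
    · rw [if_pos (by omega), if_neg (by omega), Matrix.one_apply]; simp [h3, Fin.ext_iff]
    · rw [if_neg (by omega), if_neg (by omega)]; rfl

theorem paddedSystem_inr_inr (h : k - 1 < k) (x y : Fin k × Fin r) :
    unblock k r ℂ[X] (Matrix.diagonal fun z => if z = ⟨k - 1, h⟩ then D else 1) x y =
      paddedSystem m k (systemMatrix A B C D) (Sum.inr x) (Sum.inr y) := by
  obtain ⟨x, i⟩ := x
  obtain ⟨y, j⟩ := y
  have hx := x.2
  have hy := y.2
  simp only [unblock_apply, paddedSystem, Matrix.of_apply, middleIndex, Matrix.diagonal_apply,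
    Fin.ext_iff, Fin.val_rev, Sum.inr.injEq, Prod.mk.injEq]
  by_cases h1 : (x : ℕ) = 0 <;> by_cases h2 : (y : ℕ) = 0
  · rw [if_pos (by omega), if_pos (by omega), if_pos h1, if_pos h2]; rfl
  · rw [if_neg (by omega), if_pos h1, if_neg h2, if_neg (by omega)]; rfl
  · rw [if_neg (by omega), if_neg h1, if_pos h2, if_neg (by omega)]; rfl
  · rw [if_neg h1, if_neg h2]
    by_cases h3 : (x : ℕ) = y
    · rw [if_pos (by omega), if_neg (by omega), Matrix.one_apply]; simp [h3, Fin.ext_iff]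
    · rw [if_neg (by omega), if_neg (by omega)]; rfl

theorem paddedSystem_inl_inr (h : k - 1 < k) (x : Fin m × Fin n) (y : Fin k × Fin r) :
    constMat (Matrix.kroneckerMap (fun x y => x * y) (Matrix.vecMulVec
        (stdVec m ((m : ℤ) - (0 : ℕ))) (stdVec k ((k : ℤ) - (k - 1 : ℕ)))) B) x y =
      paddedSystem m k (systemMatrix A B C D) (Sum.inl x) (Sum.inr y) := by
  obtain ⟨x, i⟩ := x
  obtain ⟨y, j⟩ := y
  simp only [constMat, Matrix.map_apply, Matrix.kroneckerMap_apply, Matrix.vecMulVec_apply, stdVec,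
    paddedSystem, Matrix.of_apply, middleIndex]
  by_cases h1 : (x : ℕ) + 1 = m <;> by_cases h2 : (y : ℕ) = 0
  · rw [if_pos (by omega), if_pos (by omega), if_pos h1, if_pos h2, one_mul, one_mul]; rfl
  · rw [if_neg (c := ((y : ℕ) : ℤ) + 1 = _) (by omega), if_pos h1, if_neg h2]; simp
  · rw [if_neg (c := ((x : ℕ) : ℤ) + 1 = _) (by omega), if_neg h1, if_pos h2]; simp
  · rw [if_neg (c := ((x : ℕ) : ℤ) + 1 = _) (by omega), if_neg h1, if_neg h2]; simp

theorem paddedSystem_inr_inl (h : k - 1 < k) (x : Fin k × Fin r) (y : Fin m × Fin n) :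
    constMat (Matrix.kroneckerMap (fun x y => x * y) (Matrix.vecMulVec
        (stdVec k ((k : ℤ) - (k - 1 : ℕ))) (stdVec m ((m : ℤ) - (0 : ℕ)))) C) x y =
      paddedSystem m k (systemMatrix A B C D) (Sum.inr x) (Sum.inl y) := by
  obtain ⟨x, i⟩ := x
  obtain ⟨y, j⟩ := y
  simp only [constMat, Matrix.map_apply, Matrix.kroneckerMap_apply, Matrix.vecMulVec_apply, stdVec,
    paddedSystem, Matrix.of_apply, middleIndex]
  by_cases h1 : (x : ℕ) = 0 <;> by_cases h2 : (y : ℕ) + 1 = m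
  · rw [if_pos (by omega), if_pos (by omega), if_pos h1, if_pos h2, one_mul, one_mul]; rfl
  · rw [if_neg (c := ((y : ℕ) : ℤ) + 1 = _) (by omega), if_pos h1, if_neg h2]; simp
  · rw [if_neg (c := ((x : ℕ) : ℤ) + 1 = _) (by omega), if_neg h1, if_pos h2]; simp
  · rw [if_neg (c := ((x : ℕ) : ℤ) + 1 = _) (by omega), if_neg h1, if_neg h2]; simp

theorem isGFPR_simplePencil : IsGFPR (simplePencil A B C D a d) A B C D := by
  refine ⟨a.toGFPRData A, d.toGFPRData D, ?_⟩
  rw [gfpr, a.toGFPRData_pencil, d.toGFPRData_pencil]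
  simp only [SimpleData.toGFPRData, ← List.append_assoc]
  rfl

theorem isBlockSymmetric_simplePencil (ha : Even a.h) (hd : Even d.h) :
    (simplePencil A B C D a d).IsBlockSymmetric := by
  simp only [BlockSystem.IsBlockSymmetric, BlockSystem.rosenbrockTranspose, simplePencil,
    a.blockTranspose_pencil, d.blockTranspose_pencil, a.inversions_eq_consecutions ha,
    d.inversions_eq_consecutions hd]

theorem isSymm_simplePencil (ha : Even a.h) (hd : Even d.h) (hA : A.IsSymm) (hD : D.IsSymm)
    (hC : C = Bᵀ) (ha' : a.HasSymmetricAssignments) (hd' : d.HasSymmetricAssignments) :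
    (simplePencil A B C D a d).toMatrix.IsSymm := by
  subst hC
  have h : ∀ (u : Fin m → ℂ) (v : Fin k → ℂ),
      (constMat (Matrix.kroneckerMap (fun x y => x * y) (Matrix.vecMulVec u v) B))ᵀ =
        constMat (Matrix.kroneckerMap (fun x y => x * y) (Matrix.vecMulVec v u) Bᵀ) := by
    intro u v
    refine Matrix.ext fun x y => ?_
    simp [constMat, Matrix.vecMulVec_apply, mul_comm]
  rw [Matrix.IsSymm, BlockSystem.toMatrix, Matrix.fromBlocks_transpose]
  simp only [simplePencil, a.transpose_pencil A hA ha', d.transpose_pencil D hD hd',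
    a.inversions_eq_consecutions ha, d.inversions_eq_consecutions hd]
  rw [h, ← h, Matrix.transpose_transpose, h]

theorem isRosenbrockLinearization_simplePencil (hA : HasMatDegree A m) (hD : HasMatDegree D k)
    (ha : Even a.h) (hd : Even d.h) (hm : Even m → IsUnit (matCoeff A m).det)
    (hk : Even k → IsUnit (matCoeff D k).det) :
    IsRosenbrockLinearization (simplePencil A B C D a d).toMatrix (systemMatrix A B C D) := by
  have hm0 := a.h_lt
  have hk0 := d.h_lt
  -- Places are counted from the bottom: A(λ) is put into the last block place of its part and D(λ)
  -- into the first of its own, so that they meet in the middle.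
  obtain ⟨UA, VA, hUA, hVA, hA1, hA2, hA3⟩ := a.exists_reduction A ha hA.2 hm ⟨0, by omega⟩
  obtain ⟨UD, VD, hUD, hVD, hD1, hD2, hD3⟩ := d.exists_reduction D hd hD.2 hk ⟨k - 1, by omega⟩
  refine ⟨?_, UA, VA, UD, VD, hUA, hVA, hUD, hVD, ?_⟩
  · rintro (x | x) (y | y)
    · exact a.natDegree_pencil A x y
    · exact (Polynomial.natDegree_C _).le.trans (by norm_num)
    · exact (Polynomial.natDegree_C _).le.trans (by norm_num)
    · exact d.natDegree_pencil D x y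
  · have hB : UA * (constMat (Matrix.kroneckerMap (fun x y => x * y) (Matrix.vecMulVec
        (simplePencil A B C D a d).u (simplePencil A B C D a d).v) B)) * VD =
        constMat (Matrix.kroneckerMap (fun x y => x * y) (Matrix.vecMulVec
          (stdVec m ((m : ℤ) - (0 : ℕ))) (stdVec k ((k : ℤ) - (k - 1 : ℕ)))) B) := by
      simp only [simplePencil, constMat_kronecker]
      refine Eq.trans ?_ (congrArg₂ (fun M N => M * constMat B * N) hA2 hD3)
      simp only [Matrix.mul_assoc]
    have hC : UD * (constMat (Matrix.kroneckerMap (fun x y => x * y) (Matrix.vecMulVec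
        (simplePencil A B C D a d).s (simplePencil A B C D a d).z) C)) * VA =
        constMat (Matrix.kroneckerMap (fun x y => x * y) (Matrix.vecMulVec
          (stdVec k ((k : ℤ) - (k - 1 : ℕ))) (stdVec m ((m : ℤ) - (0 : ℕ)))) C) := by
      simp only [simplePencil, constMat_kronecker]
      refine Eq.trans ?_ (congrArg₂ (fun M N => M * constMat C * N) hD2 hA3)
      simp only [Matrix.mul_assoc]
    rw [BlockSystem.toMatrix, Matrix.fromBlocks_multiply, Matrix.fromBlocks_multiply]
    simp only [Matrix.zero_mul, Matrix.mul_zero, add_zero, zero_add]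
    have e1 : (simplePencil A B C D a d).blkA = a.pencil A := rfl
    have e2 : (simplePencil A B C D a d).blkD = d.pencil D := rfl
    have e3 : (simplePencil A B C D a d).B = B := rfl
    have e4 : (simplePencil A B C D a d).C = C := rfl
    rw [e1, e2, e3, e4, hA1, hD1, hB, hC]
    refine Matrix.ext fun x y => ?_
    rcases x with x | x <;> rcases y with y | y
    · exact paddedSystem_inl_inl A B C D _ x y
    · exact paddedSystem_inl_inr A B C D (by omega) x y
    · exact paddedSystem_inr_inl A B C D (by omega) x y
    · exact paddedSystem_inr_inr A B C D _ x y

end Main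

theorem mainTheorem3 (m n k r : ℕ)
    (A : Matrix (Fin n) (Fin n) ℂ[X]) (B : Matrix (Fin n) (Fin r) ℂ)
    (C : Matrix (Fin r) (Fin n) ℂ) (D : Matrix (Fin r) (Fin r) ℂ[X])
    (hA_deg : HasMatDegree A m) (hA_reg : A.det ≠ 0) (hD_deg : HasMatDegree D k)
    (a : SimpleData m n) (d : SimpleData k r) (ha : Even a.h) (hd : Even d.h) :
    IsGFPR (simplePencil A B C D a d) A B C D ∧
    (simplePencil A B C D a d).IsBlockSymmetric ∧
    (A.IsSymm → D.IsSymm → C = Bᵀ →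
      a.HasSymmetricAssignments → d.HasSymmetricAssignments →
      (simplePencil A B C D a d).toMatrix.IsSymm) ∧
    (Odd m → Odd k →
      IsRosenbrockLinearization (simplePencil A B C D a d).toMatrix (systemMatrix A B C D)) ∧
    ((Even m → IsUnit (matCoeff A m).det) → (Even k → IsUnit (matCoeff D k).det) →
      IsRosenbrockLinearization (simplePencil A B C D a d).toMatrix (systemMatrix A B C D)) := by
  exact ⟨isGFPR_simplePencil A B C D a d, isBlockSymmetric_simplePencil A B C D a d ha hd,
    fun hA hD hC ha' hd' => isSymm_simplePencil A B C D a d ha hd hA hD hC ha' hd',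
    fun hm hk => isRosenbrockLinearization_simplePencil A B C D a d hA_deg hD_deg ha hd
      (fun h => absurd h (Nat.not_even_iff_odd.2 hm))
      (fun h => absurd h (Nat.not_even_iff_odd.2 hk)),
    isRosenbrockLinearization_simplePencil A B C D a d hA_deg hD_deg ha hd⟩
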